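/- Conventions. The $J$-hierarchy is $J_0=\emptyset$, $J_{\alpha+1}=$ the closure of $J_\alpha\cup\{J_\alpha\}$ under the rudimentary functions, $J_\lambda=\bigcup_{\alpha<\lambda}J_\alpha$ for limit $\lambda$ (so $\mathrm{ON}\cap J_\alpha=\omega\cdot\alpha$), and $L_\alpha$ denotes the usual $\alpha$-th level of Gödel's constructible hierarchy. For a set $X$, a tree on $X$ is a set $T$ of finite sequences of elements of $X$ closed under initial segments; $T$ is wellfounded if it has no infinite branch, and ranked if there is a function $\rho:T\to\mathrm{ON}$ with $\rho(s)=\sup\{\rho(t)+1 : t\in T,\ s\subsetneq t\}$ for all $s\in T$. In the game on a nonempty tree $T$, players I and II alternately choose elements of $X$ (I moves first) so that the finite sequence of moves stays in $T$; the first player to leave $T$ loses. A winning strategy for a player in the game on a wellfounded tree $T$ is a tree $S\subseteq T$ containing the empty sequence such that for each $s\in S$: if it is that player's turn at $s$ (i.e. $s$ has even length for player I, odd length for player II), there is exactly one $x\in X$ with $s^\frown\langle x\rangle\in S$; otherwise, for all $x\in X$, $s^\frown\langle x\rangle\in S$ if and only if $s^\frown\langle x\rangle\in T$. Theorem. Let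 $\psi(v)$ be a $\Pi_1$ formula in the language of set theory with one free variable. Suppose that $\theta$ is the least ordinal such that $J_\theta$ satisfies: "there is a largest cardinal $\kappa$; $\psi(\kappa)$ holds; $\kappa$ is regular and uncountable; and every wellfounded tree on $\kappa$ is ranked", and let $\kappa$ be the largest cardinal of $J_\theta$. Then $L_\theta$ is a model of clopen determinacy for games on $\kappa$: for every nonempty tree $T\in L_\theta$ on $\kappa$ such that $L_\theta\models$ "$T$ is wellfounded", there is $S\in L_\theta$ which is a winning strategy for player I or for player II in the game on $T$. -/

import Mathlib

universe u

noncomputable section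

namespace ClopenGames

open FirstOrder FirstOrder.Language

/-! ### The language of set theory, and the Lévy classes `Δ₀` (= `Σ₀`) and `Π₁` -/

/-- The only symbol of the language of set theory (besides equality) is a binary relation. -/
inductive SetRel : ℕ → Type
  | mem : SetRel 2

/-- The language of set theory. -/
def setLang : FirstOrder.Language.{0, 0} := ⟨fun _ => Empty, SetRel⟩

/-- The symbol for membership. -/
def memSymb : setLang.Relations 2 := SetRel.mem

/-- Every set `M` is regarded as the structure `(M, ∈)`. -/
instance memStructure (M : ZFSet.{u}) : setLang.Structure {x : ZFSet.{u} // x ∈ M} where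
  funMap := fun f _ => Empty.elim f
  RelMap | SetRel.mem => fun v => (v 0 : ZFSet.{u}) ∈ (v 1 : ZFSet.{u})

/-- The atomic formula `y ∈ v`, where `y` is the newest bound variable and `v` is any older
variable. -/
def newestMem {α : Type} {n : ℕ} (v : α ⊕ Fin n) : setLang.BoundedFormula α (n + 1) :=
  memSymb.boundedFormula₂ (Term.var (Sum.inr (Fin.last n)))
    (Term.var (Sum.map id Fin.castSucc v))

/-- `Δ₀` formulas: all quantifiers are bounded, `∀ y ∈ v` or `∃ y ∈ v`.  (The propositional
connectives are built from `⊥` and `→`.) -/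
inductive IsDelta0 {α : Type} : ∀ {n : ℕ}, setLang.BoundedFormula α n → Prop
  | falsum {n : ℕ} : IsDelta0 (BoundedFormula.falsum : setLang.BoundedFormula α n)
  | equal {n : ℕ} (t₁ t₂ : setLang.Term (α ⊕ Fin n)) : IsDelta0 (BoundedFormula.equal t₁ t₂)
  | rel {n l : ℕ} (R : setLang.Relations l) (ts : Fin l → setLang.Term (α ⊕ Fin n)) :
      IsDelta0 (BoundedFormula.rel R ts)
  | imp {n : ℕ} {φ χ : setLang.BoundedFormula α n} :
      IsDelta0 φ → IsDelta0 χ → IsDelta0 (φ.imp χ)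
  | ball {n : ℕ} (v : α ⊕ Fin n) {φ : setLang.BoundedFormula α (n + 1)} :
      IsDelta0 φ → IsDelta0 (((newestMem v).imp φ).all)
  | bex {n : ℕ} (v : α ⊕ Fin n) {φ : setLang.BoundedFormula α (n + 1)} :
      IsDelta0 φ → IsDelta0 ((newestMem v ⊓ φ).ex)

/-- `Π₁` formulas: a block of universal quantifiers followed by a `Δ₀` formula. -/
inductive IsPi1 {α : Type} : ∀ {n : ℕ}, setLang.BoundedFormula α n → Prop
  | of_delta0 {n : ℕ} {φ : setLang.BoundedFormula α n} : IsDelta0 φ → IsPi1 φ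
  | all {n : ℕ} {φ : setLang.BoundedFormula α (n + 1)} : IsPi1 φ → IsPi1 φ.all

/-! ### Gödel's hierarchy `L_α` -/

/-- `Def M`: the subsets of `M` that are first-order definable, with parameters, over
`(M, ∈)`. -/
def defPowerset (M : ZFSet.{u}) : ZFSet.{u} :=
  ZFSet.sep
    (fun x => (Set.univ : Set {a : ZFSet.{u} // a ∈ M}).Definable₁ setLang {a | (a : ZFSet.{u}) ∈ x})
    (ZFSet.powerset M)

/-- `L_0 = ∅`, `L_{α+1} = Def(L_α)`, and `L_α` is the union of the earlier levels for limit
`α`. -/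
def godelL (α : Ordinal.{u}) : ZFSet.{u} :=
  Ordinal.limitRecOn α ∅ (fun _ M => defPowerset M)
    (fun lam _ ih => ZFSet.iUnion fun β : Set.Iio lam => ih β.1 β.2)

/-! ### Rudimentary functions and Jensen's hierarchy `J_α` -/

/-- Codes for the rudimentary functions of `n` variables. -/
inductive RudCode : ℕ → Type
  | proj {n : ℕ} (i : Fin n) : RudCode n
  | diff {n : ℕ} (i j : Fin n) : RudCode n
  | pair {n : ℕ} (i j : Fin n) : RudCode n
  | comp {m n : ℕ} (h : RudCode m) (g : Fin m → RudCode n) : RudCode n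
  | union {n : ℕ} (g : RudCode (n + 1)) : RudCode (n + 1)

/-- The rudimentary function with a given code: `x_i`, `x_i \ x_j`, `{x_i, x_j}`,
`h(g_1(x), …, g_m(x))`, and `f(y, x) = ⋃_{z ∈ y} g(z, x)`. -/
def RudCode.eval : {n : ℕ} → RudCode n → (Fin n → ZFSet.{u}) → ZFSet.{u}
  | _, .proj i, v => v i
  | _, .diff i j, v => v i \ v j
  | _, .pair i j, v => {v i, v j}
  | _, .comp h g, v => h.eval fun i => (g i).eval v
  | _, .union g, v =>
      ZFSet.iUnion fun z : {z : ZFSet.{u} // z ∈ v 0} => g.eval (Fin.cons z.1 (Fin.tail v))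

/-- The closure of a set `U` under the rudimentary functions. -/
def rudClosure (U : ZFSet.{u}) : ZFSet.{u} :=
  ZFSet.range fun p : Σ n : ℕ, RudCode n × (Fin n → {x : ZFSet.{u} // x ∈ U}) =>
    p.2.1.eval fun i => (p.2.2 i : ZFSet.{u})

/-- `J_0 = ∅`, `J_{α+1}` is the rudimentary closure of `J_α ∪ {J_α}`, and `J_α` is the union of
the earlier levels for limit `α`; thus the ordinals in `J_α` are those below `ω · α`. -/
def jensenJ (α : Ordinal.{u}) : ZFSet.{u} :=
  Ordinal.limitRecOn α ∅ (fun _ M => rudClosure (insert M M))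
    (fun lam _ ih => ZFSet.iUnion fun β : Set.Iio lam => ih β.1 β.2)

/-! ### Finite sequences and trees -/

/-- The finite sequence `⟨x_0, …, x_{n-1}⟩` as a set, namely the function
`{(0, x_0), …, (n - 1, x_{n-1})}` with domain `n`. -/
def seq (l : List ZFSet.{u}) : ZFSet.{u} :=
  ZFSet.range fun i : Fin l.length => ZFSet.pair (Ordinal.toZFSet ((i : ℕ) : Ordinal.{u})) (l.get i)

/-- The `ω`-sequence `⟨x_0, x_1, …⟩` as a set, namely a function with domain `ω`. -/
def omegaSeq (x : ℕ → ZFSet.{u}) : ZFSet.{u} :=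
  ZFSet.range fun i : ℕ => ZFSet.pair (Ordinal.toZFSet (i : Ordinal.{u})) (x i)

/-- `T` is a tree on `X`: a set of finite sequences from `X` closed under initial segments. -/
def IsTreeOn (X T : ZFSet.{u}) : Prop :=
  (∀ s ∈ T, ∃ l : List ZFSet.{u}, (∀ x ∈ l, x ∈ X) ∧ seq l = s) ∧
    ∀ l m : List ZFSet.{u}, seq (l ++ m) ∈ T → seq l ∈ T

/-- `M ⊨ "T is wellfounded"`, for a tree `T` on `X`: no infinite branch through `T` belongs to
`M`. -/
def IsWellfoundedIn (M X T : ZFSet.{u}) : Prop :=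
  ¬ ∃ x : ℕ → ZFSet.{u}, omegaSeq x ∈ M ∧ (∀ n, x n ∈ X) ∧
    ∀ n : ℕ, seq (List.ofFn fun i : Fin n => x i) ∈ T

/-- `r` is the ranking function of the tree `T`: the map `ρ` from `T` to the ordinals such that
`ρ(s) = sup {ρ(t) + 1 : t ∈ T, s ⊊ t}`, i.e. `ρ(s)` is the least strict upper bound of those
`ρ(t)`. -/
def IsRankingFunction (T r : ZFSet.{u}) : Prop :=
  ∃ ρ : ZFSet.{u} → Ordinal.{u},
    (∀ s ∈ T, IsLeast {a : Ordinal.{u} | ∀ t ∈ T, s ⊂ t → ρ t < a} (ρ s)) ∧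
    r = ZFSet.range fun s : {s : ZFSet.{u} // s ∈ T} => ZFSet.pair s.1 (ρ s.1).toZFSet

/-- `M ⊨ "T is ranked"`. -/
def IsRankedIn (M T : ZFSet.{u}) : Prop :=
  ∃ r ∈ M, IsRankingFunction T r

/-! ### Cardinals of a transitive set -/

/-- `M ⊨ "a is a cardinal"`: no function in `M` is a bijection of a smaller ordinal with `a`. -/
def IsCardinalIn (M : ZFSet.{u}) (a : Ordinal.{u}) : Prop :=
  a.toZFSet ∈ M ∧ ∀ b < a, ¬ ∃ f ∈ M, ZFSet.IsFunc b.toZFSet a.toZFSet f ∧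
    ∀ y ∈ a.toZFSet, ∃! x, ZFSet.pair x y ∈ f

/-- `M ⊨ "κ is the largest cardinal"`. -/
def IsLargestCardinalIn (M : ZFSet.{u}) (κ : Ordinal.{u}) : Prop :=
  IsGreatest {a : Ordinal.{u} | IsCardinalIn M a} κ

/-- For an infinite cardinal `κ` of `M`, `M ⊨ "κ is regular"`: every function in `M` from a smaller
ordinal to `κ` is bounded in `κ`. -/
def IsRegularIn (M : ZFSet.{u}) (κ : Ordinal.{u}) : Prop :=
  ∀ b < κ, ∀ f ∈ M, ZFSet.IsFunc b.toZFSet κ.toZFSet f →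
    ∃ c < κ, ∀ x y : ZFSet.{u}, ZFSet.pair x y ∈ f → y ∈ c.toZFSet

/-! ### The ordinal `θ` -/

/-- `M` satisfies: "`κ` is the largest cardinal, `ψ(κ)` holds, `κ` is regular and uncountable, and
every wellfounded tree on `κ` is ranked". -/
structure RanksTrees (ψ : setLang.Formula (Fin 1)) (M : ZFSet.{u}) (κ : Ordinal.{u}) : Prop where
  largest : IsLargestCardinalIn M κ
  formula : ψ.Realize (fun _ : Fin 1 => (⟨κ.toZFSet, largest.1.1⟩ : {x : ZFSet.{u} // x ∈ M}))
  regular : IsRegularIn M κ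
  uncountable : Ordinal.omega0 < κ
  ranked : ∀ T ∈ M, IsTreeOn κ.toZFSet T → IsWellfoundedIn M κ.toZFSet T → IsRankedIn M T

/-- `θ = θ^ψ`: the least ordinal such that `J_θ` has a largest cardinal `κ` as above. -/
def IsTheta (ψ : setLang.Formula (Fin 1)) (θ : Ordinal.{u}) : Prop :=
  IsLeast {α : Ordinal.{u} | ∃ κ : Ordinal.{u}, RanksTrees ψ (jensenJ α) κ} θ

/-! ### Games on trees -/

/-- The two players. -/
inductive Player
  | I
  | II

/-- Player I moves at positions of even length, player II at positions of odd length. -/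
def Player.MovesAt : Player → ℕ → Prop
  | .I, n => Even n
  | .II, n => Odd n

/-- `S` is a strategy for player `p` in the game on the tree `T` on `X` which never leaves `T`:
a subtree of `T` containing the starting position, such that at each position in `S` where it is
`p`'s turn exactly one move stays in `S`, and at the other positions in `S` all moves that are legal
in `T` stay in `S`.  In the game on a wellfounded tree such strategies are the winning ones. -/
structure IsWinningStrategy (p : Player) (X T S : ZFSet.{u}) : Prop where
  tree : IsTreeOn X S
  subset : S ⊆ T
  root : seq [] ∈ S
  own : ∀ l : List ZFSet.{u}, seq l ∈ S → p.MovesAt l.length →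
    ∃! x : ZFSet.{u}, x ∈ X ∧ seq (l ++ [x]) ∈ S
  other : ∀ l : List ZFSet.{u}, seq l ∈ S → ¬ p.MovesAt l.length →
    ∀ x ∈ X, (seq (l ++ [x]) ∈ S ↔ seq (l ++ [x]) ∈ T)

/-- `M` satisfies clopen determinacy for games on `X`: for every (nonempty) tree `T` on `X` in `M`
that is wellfounded in `M`, one of the players has a winning strategy in `M`. -/
def ClopenDeterminacyIn (M X : ZFSet.{u}) : Prop :=
  ∀ T ∈ M, IsTreeOn X T → seq [] ∈ T → IsWellfoundedIn M X T →
    ∃ p : Player, ∃ S ∈ M, IsWinningStrategy p X T S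

end ClopenGames

end

/-! Write M for J_θ. To decide a game on T it is enough to have ordinals ρ on T that drop along
proper extensions: the set W of positions won by the player to move is then reached by a monotone
recursion of length ρ(∅) + 1, and always playing the least winning move is a strategy rudimentary in
T, κ and W (`isWinningSet_winStage`, `exists_isWinningStrategy_leastStrategy`). M ranks its
wellfounded trees by assumption. Two things remain: M must be closed under such recursions of length
below θ, and J_θ must equal L_θ.

Both come down to ω·θ = θ and closure of θ under addition, and it is the ranking of trees that
yields these. Since κ is the largest cardinal of M, any ordinals α and δ of M are images, by
functions in M, of ordinals b, c ≤ κ. Pulling back the lexicographic order gives a prewellordering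
of b × c of length δ·α that is rudimentary over M. Its descending chains form a tree on κ, a pair
being spelled out as two consecutive moves. This tree is wellfounded, so M ranks it, and the rank of
the root is at least δ·α. Thus the ordinals of M are closed under multiplication
(`RanksTrees.toZFSet_mul_mem`). As they are those below ω·θ, the inequality θ < ω·θ would put θ,
hence ω·θ, into M, which is absurd. Regularity and uncountability of κ make κ a multiple of ω and
put ω into M, so that the finite sequences from κ form a set of M.

The recursion principle is proved for any continuous chain N of transitive, rudimentarily closed
sets with N_α ∈ N_{α+1} (`RudHierarchy.graph_mem`): if the step is rudimentary in parameters from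
N_{α+1}, the recursion up to ω·δ + k is an element of N_{α+δ+1}. Both α ↦ J_α and α ↦ L_{ω·α} are
such chains. Applied to each with the recursion that generates the other, the principle gives J_α ∈
L_{ω·(α+1)} and L_ξ ∈ J_{ξ+1}, whence J_θ = L_θ when ω·θ = θ. For this, a level of either hierarchy
must arise from the preceding one by ω applications of a single rudimentary step: for J this is a
finite basis of the rudimentary functions (`rudClosed_of_basisValues_subset`), for L a finite list
of operations generating the definable relations (`mem_defPowerset_iff`). -/

noncomputable section

namespace ClopenGames

open FirstOrder FirstOrder.Language

/-! ### A calculus of rudimentary functions with parameters -/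

/-- The union of the sets `g z` for `z ∈ a`. -/
def bUnion (a : ZFSet.{u}) (g : ZFSet.{u} → ZFSet.{u}) : ZFSet.{u} :=
  ZFSet.iUnion fun z : {z : ZFSet.{u} // z ∈ a} => g z.1

@[simp]
theorem mem_bUnion {a : ZFSet.{u}} {g : ZFSet.{u} → ZFSet.{u}} {x : ZFSet.{u}} :
    x ∈ bUnion a g ↔ ∃ z ∈ a, x ∈ g z := by
  simp [bUnion]

/-- Functions of `n` variables that are rudimentary in parameters from `P`. -/
inductive Rud (P : Set ZFSet.{u}) : ∀ {n : ℕ}, ((Fin n → ZFSet.{u}) → ZFSet.{u}) → Prop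
  | empty {n : ℕ} : Rud P (fun _ : Fin n → ZFSet.{u} => ∅)
  | const {n : ℕ} {c : ZFSet.{u}} : c ∈ P → Rud P (fun _ : Fin n → ZFSet.{u} => c)
  | proj {n : ℕ} (i : Fin n) : Rud P (fun v => v i)
  | diff {n : ℕ} {f g : (Fin n → ZFSet.{u}) → ZFSet.{u}} :
      Rud P f → Rud P g → Rud P (fun v => f v \ g v)
  | upair {n : ℕ} {f g : (Fin n → ZFSet.{u}) → ZFSet.{u}} :
      Rud P f → Rud P g → Rud P (fun v => ({f v, g v} : ZFSet.{u}))
  | bUnion' {n : ℕ} {f : (Fin n → ZFSet.{u}) → ZFSet.{u}} {g : (Fin (n + 1) → ZFSet.{u}) → ZFSet.{u}} :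
      Rud P f → Rud P g → Rud P (fun v => bUnion (f v) fun z => g (Fin.cons z v))

variable {P Q : Set ZFSet.{u}} {n m : ℕ}

theorem Rud.congr {f g : (Fin n → ZFSet.{u}) → ZFSet.{u}} (hf : Rud P f) (h : ∀ v, g v = f v) :
    Rud P g := by
  rwa [funext h]

theorem Rud.bUnion {f : (Fin n → ZFSet.{u}) → ZFSet.{u}}
    {g : ZFSet.{u} → (Fin n → ZFSet.{u}) → ZFSet.{u}} (hf : Rud P f)
    (hg : Rud P fun w : Fin (n + 1) → ZFSet.{u} => g (w 0) (Fin.tail w)) :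
    Rud P (fun v => bUnion (f v) fun z => g z v) :=
  (Rud.bUnion' hf hg).congr fun v => by simp

theorem Rud.reindex {f : (Fin n → ZFSet.{u}) → ZFSet.{u}} (hf : Rud P f) {m : ℕ}
    (σ : Fin n → Fin m) : Rud P (fun w => f fun i => w (σ i)) := by
  induction hf generalizing m with
  | empty => exact .empty
  | const h => exact .const h
  | proj i => exact .proj _
  | diff _ _ ih₁ ih₂ => exact .diff (ih₁ σ) (ih₂ σ)
  | upair _ _ ih₁ ih₂ => exact .upair (ih₁ σ) (ih₂ σ)
  | bUnion' _ _ ih₁ ih₂ =>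
    refine (Rud.bUnion' (ih₁ σ) (ih₂ (Fin.cons 0 fun i => (σ i).succ))).congr fun v => ?_
    beta_reduce
    congr 1
    funext z
    congr 1
    funext i
    refine Fin.cases ?_ (fun j => ?_) i <;> simp

/-- Composition is not a constructor of `Rud`, so it is pushed inwards by induction on the outer
function; under a bounded union the inner functions ignore the new variable, which sits at index 0.
-/
theorem Rud.comp {h : (Fin m → ZFSet.{u}) → ZFSet.{u}} (hh : Rud P h) {n : ℕ}
    {g : Fin m → (Fin n → ZFSet.{u}) → ZFSet.{u}} (hg : ∀ i, Rud P (g i)) :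
    Rud P (fun v => h fun i => g i v) := by
  induction hh generalizing n with
  | empty => exact .empty
  | const h => exact .const h
  | proj i => exact hg i
  | diff _ _ ih₁ ih₂ => exact .diff (ih₁ hg) (ih₂ hg)
  | upair _ _ ih₁ ih₂ => exact .upair (ih₁ hg) (ih₂ hg)
  | @bUnion' k f k' _ _ ih₁ ih₂ =>
    refine (Rud.bUnion' (ih₁ hg) (ih₂ (g := Fin.cons (fun w => w 0)
      fun i w => g i fun j => w j.succ) fun i => ?_)).congr fun v => ?_
    · refine Fin.cases ?_ (fun j => ?_) i
      · exact .proj 0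
      · exact (hg j).reindex Fin.succ
    · beta_reduce
      congr 1
      funext z
      congr 1
      funext i
      refine Fin.cases ?_ (fun j => ?_) i <;> simp

/-- Parameters that are themselves rudimentary in `Q` can be eliminated. This makes rudimentary
closure idempotent. -/
theorem Rud.subst {f : (Fin n → ZFSet.{u}) → ZFSet.{u}} (hf : Rud P f)
    (hP : ∀ c ∈ P, Rud Q (fun _ : Fin 0 → ZFSet.{u} => c)) : Rud Q f := by
  induction hf with
  | empty => exact .empty
  | const h => exact (hP _ h).reindex (n := 0) Fin.elim0
  | proj i => exact .proj i
  | diff _ _ ih₁ ih₂ => exact .diff ih₁ ih₂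
  | upair _ _ ih₁ ih₂ => exact .upair ih₁ ih₂
  | bUnion' _ _ ih₁ ih₂ => exact .bUnion' ih₁ ih₂

theorem Rud.mono {f : (Fin n → ZFSet.{u}) → ZFSet.{u}} (hf : Rud P f) (h : P ⊆ Q) : Rud Q f :=
  hf.subst fun _ hc => .const (h hc)

theorem Rud.comp₁ {h : ZFSet.{u} → ZFSet.{u}} {f : (Fin n → ZFSet.{u}) → ZFSet.{u}}
    (hh : Rud P fun v : Fin 1 → ZFSet.{u} => h (v 0)) (hf : Rud P f) :
    Rud P (fun v => h (f v)) :=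
  hh.comp (g := fun _ => f) fun _ => hf

theorem Rud.comp₂ {h : ZFSet.{u} → ZFSet.{u} → ZFSet.{u}}
    {f g : (Fin n → ZFSet.{u}) → ZFSet.{u}}
    (hh : Rud P fun v : Fin 2 → ZFSet.{u} => h (v 0) (v 1)) (hf : Rud P f) (hg : Rud P g) :
    Rud P (fun v => h (f v) (g v)) :=
  hh.comp (g := ![f, g]) fun i => by
    refine Fin.cases ?_ (fun j => ?_) i
    · exact hf
    · rw [Subsingleton.elim j 0]
      exact hg

variable {f g h : (Fin n → ZFSet.{u}) → ZFSet.{u}}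

theorem Rud.singleton (hf : Rud P f) : Rud P (fun v => ({f v} : ZFSet.{u})) :=
  (hf.upair hf).congr fun v => by ext; simp

theorem Rud.sUnion (hf : Rud P f) : Rud P (fun v => ZFSet.sUnion (f v)) :=
  (Rud.bUnion hf (.proj 0) : Rud P fun v => ClopenGames.bUnion (f v) fun z => z).congr fun v => by
    ext; simp

theorem Rud.union (hf : Rud P f) (hg : Rud P g) : Rud P (fun v => f v ∪ g v) :=
  (hf.upair hg).sUnion.congr fun v => by ext; simp

theorem Rud.inter (hf : Rud P f) (hg : Rud P g) : Rud P (fun v => f v ∩ g v) :=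
  (hf.diff (hf.diff hg)).congr fun v => by ext; simp; tauto

theorem Rud.insert (hf : Rud P f) (hg : Rud P g) : Rud P (fun v => Insert.insert (f v) (g v)) :=
  (hf.singleton.union hg).congr fun v => by ext; simp

theorem Rud.pair (hf : Rud P f) (hg : Rud P g) : Rud P (fun v => ZFSet.pair (f v) (g v)) :=
  hf.singleton.upair (hf.upair hg)

/-- The image of `a` under `g`. -/
def img (a : ZFSet.{u}) (g : ZFSet.{u} → ZFSet.{u}) : ZFSet.{u} := bUnion a fun z => {g z}

@[simp]
theorem mem_img {a : ZFSet.{u}} {g : ZFSet.{u} → ZFSet.{u}} {x : ZFSet.{u}} :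
    x ∈ img a g ↔ ∃ z ∈ a, x = g z := by
  simp [img]

theorem Rud.img {g : ZFSet.{u} → (Fin n → ZFSet.{u}) → ZFSet.{u}} (hf : Rud P f)
    (hg : Rud P fun w : Fin (n + 1) → ZFSet.{u} => g (w 0) (Fin.tail w)) :
    Rud P (fun v => img (f v) fun z => g z v) :=
  hf.bUnion (g := fun z v => {g z v}) hg.singleton

/-! ### Rudimentary relations -/

open Classical in
/-- The truth value of `p`, as the set `1` or `0`. -/
def truth (p : Prop) : ZFSet.{u} := if p then {∅} else ∅

@[simp]
theorem mem_truth {p : Prop} {x : ZFSet.{u}} : x ∈ truth p ↔ p ∧ x = ∅ := by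
  by_cases h : p <;> simp [truth, h]

/-- Relations whose characteristic function is rudimentary in parameters from `P`. -/
def RudRel (P : Set ZFSet.{u}) (R : (Fin n → ZFSet.{u}) → Prop) : Prop := Rud P fun v => truth (R v)

variable {R S : (Fin n → ZFSet.{u}) → Prop}

theorem RudRel.congr (hR : RudRel P R) (h : ∀ v, S v ↔ R v) : RudRel P S :=
  Rud.congr hR fun v => by rw [propext (h v)]

theorem RudRel.comp₂ {R : ZFSet.{u} → ZFSet.{u} → Prop}
    (hR : RudRel P fun v : Fin 2 → ZFSet.{u} => R (v 0) (v 1)) (hf : Rud P f) (hg : Rud P g) :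
    RudRel P (fun v => R (f v) (g v)) :=
  Rud.comp₂ (h := fun x y => truth (R x y)) hR hf hg

theorem RudRel.true : RudRel P (fun _ : Fin n → ZFSet.{u} => True) :=
  (Rud.empty.singleton : Rud P fun _ : Fin n → ZFSet.{u} => ({∅} : ZFSet.{u})).congr fun _ => by
    ext; simp

theorem RudRel.not (hR : RudRel P R) : RudRel P fun v => ¬ R v :=
  (Rud.diff Rud.empty.singleton hR).congr fun v => by ext; simp; tauto

theorem RudRel.and (hR : RudRel P R) (hS : RudRel P S) : RudRel P fun v => R v ∧ S v :=
  (Rud.inter hR hS).congr fun v => by ext; simp; tauto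

theorem RudRel.or (hR : RudRel P R) (hS : RudRel P S) : RudRel P fun v => R v ∨ S v :=
  (Rud.union hR hS).congr fun v => by ext; simp; tauto

theorem RudRel.imp (hR : RudRel P R) (hS : RudRel P S) : RudRel P fun v => R v → S v :=
  (hR.not.or hS).congr fun v => by tauto

theorem RudRel.iff (hR : RudRel P R) (hS : RudRel P S) : RudRel P fun v => (R v ↔ S v) :=
  ((hR.imp hS).and (hS.imp hR)).congr fun v => by tauto

theorem RudRel.bex {R : ZFSet.{u} → (Fin n → ZFSet.{u}) → Prop} (hf : Rud P f)
    (hR : RudRel P fun w : Fin (n + 1) → ZFSet.{u} => R (w 0) (Fin.tail w)) :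
    RudRel P fun v => ∃ z ∈ f v, R z v :=
  (Rud.bUnion (g := fun z v => truth (R z v)) hf hR).congr fun _ => by ext; simp; tauto

theorem RudRel.ball {R : ZFSet.{u} → (Fin n → ZFSet.{u}) → Prop} (hf : Rud P f)
    (hR : RudRel P fun w : Fin (n + 1) → ZFSet.{u} => R (w 0) (Fin.tail w)) :
    RudRel P fun v => ∀ z ∈ f v, R z v :=
  (RudRel.bex (R := fun z v => ¬ R z v) hf hR.not).not.congr fun v => by simp

/-- Equality and membership are bootstrapped from this: `a ⊆ b` says that `a \ b` is empty, equality
is mutual inclusion, and `a ∈ b` is a bounded existential over equality. -/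
theorem RudRel.eq_empty (hf : Rud P f) : RudRel P fun v => f v = ∅ :=
  (RudRel.bex (R := fun _ _ => True) hf .true).not.congr fun v => by simp [ZFSet.eq_empty]

theorem RudRel.subset (hf : Rud P f) (hg : Rud P g) : RudRel P fun v => f v ⊆ g v :=
  (RudRel.eq_empty (hf.diff hg)).congr fun v => by
    simp [ZFSet.eq_empty, ZFSet.subset_def]

theorem RudRel.eq (hf : Rud P f) (hg : Rud P g) : RudRel P fun v => f v = g v :=
  ((RudRel.subset hf hg).and (RudRel.subset hg hf)).congr fun _ =>
    ⟨fun h => h ▸ ⟨fun _ h => h, fun _ h => h⟩, fun h => antisymm h.1 h.2⟩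

theorem Rud.tail (hf : Rud P f) : Rud P fun w : Fin (n + 1) → ZFSet.{u} => f (Fin.tail w) :=
  hf.reindex Fin.succ

theorem RudRel.mem (hf : Rud P f) (hg : Rud P g) : RudRel P fun v => f v ∈ g v :=
  (RudRel.bex (R := fun z v => z = f v) hg (.eq (.proj 0) hf.tail)).congr fun v => by simp

/-- A truth value has one element or none, so a union indexed by it keeps or discards `{z}`. -/
theorem Rud.sep {R : ZFSet.{u} → (Fin n → ZFSet.{u}) → Prop} (hf : Rud P f)
    (hR : RudRel P fun w : Fin (n + 1) → ZFSet.{u} => R (w 0) (Fin.tail w)) :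
    Rud P fun v => ZFSet.sep (fun z => R z v) (f v) :=
  (Rud.bUnion (g := fun z v => ClopenGames.bUnion (truth (R z v)) fun _ => {z}) hf
    (Rud.bUnion (g := fun _ w => {w 0}) hR (Rud.proj 1).singleton)).congr fun v => by
      ext x; simp

open Classical in
theorem Rud.ite (hR : RudRel P R) (hf : Rud P f) (hg : Rud P g) :
    Rud P fun v => if R v then f v else g v :=
  ((Rud.bUnion (g := fun _ v => f v) hR hf.tail).union
    (Rud.bUnion (g := fun _ v => g v) hR.not hg.tail)).congr fun v => by
      by_cases h : R v <;> ext <;> simp [h]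

/-! ### Ordered pairs and functions -/

theorem mem_sUnion_sUnion_of_pair_mem {x y a : ZFSet.{u}} (h : ZFSet.pair x y ∈ a) :
    x ∈ ZFSet.sUnion (ZFSet.sUnion a) ∧ y ∈ ZFSet.sUnion (ZFSet.sUnion a) := by
  simp only [ZFSet.mem_sUnion]
  exact ⟨⟨{x, y}, ⟨_, h, by simp [ZFSet.pair]⟩, by simp⟩,
    ⟨{x, y}, ⟨_, h, by simp [ZFSet.pair]⟩, by simp⟩⟩

theorem mem_sUnion_pair {x y z : ZFSet.{u}} :
    z ∈ ZFSet.sUnion (ZFSet.pair x y) ↔ z = x ∨ z = y := by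
  simp [ZFSet.pair]

/-- The first component of an ordered pair. -/
def fst (p : ZFSet.{u}) : ZFSet.{u} :=
  ZFSet.sUnion <| ZFSet.sep (fun x => ∃ y ∈ ZFSet.sUnion p, p = ZFSet.pair x y) (ZFSet.sUnion p)

/-- The second component of an ordered pair. -/
def snd (p : ZFSet.{u}) : ZFSet.{u} :=
  ZFSet.sUnion <| ZFSet.sep (fun y => ∃ x ∈ ZFSet.sUnion p, p = ZFSet.pair x y) (ZFSet.sUnion p)

@[simp]
theorem fst_pair (x y : ZFSet.{u}) : fst (ZFSet.pair x y) = x := by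
  ext z
  rw [fst, ZFSet.mem_sUnion]
  simp only [ZFSet.mem_sep, mem_sUnion_pair, ZFSet.pair_inj]
  exact ⟨fun ⟨_, ⟨_, _, _, h, _⟩, hz⟩ => h ▸ hz, fun h => ⟨x, ⟨.inl rfl, y, .inr rfl, rfl, rfl⟩, h⟩⟩

@[simp]
theorem snd_pair (x y : ZFSet.{u}) : snd (ZFSet.pair x y) = y := by
  ext z
  rw [snd, ZFSet.mem_sUnion]
  simp only [ZFSet.mem_sep, mem_sUnion_pair, ZFSet.pair_inj]
  exact ⟨fun ⟨_, ⟨_, _, _, _, h⟩, hz⟩ => h ▸ hz, fun h => ⟨y, ⟨.inr rfl, x, .inl rfl, rfl, rfl⟩, h⟩⟩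

theorem Rud.fst (hf : Rud P f) : Rud P fun v => fst (f v) :=
  Rud.comp₁ (h := ClopenGames.fst) (.sUnion (.sep (R := fun x v => ∃ y ∈ ZFSet.sUnion (v 0), v 0 = ZFSet.pair x y)
    (Rud.proj 0).sUnion
    (.bex (R := fun y w => Fin.tail w 0 = ZFSet.pair (w 0) y) (Rud.proj 1).sUnion
      (.eq (.proj 2) (.pair (.proj 1) (.proj 0)))))) hf

theorem Rud.snd (hf : Rud P f) : Rud P fun v => snd (f v) :=
  Rud.comp₁ (h := ClopenGames.snd) (.sUnion (.sep (R := fun x v => ∃ y ∈ ZFSet.sUnion (v 0), v 0 = ZFSet.pair y x)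
    (Rud.proj 0).sUnion
    (.bex (R := fun y w => Fin.tail w 0 = ZFSet.pair y (w 0)) (Rud.proj 1).sUnion
      (.eq (.proj 2) (.pair (.proj 0) (.proj 1)))))) hf

/-- `p` is an ordered pair. -/
def IsPair (p : ZFSet.{u}) : Prop := p = ZFSet.pair (fst p) (snd p)

@[simp]
theorem isPair_pair (x y : ZFSet.{u}) : IsPair (ZFSet.pair x y) := by simp [IsPair]

theorem isPair_iff {p : ZFSet.{u}} : IsPair p ↔ ∃ x y, p = ZFSet.pair x y :=
  ⟨fun h => ⟨_, _, h⟩, by rintro ⟨x, y, rfl⟩; simp⟩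

theorem RudRel.isPair (hf : Rud P f) : RudRel P fun v => IsPair (f v) :=
  RudRel.eq hf (hf.fst.pair hf.snd)

/-- The domain of a binary relation. -/
def dom (r : ZFSet.{u}) : ZFSet.{u} := img (ZFSet.sep IsPair r) fst

/-- The range of a binary relation. -/
def ran (r : ZFSet.{u}) : ZFSet.{u} := img (ZFSet.sep IsPair r) snd

@[simp]
theorem mem_dom {r x : ZFSet.{u}} : x ∈ dom r ↔ ∃ y, ZFSet.pair x y ∈ r := by
  simp only [dom, mem_img, ZFSet.mem_sep, isPair_iff]
  constructor
  · rintro ⟨_, ⟨hz, a, b, rfl⟩, rfl⟩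
    exact ⟨b, by simpa using hz⟩
  · rintro ⟨y, hy⟩
    exact ⟨_, ⟨hy, _, _, rfl⟩, by simp⟩

@[simp]
theorem mem_ran {r y : ZFSet.{u}} : y ∈ ran r ↔ ∃ x, ZFSet.pair x y ∈ r := by
  simp only [ran, mem_img, ZFSet.mem_sep, isPair_iff]
  constructor
  · rintro ⟨_, ⟨hz, a, b, rfl⟩, rfl⟩
    exact ⟨a, by simpa using hz⟩
  · rintro ⟨y, hy⟩
    exact ⟨_, ⟨hy, _, _, rfl⟩, by simp⟩

theorem Rud.sepPairs (hf : Rud P f) : Rud P fun v => ZFSet.sep IsPair (f v) :=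
  Rud.sep (R := fun z _ => IsPair z) hf (.isPair (.proj 0))

theorem Rud.dom (hf : Rud P f) : Rud P fun v => dom (f v) :=
  Rud.img (g := fun z _ => ClopenGames.fst z) hf.sepPairs (.fst (.proj 0))

theorem Rud.ran (hf : Rud P f) : Rud P fun v => ran (f v) :=
  Rud.img (g := fun z _ => ClopenGames.snd z) hf.sepPairs (.snd (.proj 0))

/-- The value of the function `r` at `x`. -/
def app (r x : ZFSet.{u}) : ZFSet.{u} := ZFSet.sUnion <| ZFSet.sep (fun y => ZFSet.pair x y ∈ r) (ran r)

theorem app_eq {r x y : ZFSet.{u}} (h : ∀ z, ZFSet.pair x z ∈ r ↔ z = y) : app r x = y := by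
  ext w
  simp only [app, ZFSet.mem_sUnion, ZFSet.mem_sep, h, mem_ran]
  constructor
  · rintro ⟨_, ⟨-, rfl⟩, hw⟩
    exact hw
  · exact fun hw => ⟨y, ⟨⟨x, (h y).2 rfl⟩, rfl⟩, hw⟩

theorem Rud.app (hf : Rud P f) (hg : Rud P g) : Rud P fun v => app (f v) (g v) :=
  .sUnion (.sep (R := fun y v => ZFSet.pair (g v) y ∈ f v) hf.ran
    (.mem (.pair hg.tail (.proj 0)) hf.tail))

theorem Rud.prod (hf : Rud P f) (hg : Rud P g) : Rud P fun v => ZFSet.prod (f v) (g v) :=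
  (Rud.bUnion (g := fun x v => ClopenGames.img (g v) fun y => ZFSet.pair x y) hf
    (.img (g := fun y w => ZFSet.pair (w 0) y) hg.tail (.pair (.proj 1) (.proj 0)))).congr
    fun v => by ext; simp

/-- The restriction of the function `r` to the set `a`. -/
def restr (r a : ZFSet.{u}) : ZFSet.{u} := ZFSet.sep (fun p => fst p ∈ a) r

theorem Rud.restr (hf : Rud P f) (hg : Rud P g) : Rud P fun v => restr (f v) (g v) :=
  .sep (R := fun p v => ClopenGames.fst p ∈ g v) hf (.mem (.fst (.proj 0)) hg.tail)

/-! ### Codes and rudimentary closure -/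

theorem RudCode.rud (c : RudCode n) : Rud P (c.eval (n := n)) := by
  induction c with
  | proj i => exact .proj i
  | diff i j => exact .diff (.proj i) (.proj j)
  | pair i j => exact .upair (.proj i) (.proj j)
  | comp h g ihh ihg => exact ihh.comp ihg
  | @union n g ih =>
    refine (Rud.bUnion' (.proj 0) (ih.reindex (Fin.cons 0 fun i : Fin n => i.succ.succ))).congr
      fun v => ?_
    simp only [RudCode.eval, ClopenGames.bUnion]
    congr 1
    funext z
    congr 1
    funext i
    refine Fin.cases ?_ (fun j => ?_) i <;> simp [Fin.tail]

theorem RudCode.pos (c : RudCode n) : 0 < n := by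
  induction c with
  | proj i => exact i.pos
  | diff i j => exact i.pos
  | pair i j => exact i.pos
  | comp h g ihh ihg => exact ihg ⟨0, ihh⟩
  | union g ih => exact Nat.succ_pos _

/-- The code `c` with variables renamed along `σ`. -/
def RudCode.rename (c : RudCode n) (σ : Fin n → Fin m) : RudCode m := .comp c fun i => .proj (σ i)

@[simp]
theorem RudCode.eval_rename (c : RudCode n) (σ : Fin n → Fin m) (v : Fin m → ZFSet.{u}) :
    (c.rename σ).eval v = c.eval fun i => v (σ i) := by
  simp [RudCode.rename, RudCode.eval]

theorem RudCode.eval_union (c : RudCode (n + 1)) (v : Fin (n + 1) → ZFSet.{u}) :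
    (RudCode.union c).eval v = bUnion (v 0) fun z => c.eval (Fin.cons z (Fin.tail v)) := rfl

-- Codes have neither constants nor the empty function, so parameters become additional variables
-- and `∅` becomes `p \ p` for a parameter `p`; hence the assumption that `P` is nonempty.
open Classical in
theorem Rud.exists_code (hP : P.Nonempty) (hf : Rud P f) :
    ∃ (k : ℕ) (c : RudCode k) (σ : Fin k → P ⊕ Fin n),
      ∀ v, f v = c.eval fun i => Sum.elim Subtype.val v (σ i) := by
  induction hf with
  | empty =>
    obtain ⟨p, hp⟩ := hP
    exact ⟨1, .diff 0 0, fun _ => .inl ⟨p, hp⟩, fun v => by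
      simp [RudCode.eval, ZFSet.ext_iff]⟩
  | @const n c hc => exact ⟨1, .proj 0, fun _ => .inl ⟨c, hc⟩, fun v => by simp [RudCode.eval]⟩
  | proj i => exact ⟨1, .proj 0, fun _ => .inr i, fun v => by simp [RudCode.eval]⟩
  | diff _ _ ih₁ ih₂ =>
    obtain ⟨k₁, c₁, σ₁, h₁⟩ := ih₁
    obtain ⟨k₂, c₂, σ₂, h₂⟩ := ih₂
    refine ⟨k₁ + k₂, .comp (.diff 0 1) ![c₁.rename (Fin.castAdd k₂), c₂.rename (Fin.natAdd k₁)],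
      Fin.append σ₁ σ₂, fun v => ?_⟩
    simp [RudCode.eval, h₁, h₂]
  | upair _ _ ih₁ ih₂ =>
    obtain ⟨k₁, c₁, σ₁, h₁⟩ := ih₁
    obtain ⟨k₂, c₂, σ₂, h₂⟩ := ih₂
    refine ⟨k₁ + k₂, .comp (.pair 0 1) ![c₁.rename (Fin.castAdd k₂), c₂.rename (Fin.natAdd k₁)],
      Fin.append σ₁ σ₂, fun v => ?_⟩
    simp [RudCode.eval, h₁, h₂]
  | @bUnion' n f g _ _ ih₁ ih₂ =>
    obtain ⟨k₁, c₁, σ₁, h₁⟩ := ih₁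
    obtain ⟨k₂, c₂, σ₂, h₂⟩ := ih₂
    have hk : 0 < k₁ := c₁.pos
    -- The coded union binds variable 0, so every variable of `c₂` that stands for the bound element
    -- is renamed to 0. The slots left behind are never read; they are filled with the first
    -- argument of `c₁`, which exists because codes have positive arity.
    refine ⟨k₁ + k₂, .comp (.union (c₂.rename fun i => if σ₂ i = .inr 0 then 0 else i.succ))
      (Fin.cons (c₁.rename (Fin.castAdd k₂)) fun i => .proj (Fin.natAdd k₁ i)),
      Fin.append σ₁ fun i => Sum.elim .inl (Fin.cases (σ₁ ⟨0, hk⟩) .inr) (σ₂ i), fun v => ?_⟩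
    have h₀ : (c₁.rename (Fin.castAdd k₂)).eval (fun i => Sum.elim Subtype.val v (Fin.append σ₁
        (fun i => Sum.elim .inl (Fin.cases (σ₁ ⟨0, hk⟩) .inr) (σ₂ i)) i)) = f v := by
      simp [h₁]
    rw [RudCode.eval, RudCode.eval_union, Fin.cons_zero, h₀]
    simp only [RudCode.eval_rename, h₂]
    congr 1
    funext z
    congr 1
    funext i
    rcases h : σ₂ i with p | j
    · simp [Fin.tail, RudCode.eval, h]
    · refine Fin.cases (fun h => ?_) (fun j h => ?_) j h
      · simp
      · simp [Fin.tail, RudCode.eval, h]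

theorem mem_rudClosure {U x : ZFSet.{u}} (hU : ∃ y, y ∈ U) :
    x ∈ rudClosure U ↔ Rud {y | y ∈ U} fun _ : Fin 0 → ZFSet.{u} => x := by
  simp only [rudClosure, ZFSet.mem_range, Sigma.exists, Prod.exists]
  constructor
  · rintro ⟨k, c, p, rfl⟩
    exact c.rud.comp (g := fun i _ => (p i).1) fun i => .const (p i).2
  · intro h
    obtain ⟨k, c, σ, hc⟩ := h.exists_code hU
    exact ⟨k, c, fun i => Sum.elim (fun y => ⟨y.1, y.2⟩) Fin.elim0 (σ i), by
      rw [hc Fin.elim0]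
      congr 1
      funext i
      rcases h : σ i with p | j
      · simp [h]
      · exact j.elim0⟩

/-- `M` is closed under the functions that are rudimentary in parameters from `M`. -/
def RudClosed (M : ZFSet.{u}) : Prop :=
  ∀ x : ZFSet.{u}, Rud {y | y ∈ M} (fun _ : Fin 0 → ZFSet.{u} => x) → x ∈ M

theorem RudClosed.mem {M : ZFSet.{u}} (hM : RudClosed M) {f : (Fin n → ZFSet.{u}) → ZFSet.{u}}
    (hf : Rud {y | y ∈ M} f) {v : Fin n → ZFSet.{u}} (hv : ∀ i, v i ∈ M) : f v ∈ M :=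
  hM _ (hf.comp (g := fun i _ => v i) fun i => .const (hv i))

theorem rudClosed_rudClosure {U : ZFSet.{u}} (hU : ∃ y, y ∈ U) : RudClosed (rudClosure U) :=
  fun _ hx => (mem_rudClosure hU).2 (hx.subst fun _ hc => (mem_rudClosure hU).1 hc)

theorem subset_rudClosure {U : ZFSet.{u}} : U ⊆ rudClosure U := fun x hx =>
  (mem_rudClosure ⟨x, hx⟩).2 (.const hx)

/-! ### Recursion along hierarchies of rudimentarily closed sets -/

section
variable {P : Set ZFSet.{u}} {n : ℕ} {f g : (Fin n → ZFSet.{u}) → ZFSet.{u}}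

theorem RudRel.isTransitive (hf : Rud P f) : RudRel P fun v => (f v).IsTransitive :=
  .ball (R := fun y v => y ⊆ f v) hf (.subset (.proj 0) hf.tail)

theorem RudRel.isOrdinal (hf : Rud P f) : RudRel P fun v => (f v).IsOrdinal :=
  ((RudRel.isTransitive hf).and (.ball (R := fun y _ => y.IsTransitive) hf
    (.isTransitive (.proj 0)))).congr fun _ => ZFSet.isOrdinal_iff_forall_mem_isTransitive

end

/-- The restriction of the ordinal function `F` to `δ`, as a set. -/
def graph (F : Ordinal.{u} → ZFSet.{u}) (δ : Ordinal.{u}) : ZFSet.{u} :=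
  ZFSet.range fun ξ : Set.Iio δ => ZFSet.pair ξ.1.toZFSet (F ξ.1)

section
variable {F : Ordinal.{u} → ZFSet.{u}} {G : ZFSet.{u} → ZFSet.{u}}

@[simp]
theorem mem_graph {δ : Ordinal.{u}} {p : ZFSet.{u}} :
    p ∈ graph F δ ↔ ∃ ξ < δ, p = ZFSet.pair ξ.toZFSet (F ξ) := by
  simp only [graph, ZFSet.mem_range, Subtype.exists, Set.mem_Iio, exists_prop, eq_comm]

theorem pair_mem_graph {δ ξ : Ordinal.{u}} {y : ZFSet.{u}} :
    ZFSet.pair ξ.toZFSet y ∈ graph F δ ↔ ξ < δ ∧ y = F ξ := by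
  simp only [mem_graph, ZFSet.pair_inj, Ordinal.toZFSet_injective.eq_iff]
  exact ⟨fun ⟨_, h, rfl, hy⟩ => ⟨h, hy⟩, fun ⟨h, hy⟩ => ⟨ξ, h, rfl, hy⟩⟩

@[simp]
theorem dom_graph (δ : Ordinal.{u}) : dom (graph F δ) = δ.toZFSet := by
  ext x
  simp only [mem_dom, mem_graph, ZFSet.pair_inj, Ordinal.mem_toZFSet_iff]
  exact ⟨fun ⟨_, ξ, h, hx, _⟩ => ⟨ξ, h, hx.symm⟩, fun ⟨ξ, h, hx⟩ => ⟨_, ξ, h, hx.symm, rfl⟩⟩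

theorem app_graph {δ ξ : Ordinal.{u}} (h : ξ < δ) : app (graph F δ) ξ.toZFSet = F ξ :=
  app_eq fun z => by simp [pair_mem_graph, h, -mem_graph]

theorem restr_graph {δ ξ : Ordinal.{u}} (h : ξ ≤ δ) :
    restr (graph F δ) ξ.toZFSet = graph F ξ := by
  ext p
  simp only [restr, ZFSet.mem_sep, mem_graph]
  constructor
  · rintro ⟨⟨ζ, -, rfl⟩, h⟩
    rw [fst_pair, Ordinal.toZFSet_mem_toZFSet_iff] at h
    exact ⟨ζ, h, rfl⟩
  · rintro ⟨ζ, hζ, rfl⟩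
    refine ⟨⟨ζ, hζ.trans_le h, rfl⟩, ?_⟩
    rwa [fst_pair, Ordinal.toZFSet_mem_toZFSet_iff]

/-- `g` is an initial segment of the function defined by recursion with step `G`. -/
def IsAttempt (G : ZFSet.{u} → ZFSet.{u}) (g : ZFSet.{u}) : Prop :=
  (dom g).IsOrdinal ∧ ∀ p ∈ g, IsPair p ∧ snd p = G (restr g (fst p))

theorem RudRel.isAttempt {P : Set ZFSet.{u}} {n : ℕ} {f : (Fin n → ZFSet.{u}) → ZFSet.{u}}
    (hG : Rud P fun v : Fin 1 → ZFSet.{u} => G (v 0)) (hf : Rud P f) :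
    RudRel P fun v => IsAttempt G (f v) :=
  .and (.isOrdinal hf.dom) <| .ball (R := fun p v => IsPair p ∧ snd p = G (restr (f v) (fst p))) hf <|
    .and (.isPair (.proj 0)) (.eq (.snd (.proj 0)) (hG.comp₁ (.restr hf.tail (.fst (.proj 0)))))

/-- Being an initial segment of the recursion is checked locally: the domain is an ordinal and each
value is the step applied to the restriction below it. So attempts are recognised by a rudimentary
relation whenever the step is rudimentary. -/
theorem isAttempt_iff (hF : ∀ δ, F δ = G (graph F δ)) {g : ZFSet.{u}} :
    IsAttempt G g ↔ ∃ δ, g = graph F δ := by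
  constructor
  · rintro ⟨ho, hg⟩
    obtain ⟨δ, hδ⟩ := ZFSet.isOrdinal_iff_mem_range_toZFSet.1 ho
    refine ⟨δ, ?_⟩
    have key : ∀ ξ < δ, ∀ y, ZFSet.pair ξ.toZFSet y ∈ g ↔ y = F ξ := by
      intro ξ
      induction ξ using WellFoundedLT.induction with
      | ind ξ ih =>
        intro hξ
        have hr : restr g ξ.toZFSet = graph F ξ := by
          ext p
          simp only [restr, ZFSet.mem_sep, mem_graph]
          constructor
          · rintro ⟨hp, hp'⟩
            obtain ⟨ζ, hζ, hζp⟩ := Ordinal.mem_toZFSet_iff.1 hp'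
            have : p = ZFSet.pair ζ.toZFSet (snd p) := by
              rw [hζp]; exact (hg p hp).1
            rw [this, ih ζ hζ (hζ.trans hξ)] at hp
            exact ⟨ζ, hζ, by rw [this, hp]⟩
          · rintro ⟨ζ, hζ, rfl⟩
            refine ⟨(ih ζ hζ (hζ.trans hξ) _).2 rfl, ?_⟩
            rwa [fst_pair, Ordinal.toZFSet_mem_toZFSet_iff]
        have hval : ∀ y, ZFSet.pair ξ.toZFSet y ∈ g → y = F ξ := fun y hy => by
          have := (hg _ hy).2
          rwa [fst_pair, snd_pair, hr, ← hF] at this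
        refine fun y => ⟨hval y, ?_⟩
        rintro rfl
        have : ξ.toZFSet ∈ dom g := by rwa [← hδ, Ordinal.toZFSet_mem_toZFSet_iff]
        obtain ⟨y, hy⟩ := mem_dom.1 this
        rwa [← hval y hy]
    ext p
    rw [mem_graph]
    constructor
    · intro hp
      have hp' := (hg p hp).1
      have : fst p ∈ dom g := mem_dom.2 ⟨snd p, by rwa [← hp']⟩
      rw [← hδ] at this
      obtain ⟨ξ, hξ, hξp⟩ := Ordinal.mem_toZFSet_iff.1 this
      have h : p = ZFSet.pair ξ.toZFSet (snd p) := by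
        rw [hξp]; exact hp'
      rw [h, key ξ hξ] at hp
      exact ⟨ξ, hξ, by rw [h, hp]⟩
    · rintro ⟨ξ, hξ, rfl⟩
      exact (key ξ hξ _).2 rfl
  · rintro ⟨δ, rfl⟩
    refine ⟨by simpa using ZFSet.isOrdinal_toZFSet δ, fun p hp => ?_⟩
    obtain ⟨ξ, hξ, rfl⟩ := mem_graph.1 hp
    rw [fst_pair, snd_pair, restr_graph hξ.le, ← hF]
    simp

theorem graph_add_one (ξ : Ordinal.{u}) :
    graph F (ξ + 1) = insert (ZFSet.pair ξ.toZFSet (F ξ)) (graph F ξ) := by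
  ext p
  simp only [mem_graph, ZFSet.mem_insert_iff, Order.lt_add_one_iff, le_iff_eq_or_lt]
  grind

end

/-- An increasing continuous sequence of transitive sets, each an element of the next and, apart from
the one with index `0`, closed under rudimentary functions. -/
structure RudHierarchy (N : Ordinal.{u} → ZFSet.{u}) : Prop where
  trans : ∀ α, (N α).IsTransitive
  mono : ∀ {α β}, α ≤ β → N α ⊆ N β
  mem_add_one : ∀ α, N α ∈ N (α + 1)
  closed : ∀ α, 0 < α → RudClosed (N α)
  exists_lt : ∀ {α x}, Order.IsSuccLimit α → x ∈ N α → ∃ β < α, x ∈ N β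

theorem exists_eq_omega0_mul_add {ξ δ : Ordinal.{u}} (h : ξ < Ordinal.omega0 * δ) :
    ∃ η < δ, ∃ k : ℕ, ξ = Ordinal.omega0 * η + k := by
  refine ⟨ξ / Ordinal.omega0, ?_, ?_⟩
  · rwa [← Ordinal.lt_mul_iff_div_lt Ordinal.omega0_ne_zero]
  · obtain ⟨k, hk⟩ := Ordinal.lt_omega0.1 (Ordinal.mod_lt ξ Ordinal.omega0_ne_zero)
    exact ⟨k, by rw [← hk, Ordinal.div_add_mod]⟩

/-! ### Transfinite recursion inside a hierarchy -/

namespace RudHierarchy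

variable {N : Ordinal.{u} → ZFSet.{u}} {F : Ordinal.{u} → ZFSet.{u}}
  {G : ZFSet.{u} → ZFSet.{u}}

/-- Each level accommodates ω further stages: a successor stage costs one rudimentary operation, and
at `ω · δ` one takes the union of the attempts found in `N (α + δ)`, which is itself an element of
the next level. -/
theorem graph_mem (hN : RudHierarchy N) (hF : ∀ δ, F δ = G (graph F δ)) {α : Ordinal.{u}}
    (hG : Rud {x | x ∈ N (α + 1)} fun v : Fin 1 → ZFSet.{u} => G (v 0)) (δ : Ordinal.{u}) (k : ℕ) :
    graph F (Ordinal.omega0 * δ + k) ∈ N (α + δ + 1) := by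
  induction δ using WellFoundedLT.induction generalizing k with
  | ind δ ihδ =>
    have hM : RudClosed (N (α + δ + 1)) := hN.closed _ (by simp)
    have hG' : Rud {x | x ∈ N (α + δ + 1)} fun v : Fin 1 → ZFSet.{u} => G (v 0) :=
      hG.mono fun x hx => hN.mono (by gcongr; exact le_self_add) hx
    induction k with
    | succ k ihk =>
      rw [Nat.cast_succ, ← add_assoc, graph_add_one]
      have := hM.mem (f := fun v : Fin 1 → ZFSet.{u} => insert (ZFSet.pair (dom (v 0)) (G (v 0))) (v 0))
        (.insert (.pair (.dom (.proj 0)) hG') (.proj 0)) (v := fun _ => _) fun _ => ihk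
      simpa [← hF] using this
    | zero =>
      rw [Nat.cast_zero, add_zero]
      -- The case `δ = 0` is separate because `N (α + δ)` could then be `N 0`, which need not be
      -- rudimentarily closed.
      rcases eq_or_ne δ 0 with rfl | hδ
      · have : graph F 0 = ∅ := by
          rw [ZFSet.eq_empty]
          intro y
          simp
        rw [mul_zero, this]
        exact hM _ .empty
      have hlow : ∀ ξ < Ordinal.omega0 * δ, graph F ξ ∈ N (α + δ) := by
        intro ξ hξ
        obtain ⟨η, hη, k, rfl⟩ := exists_eq_omega0_mul_add hξ
        refine hN.mono ?_ (ihδ η hη k)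
        rw [add_assoc]
        gcongr
        exact Order.add_one_le_of_lt hη
      -- The union of the attempts in `N (α + δ)` would overshoot if one of them were longer than `ω
      -- · δ`. As soon as one has length at least `ω · δ`, its restriction gives the required graph
      -- already at this level.
      by_cases hbig : ∃ ξ, Ordinal.omega0 * δ ≤ ξ ∧ graph F ξ ∈ N (α + δ)
      · obtain ⟨ξ, hξ, hmem⟩ := hbig
        have hC : RudClosed (N (α + δ)) := hN.closed _ (by
          exact (pos_iff_ne_zero.2 hδ).trans_le le_add_self)
        refine hN.mono (α := α + δ) le_self_add ?_
        rcases hξ.eq_or_lt with rfl | hlt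
        · exact hmem
        · rw [← restr_graph hξ]
          have hd : dom (graph F ξ) ∈ N (α + δ) := hC _ (.dom (.const hmem))
          rw [dom_graph] at hd
          exact hC _ (.restr (.const hmem) (.const
            (hN.trans _ _ hd (Ordinal.toZFSet_mem_toZFSet_iff.2 hlt))))
      · have : graph F (Ordinal.omega0 * δ) =
            ZFSet.sUnion (ZFSet.sep (fun g => IsAttempt G g) (N (α + δ))) := by
          ext p
          simp only [ZFSet.mem_sUnion, ZFSet.mem_sep, isAttempt_iff hF]
          constructor
          · intro hp
            obtain ⟨ξ, hξ, rfl⟩ := mem_graph.1 hp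
            have hlim : ξ + 1 < Ordinal.omega0 * δ := by
              obtain ⟨η, hη, k, rfl⟩ := exists_eq_omega0_mul_add hξ
              calc Ordinal.omega0 * η + k + 1 = Ordinal.omega0 * η + ((k + 1 : ℕ) : Ordinal) := by
                    rw [Nat.cast_succ, add_assoc]
                _ < Ordinal.omega0 * η + Ordinal.omega0 := by
                    gcongr
                    exact Ordinal.natCast_lt_omega0 _
                _ = Ordinal.omega0 * (η + 1) := by rw [mul_add, mul_one]
                _ ≤ _ := by
                    gcongr
                    exact Order.add_one_le_of_lt hη
            exact ⟨_, ⟨hlow _ hlim, _, rfl⟩, mem_graph.2 ⟨ξ, by simp, rfl⟩⟩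
          · rintro ⟨_, ⟨hg, ξ, rfl⟩, hp⟩
            obtain ⟨ζ, hζ, rfl⟩ := mem_graph.1 hp
            refine mem_graph.2 ⟨ζ, hζ.trans ?_, rfl⟩
            by_contra hle
            exact hbig ⟨ξ, not_lt.1 hle, hg⟩
        rw [this]
        exact hM _ (.sUnion (.sep (R := fun g _ => IsAttempt G g) (.const (hN.mem_add_one _))
          (.isAttempt hG' (.proj 0))))

theorem value_mem (hN : RudHierarchy N) (hF : ∀ δ, F δ = G (graph F δ)) {α : Ordinal.{u}}
    (hG : Rud {x | x ∈ N (α + 1)} fun v : Fin 1 → ZFSet.{u} => G (v 0)) (δ : Ordinal.{u}) (k : ℕ) :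
    F (Ordinal.omega0 * δ + k) ∈ N (α + δ + 1) := by
  rw [hF]
  exact (hN.closed _ (by simp)).mem (f := fun v : Fin 1 → ZFSet.{u} => G (v 0))
    (hG.mono fun x hx => hN.mono (by gcongr; exact le_self_add) hx)
    fun _ => hN.graph_mem hF hG δ k

end RudHierarchy

/-- The function defined by recursion with step `G`. -/
def recFun (G : ZFSet.{u} → ZFSet.{u}) (δ : Ordinal.{u}) : ZFSet.{u} :=
  G (ZFSet.range fun ξ : Set.Iio δ => ZFSet.pair ξ.1.toZFSet (recFun G ξ.1))
termination_by δ
decreasing_by exact ξ.2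

theorem recFun_eq (G : ZFSet.{u} → ZFSet.{u}) (δ : Ordinal.{u}) :
    recFun G δ = G (graph (recFun G) δ) := by
  rw [recFun, graph]

/-- The step of the recursion `F δ = ⋃_{ξ < δ} S (F ξ)`. -/
def accStep (S : ZFSet.{u} → ZFSet.{u}) (g : ZFSet.{u}) : ZFSet.{u} := bUnion (ran g) S

theorem Rud.accStep {P : Set ZFSet.{u}} {S : ZFSet.{u} → ZFSet.{u}}
    (hS : Rud P fun v : Fin 1 → ZFSet.{u} => S (v 0)) :
    Rud P fun v : Fin 1 → ZFSet.{u} => accStep S (v 0) :=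
  Rud.bUnion (g := fun x _ => S x) (.ran (.proj 0)) (hS.comp₁ (.proj 0))

theorem mem_recFun_accStep {S : ZFSet.{u} → ZFSet.{u}} {δ : Ordinal.{u}} {x : ZFSet.{u}} :
    x ∈ recFun (accStep S) δ ↔ ∃ ξ < δ, x ∈ S (recFun (accStep S) ξ) := by
  rw [recFun_eq]
  simp only [accStep, mem_bUnion, mem_ran, mem_graph, ZFSet.pair_inj]
  constructor
  · rintro ⟨_, ⟨_, ξ, hξ, -, rfl⟩, hx⟩
    exact ⟨ξ, hξ, hx⟩
  · rintro ⟨ξ, hξ, hx⟩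
    exact ⟨_, ⟨_, ξ, hξ, rfl, rfl⟩, hx⟩

/-! ### The `J`-hierarchy -/

@[simp]
theorem jensenJ_zero : jensenJ (0 : Ordinal.{u}) = ∅ := by
  simp [jensenJ]

theorem jensenJ_add_one (α : Ordinal.{u}) :
    jensenJ (α + 1) = rudClosure (insert (jensenJ α) (jensenJ α)) := by
  simp [jensenJ]

theorem mem_jensenJ_limit {α : Ordinal.{u}} (h : Order.IsSuccLimit α) {x : ZFSet.{u}} :
    x ∈ jensenJ α ↔ ∃ β < α, x ∈ jensenJ β := by
  rw [jensenJ, Ordinal.limitRecOn_limit _ _ _ _ h]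
  simp [jensenJ]

theorem insert_self_subset_rudClosure (M : ZFSet.{u}) : M ⊆ rudClosure (insert M M) :=
  fun _ hx => subset_rudClosure (ZFSet.mem_insert_of_mem _ hx)

theorem self_mem_rudClosure (M : ZFSet.{u}) : M ∈ rudClosure (insert M M) :=
  subset_rudClosure (ZFSet.mem_insert _ _)

theorem exists_mem_insert (M : ZFSet.{u}) : ∃ y, y ∈ (insert M M : ZFSet.{u}) :=
  ⟨M, ZFSet.mem_insert _ _⟩

theorem jensenJ_mono {α β : Ordinal.{u}} (h : α ≤ β) : jensenJ α ⊆ jensenJ β := by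
  induction β using Ordinal.limitRecOn generalizing α with
  | zero =>
    rw [nonpos_iff_eq_zero.1 h]
  | add_one β ih =>
    rcases h.eq_or_lt with rfl | h
    · exact fun _ h => h
    · intro x hx
      rw [jensenJ_add_one]
      exact insert_self_subset_rudClosure _ (ih (Order.lt_add_one_iff.1 h) hx)
  | limit β hβ ih =>
    rcases h.eq_or_lt with rfl | h
    · exact fun _ h => h
    · exact fun x hx => (mem_jensenJ_limit hβ).2 ⟨α, h, hx⟩

/-- If every set built from parameters in `P` is hereditarily so on `P`, then rudimentary functions
preserve this property. -/
theorem Rud.hereditarily {P : Set ZFSet.{u}} {n : ℕ} {f : (Fin n → ZFSet.{u}) → ZFSet.{u}}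
    (hf : Rud P f) (hP : ∀ c ∈ P, c.Hereditarily fun x => Rud P fun _ : Fin 0 → ZFSet.{u} => x)
    {v : Fin n → ZFSet.{u}}
    (hv : ∀ i, (v i).Hereditarily fun x => Rud P fun _ : Fin 0 → ZFSet.{u} => x) :
    (f v).Hereditarily fun x => Rud P fun _ : Fin 0 → ZFSet.{u} => x := by
  have step : ∀ {n : ℕ} {f : (Fin n → ZFSet.{u}) → ZFSet.{u}} {v : Fin n → ZFSet.{u}}, Rud P f →
      (∀ i, (v i).Hereditarily fun x => Rud P fun _ : Fin 0 → ZFSet.{u} => x) →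
      (∀ y ∈ f v, y.Hereditarily fun x => Rud P fun _ : Fin 0 → ZFSet.{u} => x) →
      (f v).Hereditarily fun x => Rud P fun _ : Fin 0 → ZFSet.{u} => x := by
    intro n f v hf hv hy
    rw [ZFSet.hereditarily_iff]
    exact ⟨hf.comp (g := fun i _ => v i) fun i => (hv i).self, hy⟩
  induction hf with
  | empty => exact step .empty hv fun y hy => absurd hy (ZFSet.notMem_empty y)
  | const hc => exact hP _ hc
  | proj i => exact hv i
  | diff h₁ h₂ ih₁ _ =>
    exact step (.diff h₁ h₂) hv fun y hy => (ih₁ hv).mem (ZFSet.mem_sdiff.1 hy).1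
  | upair h₁ h₂ ih₁ ih₂ =>
    refine step (.upair h₁ h₂) hv fun y hy => ?_
    rcases ZFSet.mem_pair.1 hy with rfl | rfl
    · exact ih₁ hv
    · exact ih₂ hv
  | bUnion' h₁ h₂ ih₁ ih₂ =>
    refine step (.bUnion' h₁ h₂) hv fun y hy => ?_
    obtain ⟨z, hz, hy⟩ := mem_bUnion.1 hy
    refine (ih₂ fun i => ?_).mem hy
    refine Fin.cases ?_ (fun j => ?_) i
    · exact (ih₁ hv).mem hz
    · exact hv j

/-- Transitivity of `U` makes every parameter hereditarily a rudimentary value, and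
`Rud.hereditarily` passes this on to every point of the closure. An empty `U` has empty closure,
since codes have at least one variable. -/
theorem isTransitive_rudClosure {U : ZFSet.{u}} (hU : U.IsTransitive) :
    (rudClosure U).IsTransitive := by
  intro x hx y hy
  have hne : ∃ y, y ∈ U := by
    obtain ⟨p, -⟩ := ZFSet.mem_range.1 hx
    by_contra h
    push Not at h
    exact h _ (p.2.2 ⟨0, p.2.1.pos⟩).2
  have hP : ∀ c : ZFSet.{u}, c ∈ U →
      c.Hereditarily fun x => Rud {y | y ∈ U} fun _ : Fin 0 → ZFSet.{u} => x := by
    intro c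
    induction c using ZFSet.inductionOn with
    | h c ih =>
      intro hc
      rw [ZFSet.hereditarily_iff]
      exact ⟨.const hc, fun y hy => ih y hy (hU _ hc hy)⟩
  exact (mem_rudClosure hne).2
    ((((mem_rudClosure hne).1 hx).hereditarily hP (v := Fin.elim0) (fun i => i.elim0)).mem hy).self

theorem isTransitive_insert_self {M : ZFSet.{u}} (hM : M.IsTransitive) :
    (insert M M : ZFSet.{u}).IsTransitive := by
  intro x hx y hy
  rcases ZFSet.mem_insert_iff.1 hx with rfl | hx
  · exact ZFSet.mem_insert_of_mem _ hy
  · exact ZFSet.mem_insert_of_mem _ (hM _ hx hy)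

theorem isTransitive_jensenJ (α : Ordinal.{u}) : (jensenJ α).IsTransitive := by
  induction α using Ordinal.limitRecOn with
  | zero => simp
  | add_one α ih =>
    rw [jensenJ_add_one]
    exact isTransitive_rudClosure (isTransitive_insert_self ih)
  | limit α hα ih =>
    intro x hx y hy
    obtain ⟨β, hβ, hx⟩ := (mem_jensenJ_limit hα).1 hx
    exact (mem_jensenJ_limit hα).2 ⟨β, hβ, ih β hβ _ hx hy⟩

/-- A rudimentary function in parameters from the union of a chain has its parameters in a member of
the chain. -/
theorem Rud.exists_of_iUnion {N : Ordinal.{u} → ZFSet.{u}} (hN : ∀ {α β}, α ≤ β → N α ⊆ N β)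
    {α : Ordinal.{u}} (hα : 0 < α) (h : ∀ x ∈ N α, ∃ β < α, x ∈ N β) {n : ℕ}
    {f : (Fin n → ZFSet.{u}) → ZFSet.{u}} (hf : Rud {x | x ∈ N α} f) :
    ∃ β < α, Rud {x | x ∈ N β} f := by
  have two : ∀ {m k l : ℕ} {f : (Fin m → ZFSet.{u}) → ZFSet.{u}}
      {g : (Fin k → ZFSet.{u}) → ZFSet.{u}} {e : (Fin l → ZFSet.{u}) → ZFSet.{u}},
      (∃ β < α, Rud {x | x ∈ N β} f) → (∃ β < α, Rud {x | x ∈ N β} g) →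
      (∀ β, Rud {x | x ∈ N β} f → Rud {x | x ∈ N β} g → Rud {x | x ∈ N β} e) →
      ∃ β < α, Rud {x | x ∈ N β} e := by
    rintro m k l f g e ⟨β, hβ, hf⟩ ⟨γ, hγ, hg⟩ h
    exact ⟨max β γ, max_lt hβ hγ, h _ (hf.mono fun x hx => hN (le_max_left _ _) hx)
      (hg.mono fun x hx => hN (le_max_right _ _) hx)⟩
  induction hf with
  | empty => exact ⟨0, hα, .empty⟩
  | const hc =>
    obtain ⟨β, hβ, hc⟩ := h _ hc
    exact ⟨β, hβ, .const hc⟩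
  | proj i => exact ⟨0, hα, .proj i⟩
  | diff _ _ ih₁ ih₂ => exact two ih₁ ih₂ fun _ => .diff
  | upair _ _ ih₁ ih₂ => exact two ih₁ ih₂ fun _ => .upair
  | bUnion' _ _ ih₁ ih₂ => exact two ih₁ ih₂ fun _ => .bUnion'

theorem rudHierarchy_jensenJ : RudHierarchy (jensenJ : Ordinal.{u} → ZFSet.{u}) where
  trans := isTransitive_jensenJ
  mono := jensenJ_mono
  mem_add_one α := by
    rw [jensenJ_add_one]
    exact self_mem_rudClosure _
  exists_lt h := (mem_jensenJ_limit h).1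
  closed α hα := by
    induction α using Ordinal.limitRecOn with
    | zero => exact absurd hα (lt_irrefl _)
    | add_one α _ =>
      rw [jensenJ_add_one]
      exact rudClosed_rudClosure (exists_mem_insert _)
    | limit α hlim ih =>
      intro x hx
      obtain ⟨β, hβ, hx⟩ := hx.exists_of_iUnion jensenJ_mono hα fun y => (mem_jensenJ_limit hlim).1
      have hβ' : β + 1 < α := hlim.add_one_lt hβ
      exact jensenJ_mono hβ'.le (ih _ hβ' (by simp) x (hx.mono fun _ hy => jensenJ_mono le_self_add hy))

/-! ### The ordinals of the `J`-hierarchy -/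

/-- A rudimentary function raises ranks by a finite amount only, so one step of the `J`-hierarchy
cannot go past the next multiple of ω. -/
theorem Rud.rank_le {P : Set ZFSet.{u}} {n : ℕ} {f : (Fin n → ZFSet.{u}) → ZFSet.{u}}
    (hf : Rud P f) {ρ : Ordinal.{u}} (hP : ∀ c ∈ P, c.rank ≤ ρ) :
    ∃ k : ℕ, ∀ σ ≥ ρ, ∀ v : Fin n → ZFSet.{u}, (∀ i, (v i).rank ≤ σ) → (f v).rank ≤ σ + k := by
  induction hf with
  | empty => exact ⟨0, fun σ _ v _ => by simp⟩
  | const hc => exact ⟨0, fun σ hσ v _ => by simpa using (hP _ hc).trans hσ⟩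
  | proj i => exact ⟨0, fun σ _ v hv => by simpa using hv i⟩
  | diff _ _ ih₁ _ =>
    obtain ⟨k, hk⟩ := ih₁
    exact ⟨k, fun σ hσ v hv => (ZFSet.rank_mono fun x hx => (ZFSet.mem_sdiff.1 hx).1).trans
      (hk σ hσ v hv)⟩
  | upair _ _ ih₁ ih₂ =>
    obtain ⟨k, hk⟩ := ih₁
    obtain ⟨l, hl⟩ := ih₂
    refine ⟨max k l + 1, fun σ hσ v hv => ?_⟩
    rw [ZFSet.rank_pair, max_le_iff, Order.succ_le_iff, Order.succ_le_iff, Nat.cast_succ, ← add_assoc,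
      Order.lt_add_one_iff, Order.lt_add_one_iff]
    exact ⟨(hk σ hσ v hv).trans (by gcongr; exact le_max_left _ _),
      (hl σ hσ v hv).trans (by gcongr; exact le_max_right _ _)⟩
  | bUnion' _ _ ih₁ ih₂ =>
    obtain ⟨k, hk⟩ := ih₁
    obtain ⟨l, hl⟩ := ih₂
    refine ⟨k + l, fun σ hσ v hv => ?_⟩
    rw [ZFSet.rank_le_iff]
    intro y hy
    obtain ⟨z, hz, hy⟩ := mem_bUnion.1 hy
    rw [Nat.cast_add, ← add_assoc]
    refine (ZFSet.rank_lt_of_mem hy).trans_le (hl (σ + k) (hσ.trans le_self_add) _ fun i => ?_)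
    refine Fin.cases ?_ (fun j => ?_) i
    · exact (ZFSet.rank_lt_of_mem hz).le.trans (hk σ hσ v hv)
    · exact (hv j).trans le_self_add

theorem rank_lt_of_mem_jensenJ {α : Ordinal.{u}} {x : ZFSet.{u}} (hx : x ∈ jensenJ α) :
    x.rank < Ordinal.omega0 * α := by
  induction α using Ordinal.limitRecOn generalizing x with
  | zero => simp at hx
  | add_one α ih =>
    rw [jensenJ_add_one, mem_rudClosure (exists_mem_insert _)] at hx
    have hJ : (jensenJ α).rank ≤ Ordinal.omega0 * α := ZFSet.rank_le_iff.2 fun y hy => ih hy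
    obtain ⟨k, hk⟩ := hx.rank_le (ρ := Ordinal.omega0 * α) fun c hc => by
      rcases ZFSet.mem_insert_iff.1 hc with rfl | hc
      · exact hJ
      · exact (ih hc).le
    refine (hk _ le_rfl Fin.elim0 fun i => i.elim0).trans_lt ?_
    rw [mul_add, mul_one]
    gcongr
    exact Ordinal.natCast_lt_omega0 k
  | limit α hα ih =>
    obtain ⟨β, hβ, hx⟩ := (mem_jensenJ_limit hα).1 hx
    exact (ih β hβ hx).trans_le (by gcongr)

theorem toZFSet_mem_jensenJ_iff {α ξ : Ordinal.{u}} :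
    ξ.toZFSet ∈ jensenJ α ↔ ξ < Ordinal.omega0 * α := by
  refine ⟨fun h => by simpa using rank_lt_of_mem_jensenJ h, fun h => ?_⟩
  induction α using WellFoundedLT.induction generalizing ξ with
  | ind α ih =>
    obtain ⟨η, hη, k, rfl⟩ := exists_eq_omega0_mul_add h
    have hc : RudClosed (jensenJ (η + 1)) := rudHierarchy_jensenJ.closed _ (by simp)
    refine jensenJ_mono (Order.add_one_le_of_lt hη) ?_
    clear h
    induction k with
    | zero =>
      -- By induction and the rank bound, the ordinals in `J_η` are exactly those below `ω · η`;
      -- being an ordinal is a rudimentary relation, so `J_{η+1}` can separate them from `J_η`.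
      have : (Ordinal.omega0 * η + (0 : ℕ)).toZFSet = ZFSet.sep (fun x => x.IsOrdinal) (jensenJ η) := by
        ext x
        simp only [Nat.cast_zero, add_zero, Ordinal.mem_toZFSet_iff, ZFSet.mem_sep]
        constructor
        · rintro ⟨ζ, hζ, rfl⟩
          exact ⟨ih η hη hζ, ZFSet.isOrdinal_toZFSet ζ⟩
        · rintro ⟨hx, ho⟩
          exact ⟨x.rank, rank_lt_of_mem_jensenJ hx, ho.toZFSet_rank_eq⟩
      rw [this]
      exact hc _ (.sep (R := fun x _ => x.IsOrdinal) (.const (rudHierarchy_jensenJ.mem_add_one _))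
        (.isOrdinal (.proj 0)))
    | succ k ihk =>
      rw [Nat.cast_succ, ← add_assoc, Ordinal.toZFSet_add_one]
      exact hc _ (.insert (.const ihk) (.const ihk))

/-! ### First-order definability over a set -/

/-- The relation `R` is first-order definable, with parameters, over `(M, ∈)`. -/
def DefRel (M : ZFSet.{u}) {n : ℕ} (R : (Fin n → ZFSet.{u}) → Prop) : Prop :=
  (Set.univ : Set {a : ZFSet.{u} // a ∈ M}).Definable setLang {v | R fun i => (v i).1}

/-- The function `f` of tuples from `M` has values in `M` and is first-order definable, with
parameters, over `(M, ∈)`. -/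
def DefFun (M : ZFSet.{u}) {n : ℕ} (f : (Fin n → ZFSet.{u}) → ZFSet.{u}) : Prop :=
  ∃ f' : (Fin n → {a : ZFSet.{u} // a ∈ M}) → {a : ZFSet.{u} // a ∈ M},
    (Set.univ : Set {a : ZFSet.{u} // a ∈ M}).DefinableFun setLang f' ∧
      ∀ v, (f' v).1 = f fun i => (v i).1

section
variable {M : ZFSet.{u}} {n m : ℕ} {R S : (Fin n → ZFSet.{u}) → Prop}
  {f g : (Fin n → ZFSet.{u}) → ZFSet.{u}}

theorem DefFun.proj (i : Fin n) : DefFun M fun v => v i :=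
  ⟨fun v => v i, .proj _, fun _ => rfl⟩

theorem DefFun.const {c : ZFSet.{u}} (hc : c ∈ M) : DefFun M fun _ : Fin n → ZFSet.{u} => c :=
  ⟨fun _ => ⟨c, hc⟩, definableFun_const _ _ (Set.mem_univ _), fun _ => rfl⟩

theorem DefRel.congr (hR : DefRel M R) (h : ∀ v : Fin n → ZFSet.{u}, (∀ i, v i ∈ M) → (S v ↔ R v)) :
    DefRel M S := by
  unfold DefRel at hR ⊢
  convert hR using 3 with v
  exact h _ fun i => (v i).2

theorem DefRel.subst {R : (Fin m → ZFSet.{u}) → Prop} (hR : DefRel M R)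
    {f : Fin m → (Fin n → ZFSet.{u}) → ZFSet.{u}} (hf : ∀ i, DefFun M (f i)) :
    DefRel M fun v => R fun i => f i v := by
  choose f' hf' h using hf
  have := Set.Definable.preimage_map (F := fun v i => f' i v) (fun i => hf' i) hR
  unfold DefRel
  convert this using 1
  ext v
  simp [h]

theorem DefRel.eq (hf : DefFun M f) (hg : DefFun M g) : DefRel M fun v => f v = g v := by
  obtain ⟨f', hf', hf⟩ := hf
  obtain ⟨g', hg', hg⟩ := hg
  have := hf'.ofPred_eq hg'
  unfold DefRel
  convert this using 3 with v
  rw [Subtype.ext_iff, hf, hg]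

theorem DefRel.mem (hf : DefFun M f) (hg : DefFun M g) : DefRel M fun v => f v ∈ g v := by
  have : DefRel M fun v : Fin 2 → ZFSet.{u} => v 0 ∈ v 1 := by
    refine Set.Definable.mono (A := ∅) (Set.empty_definable_iff.2
      ⟨memSymb.formula₂ (Term.var 0) (Term.var 1), ?_⟩) (Set.empty_subset _)
    ext v
    simp only [Set.mem_ofPred_eq, Formula.realize_rel₂]
    rfl
  refine (this.subst (f := ![f, g]) fun i => ?_)
  refine Fin.cases hf (fun j => ?_) i
  rw [Subsingleton.elim j 0]
  exact hg

theorem DefRel.not (hR : DefRel M R) : DefRel M fun v => ¬ R v := Set.Definable.compl hR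

theorem DefRel.and (hR : DefRel M R) (hS : DefRel M S) : DefRel M fun v => R v ∧ S v :=
  Set.Definable.inter hR hS

theorem DefRel.or (hR : DefRel M R) (hS : DefRel M S) : DefRel M fun v => R v ∨ S v :=
  Set.Definable.union hR hS

theorem DefRel.iff (hR : DefRel M R) (hS : DefRel M S) : DefRel M fun v => (R v ↔ S v) :=
  ((hR.and hS).or (hR.not.and hS.not)).congr fun v _ => by tauto

theorem DefRel.true : DefRel M fun _ : Fin n → ZFSet.{u} => True :=
  Set.definable_univ

theorem DefRel.ex {R : ZFSet.{u} → (Fin n → ZFSet.{u}) → Prop}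
    (hR : DefRel M fun w : Fin (n + 1) → ZFSet.{u} => R (w 0) (Fin.tail w)) :
    DefRel M fun v => ∃ z ∈ M, R z v := by
  have := Set.Definable.image_comp hR Fin.succ
  unfold DefRel
  convert this using 1
  ext v
  simp only [Set.mem_ofPred_eq, Set.mem_image]
  constructor
  · rintro ⟨z, hz, h⟩
    exact ⟨Fin.cons ⟨z, hz⟩ v, by simpa [Fin.tail] using! h, by ext; simp⟩
  · rintro ⟨w, h, rfl⟩
    exact ⟨_, (w 0).2, h⟩

theorem DefRel.all {R : ZFSet.{u} → (Fin n → ZFSet.{u}) → Prop}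
    (hR : DefRel M fun w : Fin (n + 1) → ZFSet.{u} => R (w 0) (Fin.tail w)) :
    DefRel M fun v => ∀ z ∈ M, R z v :=
  (DefRel.ex (R := fun z v => ¬ R z v) hR.not).not.congr fun v _ => by simp

theorem DefRel.forall_fin {k : ℕ} {R : Fin k → (Fin n → ZFSet.{u}) → Prop}
    (hR : ∀ i, DefRel M (R i)) : DefRel M fun v => ∀ i, R i v := by
  have := Set.definable_iInter_of_finite hR
  unfold DefRel
  convert this using 1
  ext v
  simp

theorem mem_defPowerset {x : ZFSet.{u}} :
    x ∈ defPowerset M ↔ x ⊆ M ∧ DefRel M fun v : Fin 1 → ZFSet.{u} => v 0 ∈ x := by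
  rw [defPowerset, ZFSet.mem_sep, ZFSet.mem_powerset]
  rfl

theorem sep_mem_defPowerset {p : ZFSet.{u} → Prop}
    (hp : DefRel M fun v : Fin 1 → ZFSet.{u} => p (v 0)) : ZFSet.sep p M ∈ defPowerset M :=
  mem_defPowerset.2 ⟨ZFSet.sep_subset, hp.congr fun v hv => by simp [hv]⟩

end

/-! ### The levels of the constructible hierarchy -/

@[simp]
theorem godelL_zero : godelL (0 : Ordinal.{u}) = ∅ := by
  simp [godelL]

theorem godelL_add_one (α : Ordinal.{u}) : godelL (α + 1) = defPowerset (godelL α) := by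
  simp [godelL]

theorem mem_godelL_limit {α : Ordinal.{u}} (h : Order.IsSuccLimit α) {x : ZFSet.{u}} :
    x ∈ godelL α ↔ ∃ β < α, x ∈ godelL β := by
  rw [godelL, Ordinal.limitRecOn_limit _ _ _ _ h]
  simp [godelL]

theorem subset_defPowerset {M : ZFSet.{u}} (hM : M.IsTransitive) : M ⊆ defPowerset M := fun _ hx =>
  mem_defPowerset.2 ⟨hM _ hx, .mem (.proj 0) (.const hx)⟩

theorem self_mem_defPowerset (M : ZFSet.{u}) : M ∈ defPowerset M :=
  mem_defPowerset.2 ⟨fun _ h => h, DefRel.true.congr fun v hv => by simp [hv]⟩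

theorem isTransitive_godelL (α : Ordinal.{u}) : (godelL α).IsTransitive := by
  induction α using Ordinal.limitRecOn with
  | zero => simp
  | add_one α ih =>
    intro x hx y hy
    rw [godelL_add_one] at hx ⊢
    exact subset_defPowerset ih ((mem_defPowerset.1 hx).1 hy)
  | limit α hα ih =>
    intro x hx y hy
    obtain ⟨β, hβ, hx⟩ := (mem_godelL_limit hα).1 hx
    exact (mem_godelL_limit hα).2 ⟨β, hβ, ih β hβ _ hx hy⟩

theorem godelL_mono {α β : Ordinal.{u}} (h : α ≤ β) : godelL α ⊆ godelL β := by
  induction β using Ordinal.limitRecOn generalizing α with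
  | zero =>
    rw [nonpos_iff_eq_zero.1 h]
  | add_one β ih =>
    rcases h.eq_or_lt with rfl | h
    · exact fun _ h => h
    · intro x hx
      rw [godelL_add_one]
      exact subset_defPowerset (isTransitive_godelL _) (ih (Order.lt_add_one_iff.1 h) hx)
  | limit β hβ ih =>
    rcases h.eq_or_lt with rfl | h
    · exact fun _ h => h
    · exact fun x hx => (mem_godelL_limit hβ).2 ⟨α, h, hx⟩

theorem mem_godelL_of_lt {α β : Ordinal.{u}} (h : α < β) : godelL α ∈ godelL β := by
  refine godelL_mono (Order.add_one_le_of_lt h) ?_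
  rw [godelL_add_one]
  exact self_mem_defPowerset _

theorem sep_mem_godelL {α : Ordinal.{u}} {p : ZFSet.{u} → Prop}
    (hp : DefRel (godelL α) fun v : Fin 1 → ZFSet.{u} => p (v 0)) :
    ZFSet.sep p (godelL α) ∈ godelL (α + 1) := by
  rw [godelL_add_one]
  exact sep_mem_defPowerset hp

/-- The function `f` maps tuples from `L_β` into `L_δ`, and its restriction to these is definable
over `L_δ`. -/
def DefGraph (β δ : Ordinal.{u}) {n : ℕ} (f : (Fin n → ZFSet.{u}) → ZFSet.{u}) : Prop :=
  (∀ v : Fin n → ZFSet.{u}, (∀ i, v i ∈ godelL β) → f v ∈ godelL δ) ∧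
    DefRel (godelL δ) fun w : Fin (n + 1) → ZFSet.{u} =>
      (∀ i : Fin n, Fin.tail w i ∈ godelL β) ∧ w 0 = f (Fin.tail w)

/-- To define the graph of `f`, it suffices to define membership in its values one level lower, and
cofinally often from then on. -/
theorem defGraph_of_mem {β μ δ : Ordinal.{u}} {n : ℕ} {f : (Fin n → ZFSet.{u}) → ZFSet.{u}}
    (hβ : β ≤ μ) (hδ : μ < δ)
    (hsub : ∀ v : Fin n → ZFSet.{u}, (∀ i, v i ∈ godelL β) → f v ⊆ godelL μ)
    (hdef : ∀ ν, μ ≤ ν → ν ≤ δ → ∃ R : (Fin (n + 1) → ZFSet.{u}) → Prop, DefRel (godelL ν) R ∧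
      ∀ w : Fin (n + 1) → ZFSet.{u}, (∀ i, Fin.tail w i ∈ godelL β) → w 0 ∈ godelL ν →
        (R w ↔ w 0 ∈ f (Fin.tail w))) : DefGraph β δ f := by
  -- The hypothesis is used at two levels: over `L_μ` it exhibits `f v` as a definable subset, hence
  -- as an element of `L_{μ+1}`; over `L_δ` it defines the graph by extensionality.
  constructor
  · intro v hv
    obtain ⟨R, hR, h⟩ := hdef μ le_rfl hδ.le
    refine godelL_mono (Order.add_one_le_of_lt hδ) ?_
    have : f v = ZFSet.sep (fun y => R (Fin.cons y v)) (godelL μ) := by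
      ext y
      rw [ZFSet.mem_sep]
      constructor
      · exact fun hy => ⟨hsub v hv hy, (h (Fin.cons y v) hv (hsub v hv hy)).2 hy⟩
      · exact fun ⟨hy, hy'⟩ => (h (Fin.cons y v) hv hy).1 hy'
    rw [this]
    refine sep_mem_godelL ((hR.subst (f := Fin.cons (fun v : Fin 1 → ZFSet.{u} => v 0)
      fun i _ => v i) fun i => ?_).congr fun w _ => ?_)
    · refine Fin.cases (.proj 0) (fun j => ?_) i
      exact .const (godelL_mono hβ (hv j))
    · refine iff_of_eq (congrArg R ?_)
      funext i
      refine Fin.cases rfl (fun j => rfl) i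
  · obtain ⟨R, hR, h⟩ := hdef δ hδ.le le_rfl
    have h₁ : DefRel (godelL δ) fun w : Fin (n + 1) → ZFSet.{u} =>
        ∀ i : Fin n, Fin.tail w i ∈ godelL β :=
      .forall_fin (R := fun i w => Fin.tail w i ∈ godelL β) fun i =>
        .mem (.proj i.succ) (.const (mem_godelL_of_lt (hβ.trans_lt hδ)))
    refine (h₁.and (.all (R := fun y w => (y ∈ w 0 ↔ R (Fin.cons y (Fin.tail w))))
      (.iff (.mem (.proj 0) (.proj 1)) (hR.subst (f := fun i w => Fin.cons (w 0) (Fin.tail (Fin.tail w)) i)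
        fun i => ?_)))).congr fun w hw => ?_
    · refine Fin.cases (.proj 0) (fun j => ?_) i
      exact .proj j.succ.succ
    · refine and_congr_right fun hw' => ⟨fun he y hy => ?_, fun he => ?_⟩
      · rw [h _ (by simpa using! hw') (by simpa using hy), he]
        simp
      · ext y
        constructor
        · intro hy
          have hyδ := isTransitive_godelL δ _ (hw 0) hy
          have := (he y hyδ).1 hy
          rw [h _ (by simpa using! hw') (by simpa using hyδ)] at this
          simpa using! this
        · intro hy
          have hyδ := godelL_mono hδ.le (hsub _ hw' hy)
          rw [he y hyδ, h _ (by simpa using! hw') (by simpa using hyδ)]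
          simpa using! hy

theorem DefGraph.defRel_mem {β δ : Ordinal.{u}} {n : ℕ} {f : (Fin n → ZFSet.{u}) → ZFSet.{u}}
    (h : DefGraph β δ f) : DefRel (godelL δ) fun w : Fin (n + 1) → ZFSet.{u} =>
      (∀ i : Fin n, Fin.tail w i ∈ godelL β) ∧ w 0 ∈ f (Fin.tail w) := by
  refine (DefRel.ex (R := fun a w => ((∀ i : Fin n, Fin.tail w i ∈ godelL β) ∧ a = f (Fin.tail w)) ∧
    w 0 ∈ a) (.and (h.2.subst (f := Fin.cons (fun v => v 0) fun i v => v i.succ.succ) fun i => ?_)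
      (.mem (.proj 1) (.proj 0)))).congr fun w _ => ⟨?_, ?_⟩
  · exact Fin.cases (.proj 0) (fun j => .proj j.succ.succ) i
  · exact fun ⟨hw, hw'⟩ => ⟨_, h.1 _ hw, ⟨hw, rfl⟩, hw'⟩
  · rintro ⟨_, _, ⟨hw, rfl⟩, hw'⟩
    exact ⟨hw, hw'⟩

/-- Induction on `f`. Definability is demanded over every sufficiently late `L_δ`, not just over
one, so that the graphs of the parts of a compound function are available over a common level. The
case of no variables makes `L_λ` rudimentarily closed. -/
theorem Rud.exists_defGraph {lam : Ordinal.{u}} (hlam : Order.IsSuccLimit lam) {n : ℕ}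
    {f : (Fin n → ZFSet.{u}) → ZFSet.{u}} (hf : Rud {x | x ∈ godelL lam} f) {β : Ordinal.{u}}
    (hβ : β < lam) :
    ∃ γ < lam, β ≤ γ ∧ ∀ δ, γ ≤ δ → δ < lam → DefGraph β δ f := by
  induction hf generalizing β with
  | empty =>
    refine ⟨β + 1, hlam.add_one_lt hβ, le_self_add, fun δ hδ _ => ?_⟩
    refine defGraph_of_mem le_rfl (Order.add_one_le_iff.1 hδ)
      (fun v _ => ZFSet.empty_subset _) fun ν _ _ => ⟨_, DefRel.true.not, fun w _ _ => ?_⟩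
    simp
  | @const n c hc =>
    obtain ⟨γ, hγ, hc⟩ := (mem_godelL_limit hlam).1 hc
    refine ⟨max β γ + 1, hlam.add_one_lt (max_lt hβ hγ), (le_max_left _ _).trans le_self_add,
      fun δ hδ _ => ?_⟩
    have hγ' : godelL γ ⊆ godelL (max β γ) := godelL_mono (le_max_right _ _)
    refine defGraph_of_mem (le_max_left _ _) (Order.add_one_le_iff.1 hδ)
      (fun v _ => isTransitive_godelL _ _ (hγ' hc)) fun ν hν _ =>
        ⟨fun w => w 0 ∈ c, .mem (.proj 0) (.const (godelL_mono hν (hγ' hc))), fun w _ _ => Iff.rfl⟩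
  | proj i =>
    refine ⟨β + 1, hlam.add_one_lt hβ, le_self_add, fun δ hδ _ => ?_⟩
    exact defGraph_of_mem le_rfl (Order.add_one_le_iff.1 hδ)
      (fun v hv => isTransitive_godelL _ _ (hv i)) fun ν _ _ =>
        ⟨fun w => w 0 ∈ w i.succ, .mem (.proj 0) (.proj _), fun w _ _ => Iff.rfl⟩
  | diff _ _ ih₁ ih₂ =>
    obtain ⟨γ₁, h₁, hβ₁, H₁⟩ := ih₁ hβ
    obtain ⟨γ₂, h₂, _, H₂⟩ := ih₂ hβ
    have hμ : β ≤ max γ₁ γ₂ := hβ₁.trans (le_max_left _ _)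
    refine ⟨max γ₁ γ₂ + 1, hlam.add_one_lt (max_lt h₁ h₂), hμ.trans le_self_add, fun δ hδ hδ' => ?_⟩
    refine defGraph_of_mem hμ (Order.add_one_le_iff.1 hδ) (fun v hv x hx => ?_) fun ν hν hν' =>
      ⟨_, (H₁ ν ((le_max_left _ _).trans hν) (hν'.trans_lt hδ')).defRel_mem.and
        (H₂ ν ((le_max_right _ _).trans hν) (hν'.trans_lt hδ')).defRel_mem.not,
        fun w hw _ => ?_⟩
    · exact godelL_mono (le_max_left _ _)
        (isTransitive_godelL _ _ ((H₁ _ le_rfl h₁).1 v hv) (ZFSet.mem_sdiff.1 hx).1)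
    · simp [hw]
  | upair _ _ ih₁ ih₂ =>
    obtain ⟨γ₁, h₁, hβ₁, H₁⟩ := ih₁ hβ
    obtain ⟨γ₂, h₂, _, H₂⟩ := ih₂ hβ
    have hμ : β ≤ max γ₁ γ₂ := hβ₁.trans (le_max_left _ _)
    refine ⟨max γ₁ γ₂ + 1, hlam.add_one_lt (max_lt h₁ h₂), hμ.trans le_self_add, fun δ hδ hδ' => ?_⟩
    refine defGraph_of_mem hμ (Order.add_one_le_iff.1 hδ) (fun v hv x hx => ?_) fun ν hν hν' =>
      ⟨_, (H₁ ν ((le_max_left _ _).trans hν) (hν'.trans_lt hδ')).2.or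
        (H₂ ν ((le_max_right _ _).trans hν) (hν'.trans_lt hδ')).2,
        fun w hw _ => ?_⟩
    · rcases ZFSet.mem_pair.1 hx with rfl | rfl
      · exact godelL_mono (le_max_left _ _) ((H₁ _ le_rfl h₁).1 v hv)
      · exact godelL_mono (le_max_right _ _) ((H₂ _ le_rfl h₂).1 v hv)
    · simp [hw]
  | @bUnion' n f g _ _ ih₁ ih₂ =>
    obtain ⟨γ₁, h₁, hβ₁, H₁⟩ := ih₁ hβ
    -- The function under the union is also evaluated at elements `z ∈ f v`, which lie in `L_{γ₁}`
    -- rather than `L_β`; so its graph is taken on `L_{γ₁}`.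
    obtain ⟨γ₂, h₂, h₁₂, H₂⟩ := ih₂ h₁
    have hμ : β ≤ γ₂ := hβ₁.trans h₁₂
    have hz : ∀ v : Fin n → ZFSet.{u}, (∀ i, v i ∈ godelL β) → ∀ z ∈ f v, z ∈ godelL γ₁ :=
      fun v hv z hz => isTransitive_godelL _ _ ((H₁ _ le_rfl h₁).1 v hv) hz
    have hc : ∀ v : Fin n → ZFSet.{u}, (∀ i, v i ∈ godelL β) → ∀ z ∈ f v,
        ∀ i, (Fin.cons z v : Fin (n + 1) → ZFSet.{u}) i ∈ godelL γ₁ := fun v hv z hzv i =>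
      Fin.cases (hz v hv z hzv) (fun j => godelL_mono hβ₁ (hv j)) i
    refine ⟨γ₂ + 1, hlam.add_one_lt h₂, hμ.trans le_self_add, fun δ hδ hδ' => ?_⟩
    refine defGraph_of_mem hμ (Order.add_one_le_iff.1 hδ) (fun v hv x hx => ?_) fun ν hν hν' =>
      ⟨_, DefRel.ex (R := fun z w => ((∀ i : Fin n, Fin.tail w i ∈ godelL β) ∧ z ∈ f (Fin.tail w)) ∧
        (∀ i : Fin (n + 1), (Fin.cons z (Fin.tail w) : Fin (n + 1) → ZFSet.{u}) i ∈ godelL γ₁) ∧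
          w 0 ∈ g (Fin.cons z (Fin.tail w)))
        (.and ((H₁ ν (h₁₂.trans hν) (hν'.trans_lt hδ')).defRel_mem.subst
            (f := Fin.cons (fun v => v 0) fun i v => v i.succ.succ) fun i =>
              Fin.cases (.proj 0) (fun j => .proj j.succ.succ) i)
          ((H₂ ν hν (hν'.trans_lt hδ')).defRel_mem.subst
            (f := Fin.cons (fun v => v 1) (fun i v =>
              (Fin.cons (v 0) (Fin.tail (Fin.tail v)) : Fin (n + 1) → ZFSet.{u}) i)) fun i =>
              Fin.cases (.proj 1) (fun j => Fin.cases (.proj 0) (fun k => .proj k.succ.succ) j) i)),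
        fun w hw _ => ?_⟩
    · obtain ⟨z, hzv, hx⟩ := mem_bUnion.1 hx
      exact isTransitive_godelL _ _ ((H₂ _ le_rfl h₂).1 _ (hc v hv z hzv)) hx
    · rw [mem_bUnion]
      constructor
      · rintro ⟨z, -, ⟨-, hz⟩, -, hx⟩
        exact ⟨z, hz, hx⟩
      · rintro ⟨z, hzv, hx⟩
        exact ⟨z, godelL_mono (h₁₂.trans hν) (hz _ hw z hzv), ⟨hw, hzv⟩, hc _ hw z hzv, hx⟩

theorem isSuccLimit_omega0_mul {α : Ordinal.{u}} (hα : 0 < α) :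
    Order.IsSuccLimit (Ordinal.omega0 * α) :=
  Ordinal.isSuccLimit_mul_left Ordinal.isSuccLimit_omega0 hα

/-- Limit levels of `L` are rudimentarily closed, whence the index `ω · α`. -/
theorem rudHierarchy_godelL :
    RudHierarchy (fun α : Ordinal.{u} => godelL (Ordinal.omega0 * α)) where
  trans α := isTransitive_godelL _
  mono h := godelL_mono (by gcongr)
  mem_add_one α := mem_godelL_of_lt (by
    rw [mul_add, mul_one]
    exact lt_add_of_pos_right _ Ordinal.omega0_pos)
  closed α hα := by
    intro x hx
    have hlim := isSuccLimit_omega0_mul hα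
    obtain ⟨γ, hγ, -, h⟩ := hx.exists_defGraph hlim (β := 0) (by simpa using hα)
    exact godelL_mono hγ.le ((h γ le_rfl hγ).1 Fin.elim0 fun i => i.elim0)
  exists_lt {α x} hα hx := by
    obtain ⟨ξ, hξ, hx⟩ := (mem_godelL_limit (isSuccLimit_omega0_mul hα.pos)).1 hx
    obtain ⟨η, hη, k, rfl⟩ := exists_eq_omega0_mul_add hξ
    refine ⟨η + 1, hα.add_one_lt hη, godelL_mono ?_ hx⟩
    rw [mul_add, mul_one]
    gcongr
    exact (Ordinal.natCast_lt_omega0 k).le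

/-! ### A finite basis for the rudimentary functions -/

/-- `{((x, t), x) : x ∈ a, t ∈ b}`. -/
def headOp (a b : ZFSet.{u}) : ZFSet.{u} := img (ZFSet.prod a b) fun p => ZFSet.pair p (fst p)

/-- `{((x, t), y) : x ∈ a, (t, y) ∈ r}`. -/
def liftOp (a r : ZFSet.{u}) : ZFSet.{u} :=
  img (ZFSet.prod a r) fun q => ZFSet.pair (ZFSet.pair (fst q) (fst (snd q))) (snd (snd q))

/-- `{(t, x \ y) : (t, x) ∈ r, (t, y) ∈ s}`. -/
def diffOp (r s : ZFSet.{u}) : ZFSet.{u} :=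
  img (ZFSet.sep (fun q => fst (fst q) = fst (snd q)) (ZFSet.prod r s)) fun q =>
    ZFSet.pair (fst (fst q)) (snd (fst q) \ snd (snd q))

/-- `{(t, {x, y}) : (t, x) ∈ r, (t, y) ∈ s}`. -/
def upairOp (r s : ZFSet.{u}) : ZFSet.{u} :=
  img (ZFSet.sep (fun q => fst (fst q) = fst (snd q)) (ZFSet.prod r s)) fun q =>
    ZFSet.pair (fst (fst q)) {snd (fst q), snd (snd q)}

/-- `{(t, ⋃_{z ∈ a} s(z, t)) : (t, a) ∈ r}`. -/
def unionOp (r s : ZFSet.{u}) : ZFSet.{u} :=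
  img r fun p => ZFSet.pair (fst p)
    (bUnion (snd p) fun z => app s (ZFSet.pair z (fst p)))

/-- The values at `a` and `b` of the basis functions. -/
def basisValues (a b : ZFSet.{u}) : ZFSet.{u} :=
  {{a, b}, ZFSet.sUnion a, ZFSet.prod a b, headOp a b, liftOp a b, diffOp a b, upairOp a b, unionOp a b}

section
variable {P : Set ZFSet.{u}} {n : ℕ} {f g : (Fin n → ZFSet.{u}) → ZFSet.{u}}

theorem Rud.basisValues (hf : Rud P f) (hg : Rud P g) : Rud P fun v => basisValues (f v) (g v) := by
  have hsep : Rud P fun v =>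
      ZFSet.sep (fun q => ClopenGames.fst (ClopenGames.fst q) = ClopenGames.fst (ClopenGames.snd q))
        (ZFSet.prod (f v) (g v)) :=
    .sep (R := fun q _ => ClopenGames.fst (ClopenGames.fst q) = ClopenGames.fst (ClopenGames.snd q))
      (hf.prod hg) (.eq (Rud.proj 0).fst.fst (Rud.proj 0).snd.fst)
  refine .insert (.upair hf hg) <| .insert hf.sUnion <| .insert (hf.prod hg) <| .insert ?_ <|
    .insert ?_ <| .insert ?_ <| .insert ?_ <| .singleton ?_
  · exact .img (g := fun p _ => ZFSet.pair p (ClopenGames.fst p)) (hf.prod hg)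
      (.pair (.proj 0) (Rud.proj 0).fst)
  · exact .img (g := fun q _ => ZFSet.pair (ZFSet.pair (ClopenGames.fst q)
      (ClopenGames.fst (ClopenGames.snd q))) (ClopenGames.snd (ClopenGames.snd q))) (hf.prod hg)
      (.pair (.pair (Rud.proj 0).fst (Rud.proj 0).snd.fst) (Rud.proj 0).snd.snd)
  · exact .img (g := fun q _ => ZFSet.pair (ClopenGames.fst (ClopenGames.fst q))
      (ClopenGames.snd (ClopenGames.fst q) \ ClopenGames.snd (ClopenGames.snd q))) hsep
      (.pair (Rud.proj 0).fst.fst (.diff (Rud.proj 0).fst.snd (Rud.proj 0).snd.snd))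
  · exact .img (g := fun q _ => ZFSet.pair (ClopenGames.fst (ClopenGames.fst q))
      {ClopenGames.snd (ClopenGames.fst q), ClopenGames.snd (ClopenGames.snd q)}) hsep
      (.pair (Rud.proj 0).fst.fst (.upair (Rud.proj 0).fst.snd (Rud.proj 0).snd.snd))
  · exact .img (g := fun p v => ZFSet.pair (ClopenGames.fst p) (ClopenGames.bUnion (ClopenGames.snd p)
      fun z => ClopenGames.app (g v) (ZFSet.pair z (ClopenGames.fst p)))) hf
      (.pair (Rud.proj 0).fst (.bUnion (g := fun z w => ClopenGames.app (g (Fin.tail w))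
        (ZFSet.pair z (ClopenGames.fst (w 0)))) (Rud.proj 0).snd
          (.app hg.tail.tail (.pair (.proj 0) (Rud.proj 1).fst))))

end

/-- The tuple `v` as a set. -/
def tuple : {n : ℕ} → (Fin n → ZFSet.{u}) → ZFSet.{u}
  | 0, _ => ∅
  | _ + 1, v => ZFSet.pair (v 0) (tuple (Fin.tail v))

/-- The set of `n`-tuples from `a`. -/
def power (a : ZFSet.{u}) : ℕ → ZFSet.{u}
  | 0 => {∅}
  | n + 1 => ZFSet.prod a (power a n)

theorem tuple_injective {n : ℕ} : Function.Injective (tuple : (Fin n → ZFSet.{u}) → ZFSet.{u}) := by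
  induction n with
  | zero => exact fun v w _ => Subsingleton.elim v w
  | succ n ih =>
    intro v w h
    obtain ⟨h₀, h₁⟩ := ZFSet.pair_inj.1 h
    rw [← Fin.cons_self_tail v, ← Fin.cons_self_tail w, h₀, ih h₁]

theorem mem_power {a x : ZFSet.{u}} {n : ℕ} :
    x ∈ power a n ↔ ∃ v : Fin n → ZFSet.{u}, (∀ i, v i ∈ a) ∧ x = tuple v := by
  induction n generalizing x with
  | zero => simp [power, tuple]
  | succ n ih =>
    simp only [power, ZFSet.mem_prod, ih]
    constructor
    · rintro ⟨y, hy, _, ⟨v, hv, rfl⟩, rfl⟩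
      exact ⟨Fin.cons y v, fun i => Fin.cases hy hv i, rfl⟩
    · rintro ⟨v, hv, rfl⟩
      exact ⟨v 0, hv 0, _, ⟨Fin.tail v, fun i => hv _, rfl⟩, rfl⟩

/-- The restriction of `f` to tuples from `a`, as a set. -/
def tupleGraph (a : ZFSet.{u}) {n : ℕ} (f : (Fin n → ZFSet.{u}) → ZFSet.{u}) : ZFSet.{u} :=
  ZFSet.range fun v : Fin n → {x : ZFSet.{u} // x ∈ a} =>
    ZFSet.pair (tuple fun i => (v i).1) (f fun i => (v i).1)

section
variable {a : ZFSet.{u}} {n : ℕ} {f g : (Fin n → ZFSet.{u}) → ZFSet.{u}}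

theorem mem_tupleGraph {p : ZFSet.{u}} : p ∈ tupleGraph a f ↔
    ∃ v : Fin n → ZFSet.{u}, (∀ i, v i ∈ a) ∧ p = ZFSet.pair (tuple v) (f v) := by
  simp only [tupleGraph, ZFSet.mem_range]
  constructor
  · rintro ⟨v, rfl⟩
    exact ⟨_, fun i => (v i).2, rfl⟩
  · rintro ⟨v, hv, rfl⟩
    exact ⟨fun i => ⟨v i, hv i⟩, rfl⟩

theorem app_tupleGraph {v : Fin n → ZFSet.{u}} (hv : ∀ i, v i ∈ a) :
    app (tupleGraph a f) (tuple v) = f v := by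
  refine app_eq fun z => ?_
  rw [mem_tupleGraph]
  constructor
  · rintro ⟨w, -, h⟩
    obtain ⟨h₁, h₂⟩ := ZFSet.pair_inj.1 h
    rw [h₂, tuple_injective h₁]
  · rintro rfl
    exact ⟨v, hv, rfl⟩

theorem tupleGraph_diff : tupleGraph a (fun v => f v \ g v) =
    diffOp (tupleGraph a f) (tupleGraph a g) := by
  ext p
  simp only [diffOp, mem_img, ZFSet.mem_sep, ZFSet.mem_prod, mem_tupleGraph]
  constructor
  · rintro ⟨v, hv, rfl⟩
    exact ⟨_, ⟨⟨_, ⟨v, hv, rfl⟩, _, ⟨v, hv, rfl⟩, rfl⟩, by simp⟩, by simp⟩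
  · rintro ⟨_, ⟨⟨_, ⟨v, hv, rfl⟩, _, ⟨w, hw, rfl⟩, rfl⟩, h⟩, rfl⟩
    simp only [fst_pair, snd_pair] at h
    rw [← tuple_injective h]
    exact ⟨v, hv, by simp⟩

theorem tupleGraph_upair : tupleGraph a (fun v => {f v, g v}) =
    upairOp (tupleGraph a f) (tupleGraph a g) := by
  ext p
  simp only [upairOp, mem_img, ZFSet.mem_sep, ZFSet.mem_prod, mem_tupleGraph]
  constructor
  · rintro ⟨v, hv, rfl⟩
    exact ⟨_, ⟨⟨_, ⟨v, hv, rfl⟩, _, ⟨v, hv, rfl⟩, rfl⟩, by simp⟩, by simp⟩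
  · rintro ⟨_, ⟨⟨_, ⟨v, hv, rfl⟩, _, ⟨w, hw, rfl⟩, rfl⟩, h⟩, rfl⟩
    simp only [fst_pair, snd_pair] at h
    rw [← tuple_injective h]
    exact ⟨v, hv, by simp⟩

theorem tupleGraph_const {c : ZFSet.{u}} :
    tupleGraph a (fun _ : Fin n → ZFSet.{u} => c) = ZFSet.prod (power a n) {c} := by
  ext p
  simp only [mem_tupleGraph, ZFSet.mem_prod, mem_power, ZFSet.mem_singleton]
  constructor
  · rintro ⟨v, hv, rfl⟩
    exact ⟨_, ⟨v, hv, rfl⟩, _, rfl, rfl⟩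
  · rintro ⟨_, ⟨v, hv, rfl⟩, _, rfl, rfl⟩
    exact ⟨v, hv, rfl⟩

theorem tupleGraph_proj_zero :
    tupleGraph a (fun v : Fin (n + 1) → ZFSet.{u} => v 0) = headOp a (power a n) := by
  ext p
  simp only [headOp, mem_img, mem_tupleGraph, ← power.eq_2]
  constructor
  · rintro ⟨v, hv, rfl⟩
    exact ⟨_, mem_power.2 ⟨v, hv, rfl⟩, by simp [tuple]⟩
  · rintro ⟨_, h, rfl⟩
    obtain ⟨v, hv, rfl⟩ := mem_power.1 h
    exact ⟨v, hv, by simp [tuple]⟩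

theorem tupleGraph_tail :
    tupleGraph a (fun v : Fin (n + 1) → ZFSet.{u} => f (Fin.tail v)) = liftOp a (tupleGraph a f) := by
  ext p
  simp only [liftOp, mem_img, mem_tupleGraph, ZFSet.mem_prod]
  constructor
  · rintro ⟨v, hv, rfl⟩
    exact ⟨_, ⟨_, hv 0, _, ⟨Fin.tail v, fun i => hv _, rfl⟩, rfl⟩, by simp [tuple]⟩
  · rintro ⟨_, ⟨x, hx, _, ⟨v, hv, rfl⟩, rfl⟩, rfl⟩
    exact ⟨Fin.cons x v, fun i => Fin.cases hx hv i, by simp [tuple]⟩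

/-- The graph of `g` is needed at arguments `z ∈ f v`, which may lie outside `a`; hence the larger
set `b`. -/
theorem tupleGraph_bUnion {b : ZFSet.{u}} {g : (Fin (n + 1) → ZFSet.{u}) → ZFSet.{u}}
    (hab : a ⊆ b) (hb : ∀ v : Fin n → ZFSet.{u}, (∀ i, v i ∈ a) → f v ⊆ b) :
    tupleGraph a (fun v => bUnion (f v) fun z => g (Fin.cons z v)) =
      unionOp (tupleGraph a f) (tupleGraph b g) := by
  have key : ∀ v : Fin n → ZFSet.{u}, (∀ i, v i ∈ a) → (bUnion (f v) fun z => g (Fin.cons z v)) =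
      bUnion (f v) fun z => app (tupleGraph b g) (ZFSet.pair z (tuple v)) := by
    intro v hv
    ext x
    simp only [mem_bUnion]
    refine exists_congr fun z => and_congr_right fun hz => ?_
    have : ZFSet.pair z (tuple v) = tuple (Fin.cons z v : Fin (n + 1) → ZFSet.{u}) := rfl
    rw [this, app_tupleGraph fun i => Fin.cases (hb v hv hz) (fun j => hab (hv j)) i]
  ext p
  simp only [unionOp, mem_img, mem_tupleGraph]
  constructor
  · rintro ⟨v, hv, rfl⟩
    exact ⟨_, ⟨v, hv, rfl⟩, by simp [key v hv]⟩
  · rintro ⟨_, ⟨v, hv, rfl⟩, rfl⟩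
    exact ⟨v, hv, by simp [key v hv]⟩

end

/-- A rudimentary function is not a set, but its restriction to tuples from some `a ∈ M` is, and the
constructors of `Rud` act on such restrictions through basis functions. By induction all these
restrictions lie in `M`. -/
theorem rudClosed_of_basisValues_subset {M : ZFSet.{u}} (h₀ : ∅ ∈ M)
    (hM : ∀ a ∈ M, ∀ b ∈ M, basisValues a b ⊆ M) : RudClosed M := by
  have hpair : ∀ a ∈ M, ∀ b ∈ M, ({a, b} : ZFSet.{u}) ∈ M := fun a ha b hb =>
    hM a ha b hb (by simp [basisValues])
  have hsUnion : ∀ a ∈ M, ZFSet.sUnion a ∈ M := fun a ha => hM a ha a ha (by simp [basisValues])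
  have hprod : ∀ a ∈ M, ∀ b ∈ M, ZFSet.prod a b ∈ M := fun a ha b hb =>
    hM a ha b hb (by simp [basisValues])
  have hunion : ∀ a ∈ M, ∀ b ∈ M, a ∪ b ∈ M := fun a ha b hb => hsUnion _ (hpair a ha b hb)
  have hsing : ∀ a ∈ M, ({a} : ZFSet.{u}) ∈ M := fun a ha => by
    simpa using hpair a ha a ha
  have hpow : ∀ a ∈ M, ∀ n, power a n ∈ M := fun a ha n => by
    induction n with
    | zero => exact hsing _ h₀
    | succ n ih => exact hprod _ ha _ ih
  have key : ∀ {n : ℕ} {f : (Fin n → ZFSet.{u}) → ZFSet.{u}}, Rud {x | x ∈ M} f →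
      ∀ a ∈ M, tupleGraph a f ∈ M := by
    intro n f hf
    induction hf with
    | empty =>
      intro a ha
      rw [tupleGraph_const]
      exact hprod _ (hpow a ha _) _ (hsing _ h₀)
    | const hc =>
      intro a ha
      rw [tupleGraph_const]
      exact hprod _ (hpow a ha _) _ (hsing _ hc)
    | @proj n i =>
      intro a ha
      induction n with
      | zero => exact i.elim0
      | succ n ih =>
        refine Fin.cases ?_ (fun j => ?_) i
        · rw [tupleGraph_proj_zero]
          exact hM _ ha _ (hpow a ha n) (by simp [basisValues])
        · have := tupleGraph_tail (a := a) (f := fun v : Fin n → ZFSet.{u} => v j)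
          simp only [Fin.tail] at this
          rw [this]
          exact hM _ ha _ (ih j) (by simp [basisValues])
    | diff _ _ ih₁ ih₂ =>
      intro a ha
      rw [tupleGraph_diff]
      exact hM _ (ih₁ a ha) _ (ih₂ a ha) (by simp [basisValues])
    | upair _ _ ih₁ ih₂ =>
      intro a ha
      rw [tupleGraph_upair]
      exact hM _ (ih₁ a ha) _ (ih₂ a ha) (by simp [basisValues])
    | @bUnion' n f g _ _ ih₁ ih₂ =>
      intro a ha
      -- Two unions reach the components of the pairs in `tupleGraph a f`, a third reaches the
      -- elements of the values `f v`.
      have hb : a ∪ ZFSet.sUnion (ZFSet.sUnion (ZFSet.sUnion (tupleGraph a f))) ∈ M :=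
        hunion _ ha _ (hsUnion _ (hsUnion _ (hsUnion _ (ih₁ a ha))))
      rw [tupleGraph_bUnion (b := a ∪ ZFSet.sUnion (ZFSet.sUnion (ZFSet.sUnion (tupleGraph a f))))]
      · exact hM _ (ih₁ a ha) _ (ih₂ _ hb) (by simp [basisValues])
      · exact fun x hx => ZFSet.mem_union.2 (.inl hx)
      · intro v hv x hx
        refine ZFSet.mem_union.2 (.inr (ZFSet.mem_sUnion.2 ⟨_, ?_, hx⟩))
        exact (mem_sUnion_sUnion_of_pair_mem (mem_tupleGraph.2 ⟨v, hv, rfl⟩)).2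
  intro x hx
  -- A constant `x` is recovered from its nullary graph `{(∅, x)}`, whose threefold union is `∅ ∪
  -- x`.
  have : ZFSet.sUnion (ZFSet.sUnion (ZFSet.sUnion
      (tupleGraph ∅ fun _ : Fin 0 → ZFSet.{u} => x))) = x := by
    rw [tupleGraph_const]
    ext y
    simp [power, ZFSet.mem_prod, ZFSet.pair]
  rw [← this]
  exact hsUnion _ (hsUnion _ (hsUnion _ (key hx _ h₀)))

/-! ### The `J`-hierarchy inside the constructible hierarchy -/

/-- One step in the generation of the rudimentary closure of `x ∪ {x}`. -/
def rudStep (x : ZFSet.{u}) : ZFSet.{u} :=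
  insert x x ∪ bUnion (insert x x) fun a => bUnion (insert x x) fun b => basisValues a b

theorem Rud.rudStep {P : Set ZFSet.{u}} {n : ℕ} {f : (Fin n → ZFSet.{u}) → ZFSet.{u}}
    (hf : Rud P f) : Rud P fun v => rudStep (f v) :=
  .union (.insert hf hf) (.bUnion (g := fun a v => ClopenGames.bUnion (Insert.insert (f v) (f v))
    fun b => ClopenGames.basisValues a b) (.insert hf hf)
      (.bUnion (g := fun b w => ClopenGames.basisValues (w 0) b) (.insert hf.tail hf.tail)
        (.basisValues (.proj 1) (.proj 0))))

theorem recFun_accStep_mono {S : ZFSet.{u} → ZFSet.{u}} {δ ε : Ordinal.{u}} (h : δ ≤ ε) :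
    recFun (accStep S) δ ⊆ recFun (accStep S) ε := by
  intro x hx
  obtain ⟨ξ, hξ, hx⟩ := mem_recFun_accStep.1 hx
  exact mem_recFun_accStep.2 ⟨ξ, hξ.trans_le h, hx⟩

theorem recFun_accStep_add_one {S : ZFSet.{u} → ZFSet.{u}} (δ : Ordinal.{u}) :
    recFun (accStep S) (δ + 1) = recFun (accStep S) δ ∪ S (recFun (accStep S) δ) := by
  ext x
  simp only [mem_recFun_accStep (δ := δ + 1), ZFSet.mem_union, Order.lt_add_one_iff]
  constructor
  · rintro ⟨ξ, hξ, hx⟩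
    rcases hξ.eq_or_lt with rfl | hξ
    · exact .inr hx
    · exact .inl (mem_recFun_accStep.2 ⟨ξ, hξ, hx⟩)
  · rintro (hx | hx)
    · obtain ⟨ξ, hξ, hx⟩ := mem_recFun_accStep.1 hx
      exact ⟨ξ, hξ.le, hx⟩
    · exact ⟨δ, le_rfl, hx⟩

/-- The passage from `J_α` to `J_{α+1}` is spread over ω stages of one rudimentary step. The union
of these stages is closed under the basis functions, because any two of its elements occur together
at an earlier stage. Conversely, finitely many steps from `J_η` stay in `J_{η+1}`. -/
theorem jensenJ_eq_recFun (α : Ordinal.{u}) :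
    jensenJ α = recFun (accStep rudStep) (Ordinal.omega0 * α) := by
  induction α using WellFoundedLT.induction with
  | ind α ih =>
    ext x
    constructor
    · intro hx
      induction α using Ordinal.limitRecOn with
      | zero => simp at hx
      | limit α hα _ =>
        obtain ⟨β, hβ, hx⟩ := (mem_jensenJ_limit hα).1 hx
        rw [ih β hβ] at hx
        exact recFun_accStep_mono (by gcongr) hx
      | add_one α _ =>
        set M := recFun (accStep rudStep) (Ordinal.omega0 * (α + 1)) with hM
        have hlim : Order.IsSuccLimit (Ordinal.omega0 * (α + 1)) :=
          isSuccLimit_omega0_mul (by simp)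
        have hstep : ∀ ξ < Ordinal.omega0 * (α + 1), rudStep (recFun (accStep rudStep) ξ) ⊆ M :=
          fun ξ hξ y hy => mem_recFun_accStep.2 ⟨ξ, hξ, hy⟩
        have hmem : ∀ y ∈ M, ∃ ξ < Ordinal.omega0 * (α + 1), y ∈ recFun (accStep rudStep) ξ := by
          intro y hy
          obtain ⟨ξ, hξ, hy⟩ := mem_recFun_accStep.1 hy
          exact ⟨ξ + 1, hlim.add_one_lt hξ, mem_recFun_accStep.2 ⟨ξ, by simp, hy⟩⟩
        have h₀ : ∅ ∈ M := by
          refine hstep 0 hlim.pos ?_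
          have : recFun (accStep rudStep) 0 = (∅ : ZFSet.{u}) := by
            rw [ZFSet.eq_empty]
            intro y hy
            obtain ⟨ξ, hξ, -⟩ := mem_recFun_accStep.1 hy
            simp at hξ
          rw [this]
          exact ZFSet.mem_union.2 (.inl (by simp))
        have hclosed : RudClosed M := by
          refine rudClosed_of_basisValues_subset h₀ fun a ha b hb y hy => ?_
          obtain ⟨ξ, hξ, ha⟩ := hmem a ha
          obtain ⟨ζ, hζ, hb⟩ := hmem b hb
          refine hstep (max ξ ζ) (max_lt hξ hζ) (ZFSet.mem_union.2 (.inr ?_))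
          simp only [mem_bUnion]
          exact ⟨a, ZFSet.mem_insert_of_mem _ (recFun_accStep_mono (le_max_left _ _) ha), b,
            ZFSet.mem_insert_of_mem _ (recFun_accStep_mono (le_max_right _ _) hb), hy⟩
        rw [jensenJ_add_one, mem_rudClosure (exists_mem_insert _)] at hx
        refine hclosed x (hx.mono fun y hy => ?_)
        refine hstep (Ordinal.omega0 * α) ?_ (ZFSet.mem_union.2 (.inl ?_))
        · rw [mul_add, mul_one]
          exact lt_add_of_pos_right _ Ordinal.omega0_pos
        · rwa [← ih α (by simp)]
    · intro hx
      obtain ⟨ξ, hξ, hx⟩ := mem_recFun_accStep.1 hx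
      obtain ⟨η, hη, k, rfl⟩ := exists_eq_omega0_mul_add hξ
      have hc : RudClosed (jensenJ (η + 1)) := rudHierarchy_jensenJ.closed _ (by simp)
      have hk : recFun (accStep rudStep) (Ordinal.omega0 * η + k) ∈ jensenJ (η + 1) := by
        clear hx hξ
        induction k with
        | zero =>
          rw [Nat.cast_zero, add_zero, ← ih η hη]
          exact rudHierarchy_jensenJ.mem_add_one _
        | succ k ihk =>
          rw [Nat.cast_succ, ← add_assoc, recFun_accStep_add_one]
          exact hc _ (.union (.const ihk) (.rudStep (.const ihk)))
      exact jensenJ_mono (Order.add_one_le_of_lt hη)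
        (isTransitive_jensenJ _ _ (hc _ (.rudStep (.const hk))) hx)

theorem jensenJ_mem_godelL (α : Ordinal.{u}) :
    jensenJ α ∈ godelL (Ordinal.omega0 * (α + 1)) := by
  have := rudHierarchy_godelL.value_mem (recFun_eq (accStep rudStep)) (α := 0)
    (.accStep (.rudStep (.proj 0))) α 0
  rwa [Nat.cast_zero, add_zero, zero_add, ← jensenJ_eq_recFun] at this

/-! ### Generating the definable subsets of a set by rudimentary functions -/

/-- The set of tuples from `M` with the property `Φ`. -/
def tupleSet (M : ZFSet.{u}) {k : ℕ} (Φ : (Fin k → ZFSet.{u}) → Prop) : ZFSet.{u} :=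
  ZFSet.sep (fun p => ∃ v : Fin k → ZFSet.{u}, Φ v ∧ p = tuple v) (power M k)

/-- `{(x, (x, t)) : (x, t) ∈ r}`. -/
def diagOp (r : ZFSet.{u}) : ZFSet.{u} := img (ZFSet.sep IsPair r) fun p => ZFSet.pair (fst p) p

/-- `{(y, (x, t)) : x ∈ a, (y, t) ∈ r}`. -/
def insertOp (a r : ZFSet.{u}) : ZFSet.{u} :=
  img (ZFSet.prod a (ZFSet.sep IsPair r)) fun q =>
    ZFSet.pair (fst (snd q)) (ZFSet.pair (fst q) (snd (snd q)))

/-- `{(y, t) ∈ s : ∃ x ∈ y, (x, t) ∈ r}`. -/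
def memOp (r s : ZFSet.{u}) : ZFSet.{u} :=
  ZFSet.sep (fun p => IsPair p ∧ ∃ x ∈ fst p, ZFSet.pair x (snd p) ∈ r) s

section
variable {M : ZFSet.{u}} {k l : ℕ} {Φ : (Fin k → ZFSet.{u}) → Prop}

theorem mem_tupleSet {p : ZFSet.{u}} : p ∈ tupleSet M Φ ↔
    ∃ v : Fin k → ZFSet.{u}, (∀ i, v i ∈ M) ∧ Φ v ∧ p = tuple v := by
  simp only [tupleSet, ZFSet.mem_sep, mem_power]
  constructor
  · rintro ⟨⟨v, hv, rfl⟩, w, hw, h⟩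
    rw [tuple_injective h] at hv ⊢
    exact ⟨w, hv, hw, rfl⟩
  · rintro ⟨v, hv, hΦ, rfl⟩
    exact ⟨⟨v, hv, rfl⟩, v, hΦ, rfl⟩

theorem tuple_mem_tupleSet {v : Fin k → ZFSet.{u}} :
    tuple v ∈ tupleSet M Φ ↔ (∀ i, v i ∈ M) ∧ Φ v := by
  rw [mem_tupleSet]
  constructor
  · rintro ⟨w, hw, hΦ, h⟩
    rw [tuple_injective h]
    exact ⟨hw, hΦ⟩
  · rintro ⟨hv, hΦ⟩
    exact ⟨v, hv, hΦ, rfl⟩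

theorem pair_ne_empty (x y : ZFSet.{u}) : ZFSet.pair x y ≠ ∅ := by
  intro h
  have : ({x} : ZFSet.{u}) ∈ ZFSet.pair x y := by simp [ZFSet.pair]
  rw [h] at this
  exact ZFSet.notMem_empty _ this

/-- Relations of all arities are kept in one set, so the generating operations also meet relations
of different arities. That a tuple determines its length makes the stray results harmless. -/
theorem length_eq_of_tuple_eq {k l : ℕ} {v : Fin k → ZFSet.{u}} {w : Fin l → ZFSet.{u}}
    (h : tuple v = tuple w) : k = l := by
  induction k generalizing l with
  | zero =>
    cases l with
    | zero => rfl
    | succ l => exact absurd h.symm (pair_ne_empty _ _)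
  | succ k ih =>
    cases l with
    | zero => exact absurd h (pair_ne_empty _ _)
    | succ l => rw [ih (ZFSet.pair_inj.1 h).2]

theorem forall_cons_mem {x : ZFSet.{u}} {v : Fin k → ZFSet.{u}} :
    (∀ i, (Fin.cons x v : Fin (k + 1) → ZFSet.{u}) i ∈ M) ↔ x ∈ M ∧ ∀ i, v i ∈ M := by
  rw [Fin.forall_fin_succ]
  simp

theorem pair_mem_tupleSet_iff {Φ : (Fin (k + 1) → ZFSet.{u}) → Prop} {x p : ZFSet.{u}} :
    ZFSet.pair x p ∈ tupleSet M Φ ↔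
      x ∈ M ∧ ∃ v : Fin k → ZFSet.{u}, (∀ i, v i ∈ M) ∧ Φ (Fin.cons x v) ∧ p = tuple v := by
  rw [mem_tupleSet]
  constructor
  · rintro ⟨v, hv, hΦ, h⟩
    obtain ⟨rfl, rfl⟩ := ZFSet.pair_inj.1 h
    exact ⟨hv 0, Fin.tail v, fun i => hv _, by rwa [Fin.cons_self_tail], rfl⟩
  · rintro ⟨hx, v, hv, hΦ, rfl⟩
    exact ⟨Fin.cons x v, forall_cons_mem.2 ⟨hx, hv⟩, hΦ, rfl⟩

theorem tupleSet_diff (Φ Ψ : (Fin k → ZFSet.{u}) → Prop) :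
    tupleSet M Φ \ tupleSet M Ψ = tupleSet M fun v => Φ v ∧ ¬ Ψ v := by
  ext p
  rw [ZFSet.mem_sdiff]
  constructor
  · rintro ⟨hp, hp'⟩
    obtain ⟨v, hv, hΦ, rfl⟩ := mem_tupleSet.1 hp
    exact tuple_mem_tupleSet.2 ⟨hv, hΦ, fun h => hp' (tuple_mem_tupleSet.2 ⟨hv, h⟩)⟩
  · intro hp
    obtain ⟨v, hv, hΦ, rfl⟩ := mem_tupleSet.1 hp
    exact ⟨tuple_mem_tupleSet.2 ⟨hv, hΦ.1⟩, fun h => hΦ.2 (tuple_mem_tupleSet.1 h).2⟩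

theorem tupleSet_diff_of_ne (hkl : k ≠ l) (Φ : (Fin k → ZFSet.{u}) → Prop)
    (Ψ : (Fin l → ZFSet.{u}) → Prop) : tupleSet M Φ \ tupleSet M Ψ = tupleSet M Φ := by
  ext p
  rw [ZFSet.mem_sdiff, and_iff_left_iff_imp]
  intro hp hp'
  obtain ⟨v, -, -, rfl⟩ := mem_tupleSet.1 hp
  obtain ⟨w, -, -, h⟩ := mem_tupleSet.1 hp'
  exact hkl (length_eq_of_tuple_eq h)

theorem ran_tupleSet (Φ : (Fin (k + 1) → ZFSet.{u}) → Prop) :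
    ran (tupleSet M Φ) = tupleSet M fun v => ∃ x ∈ M, Φ (Fin.cons x v) := by
  ext p
  simp only [mem_ran, pair_mem_tupleSet_iff]
  rw [mem_tupleSet]
  grind

theorem prod_tupleSet (Φ : (Fin k → ZFSet.{u}) → Prop) :
    ZFSet.prod M (tupleSet M Φ) = tupleSet M fun v => Φ (Fin.tail v) := by
  ext p
  simp only [ZFSet.mem_prod, mem_tupleSet]
  constructor
  · rintro ⟨x, hx, _, ⟨v, hv, hΦ, rfl⟩, rfl⟩
    exact ⟨Fin.cons x v, forall_cons_mem.2 ⟨hx, hv⟩, by simpa using hΦ, rfl⟩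
  · rintro ⟨v, hv, hΦ, rfl⟩
    exact ⟨v 0, hv 0, _, ⟨Fin.tail v, fun i => hv _, hΦ, rfl⟩, rfl⟩

theorem singleton_prod_tupleSet {c : ZFSet.{u}} (hc : c ∈ M) (Φ : (Fin k → ZFSet.{u}) → Prop) :
    ZFSet.prod {c} (tupleSet M Φ) = tupleSet M fun v => v 0 = c ∧ Φ (Fin.tail v) := by
  ext p
  simp only [ZFSet.mem_prod, mem_tupleSet, ZFSet.mem_singleton]
  constructor
  · rintro ⟨x, rfl, _, ⟨v, hv, hΦ, rfl⟩, rfl⟩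
    exact ⟨Fin.cons x v, forall_cons_mem.2 ⟨hc, hv⟩, by simpa using hΦ, rfl⟩
  · rintro ⟨v, hv, ⟨rfl, hΦ⟩, rfl⟩
    exact ⟨v 0, rfl, _, ⟨Fin.tail v, fun i => hv _, hΦ, rfl⟩, rfl⟩

theorem diagOp_tupleSet (Φ : (Fin (k + 1) → ZFSet.{u}) → Prop) :
    diagOp (tupleSet M Φ) = tupleSet M fun v => v 0 = v 1 ∧ Φ (Fin.tail v) := by
  ext p
  simp only [diagOp, mem_img, ZFSet.mem_sep, mem_tupleSet]
  constructor
  · rintro ⟨_, ⟨⟨v, hv, hΦ, rfl⟩, -⟩, rfl⟩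
    exact ⟨Fin.cons (v 0) v, forall_cons_mem.2 ⟨hv 0, hv⟩, by simpa using hΦ, by simp [tuple]⟩
  · rintro ⟨v, hv, ⟨h, hΦ⟩, rfl⟩
    exact ⟨_, ⟨⟨Fin.tail v, fun i => hv _, hΦ, rfl⟩, by simp [tuple]⟩, by simp [tuple, h, Fin.tail]⟩

theorem insertOp_tupleSet (Φ : (Fin (k + 1) → ZFSet.{u}) → Prop) :
    insertOp M (tupleSet M Φ) =
      tupleSet M fun v : Fin (k + 2) → ZFSet.{u} => Φ (Fin.cons (v 0) (Fin.tail (Fin.tail v))) := by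
  ext p
  simp only [insertOp, mem_img, ZFSet.mem_prod, ZFSet.mem_sep, mem_tupleSet]
  constructor
  · rintro ⟨_, ⟨x, hx, _, ⟨⟨v, hv, hΦ, rfl⟩, -⟩, rfl⟩, rfl⟩
    exact ⟨Fin.cons (v 0) (Fin.cons x (Fin.tail v)),
      forall_cons_mem.2 ⟨hv 0, forall_cons_mem.2 ⟨hx, fun i => hv _⟩⟩, by simpa using hΦ,
      by simp [tuple]⟩
  · rintro ⟨v, hv, hΦ, rfl⟩
    exact ⟨_, ⟨v 1, hv 1, _, ⟨⟨Fin.cons (v 0) (Fin.tail (Fin.tail v)),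
      forall_cons_mem.2 ⟨hv 0, fun i => hv _⟩, hΦ, rfl⟩, by simp [tuple]⟩, rfl⟩,
      by simp [tuple]; simp [Fin.tail]⟩

theorem memOp_tupleSet (Φ Ψ : (Fin (k + 1) → ZFSet.{u}) → Prop) :
    memOp (tupleSet M Φ) (tupleSet M Ψ) =
      tupleSet M fun v => Ψ v ∧ ∃ x ∈ M, x ∈ v 0 ∧ Φ (Fin.cons x (Fin.tail v)) := by
  ext p
  rw [memOp, ZFSet.mem_sep]
  constructor
  · rintro ⟨hp, -, x, hx, h⟩
    obtain ⟨v, hv, hΨ, rfl⟩ := mem_tupleSet.1 hp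
    rw [tuple, fst_pair] at hx
    rw [tuple, snd_pair, pair_mem_tupleSet_iff] at h
    obtain ⟨hxM, w, hw, hΦ, h⟩ := h
    rw [← tuple_injective h] at hΦ
    exact tuple_mem_tupleSet.2 ⟨hv, hΨ, x, hxM, hx, hΦ⟩
  · intro hp
    obtain ⟨v, hv, ⟨hΨ, x, hxM, hx, hΦ⟩, rfl⟩ := mem_tupleSet.1 hp
    refine ⟨tuple_mem_tupleSet.2 ⟨hv, hΨ⟩, by simp [tuple], x, by simpa [tuple] using hx, ?_⟩
    rw [tuple, snd_pair, pair_mem_tupleSet_iff]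
    exact ⟨hxM, Fin.tail v, fun i => hv _, hΦ, rfl⟩

theorem memOp_tupleSet_of_ne (hkl : k ≠ l) (Φ : (Fin k → ZFSet.{u}) → Prop)
    (Ψ : (Fin l → ZFSet.{u}) → Prop) : memOp (tupleSet M Φ) (tupleSet M Ψ) = ∅ := by
  rw [ZFSet.eq_empty]
  intro p hp
  rw [memOp, ZFSet.mem_sep] at hp
  obtain ⟨hp, hpair, x, hx, h⟩ := hp
  obtain ⟨v, -, -, h₁⟩ := mem_tupleSet.1 hp
  obtain ⟨w, -, -, h₂⟩ := mem_tupleSet.1 h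
  cases l with
  | zero => exact pair_ne_empty _ _ (hpair.symm.trans h₁)
  | succ l =>
    cases k with
    | zero => exact pair_ne_empty _ _ h₂
    | succ k =>
      rw [h₁, tuple, snd_pair] at h₂
      exact hkl (by rw [length_eq_of_tuple_eq (ZFSet.pair_inj.1 h₂).2])

theorem not_isPair_of_mem_tupleSet_zero {Φ : (Fin 0 → ZFSet.{u}) → Prop} {p : ZFSet.{u}}
    (hp : p ∈ tupleSet M Φ) : ¬ IsPair p := by
  obtain ⟨v, -, -, rfl⟩ := mem_tupleSet.1 hp
  intro h
  exact pair_ne_empty _ _ h.symm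

theorem sep_isPair_tupleSet_zero (Φ : (Fin 0 → ZFSet.{u}) → Prop) :
    ZFSet.sep IsPair (tupleSet M Φ) = ∅ := by
  rw [ZFSet.eq_empty]
  intro p hp
  exact not_isPair_of_mem_tupleSet_zero (ZFSet.mem_sep.1 hp).1 (ZFSet.mem_sep.1 hp).2

end

/-- One step in the generation of the definable relations over `M`. -/
def defStep (M D : ZFSet.{u}) : ZFSet.{u} :=
  D ∪ bUnion D fun r => (img M fun c => ZFSet.prod {c} r) ∪ bUnion D fun s =>
    {r \ s, ran r, ZFSet.prod M r, diagOp r, insertOp M r, memOp r s}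

theorem Rud.defStep {P : Set ZFSet.{u}} {n : ℕ} {f g : (Fin n → ZFSet.{u}) → ZFSet.{u}}
    (hf : Rud P f) (hg : Rud P g) : Rud P fun v => defStep (f v) (g v) := by
  refine .union hg (.bUnion (g := fun r v => (ClopenGames.img (f v) fun c => ZFSet.prod {c} r) ∪
    ClopenGames.bUnion (g v) fun s => {r \ s, ClopenGames.ran r, ZFSet.prod (f v) r, diagOp r, insertOp (f v) r,
      memOp r s}) hg (.union ?_ ?_))
  · exact .img (g := fun c w => ZFSet.prod {c} (w 0)) hf.tail (.prod (.singleton (.proj 0)) (.proj 1))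
  · refine .bUnion (g := fun s w => {w 0 \ s, ClopenGames.ran (w 0), ZFSet.prod (f (Fin.tail w)) (w 0),
      diagOp (w 0), insertOp (f (Fin.tail w)) (w 0), memOp (w 0) s}) hg.tail ?_
    refine .insert (.diff (.proj 1) (.proj 0)) <| .insert (.ran (.proj 1)) <|
      .insert (.prod hf.tail.tail (.proj 1)) <| .insert ?_ <| .insert ?_ <| .singleton ?_
    · exact .img (g := fun p _ => ZFSet.pair (ClopenGames.fst p) p) (Rud.proj 1).sepPairs
        (.pair (.fst (.proj 0)) (.proj 0))
    · exact .img (g := fun q _ => ZFSet.pair (ClopenGames.fst (ClopenGames.snd q))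
        (ZFSet.pair (ClopenGames.fst q) (ClopenGames.snd (ClopenGames.snd q))))
        (.prod hf.tail.tail (Rud.proj 1).sepPairs)
        (.pair (Rud.proj 0).snd.fst (.pair (Rud.proj 0).fst (Rud.proj 0).snd.snd))
    · exact .sep (R := fun p w => IsPair p ∧ ∃ x ∈ ClopenGames.fst p,
        ZFSet.pair x (ClopenGames.snd p) ∈ w 1) (.proj 0) (.and (.isPair (.proj 0))
          (.bex (R := fun x w => ZFSet.pair x (ClopenGames.snd (w 0)) ∈ w 2) (.fst (.proj 0))
            (.mem (.pair (.proj 0) (.snd (.proj 1))) (.proj 3))))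

/-- The definable relations over `M` generated in `j` steps. -/
def defIter (M : ZFSet.{u}) : ℕ → ZFSet.{u}
  | 0 => {{∅}}
  | j + 1 => defStep M (defIter M j)

/-- The subset of `M` coded by a unary relation. -/
def unaryPart (M r : ZFSet.{u}) : ZFSet.{u} := ZFSet.sep (fun x => ZFSet.pair x ∅ ∈ r) M

section
variable {M : ZFSet.{u}}

/-- Soundness of the generating operations. Where arities do not fit (`k = 0` or `k ≠ l`), the
result is `∅` or the first relation unchanged, so it is still definable. -/
theorem exists_tupleSet_of_mem_defIter {j : ℕ} {r : ZFSet.{u}} (hr : r ∈ defIter M j) :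
    ∃ (k : ℕ) (Φ : (Fin k → ZFSet.{u}) → Prop), DefRel M Φ ∧ r = tupleSet M Φ := by
  have hempty : ∃ (k : ℕ) (Φ : (Fin k → ZFSet.{u}) → Prop), DefRel M Φ ∧ ∅ = tupleSet M Φ :=
    ⟨0, fun _ => ¬ True, DefRel.true.not, by
      symm
      rw [ZFSet.eq_empty]
      intro p hp
      simp [mem_tupleSet] at hp⟩
  induction j generalizing r with
  | zero =>
    rw [defIter, ZFSet.mem_singleton] at hr
    refine ⟨0, fun _ => True, .true, ?_⟩
    ext p
    simp [hr, mem_tupleSet, tuple]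
  | succ j ih =>
    rw [defIter, defStep, ZFSet.mem_union, mem_bUnion] at hr
    rcases hr with hr | ⟨r, hr', hr⟩
    · exact ih hr
    obtain ⟨k, Φ, hΦ, rfl⟩ := ih hr'
    rw [ZFSet.mem_union, mem_img, mem_bUnion] at hr
    have htail : DefRel M fun v : Fin (k + 1) → ZFSet.{u} => Φ (Fin.tail v) :=
      hΦ.subst (f := fun i v => Fin.tail v i) fun i => .proj i.succ
    rcases hr with ⟨c, hc, rfl⟩ | ⟨s, hs, hr⟩
    · exact ⟨k + 1, _, (DefRel.eq (.proj 0) (.const hc)).and htail, singleton_prod_tupleSet hc Φ⟩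
    obtain ⟨l, Ψ, hΨ, rfl⟩ := ih hs
    simp only [ZFSet.mem_insert_iff, ZFSet.mem_singleton] at hr
    rcases hr with rfl | rfl | rfl | rfl | rfl | rfl
    · rcases eq_or_ne k l with rfl | hkl
      · exact ⟨k, _, hΦ.and hΨ.not, tupleSet_diff Φ Ψ⟩
      · exact ⟨k, _, hΦ, tupleSet_diff_of_ne hkl Φ Ψ⟩
    · cases k with
      | zero =>
        rw [ran, sep_isPair_tupleSet_zero]
        have : img ∅ snd = (∅ : ZFSet.{u}) := by ext; simp
        rwa [this]
      | succ k =>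
        refine ⟨k, _, .ex (R := fun x v => Φ (Fin.cons x v)) (hΦ.congr fun v _ => ?_), ran_tupleSet Φ⟩
        rw [Fin.cons_self_tail]
    · exact ⟨k + 1, _, htail, prod_tupleSet Φ⟩
    · cases k with
      | zero =>
        have : diagOp (tupleSet M Φ) = ∅ := by
          rw [diagOp, sep_isPair_tupleSet_zero]
          ext
          simp
        rwa [this]
      | succ k => exact ⟨k + 2, _, (DefRel.eq (.proj 0) (.proj 1)).and htail, diagOp_tupleSet Φ⟩
    · cases k with
      | zero =>
        have : insertOp M (tupleSet M Φ) = ∅ := by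
          rw [insertOp, sep_isPair_tupleSet_zero]
          ext
          simp [ZFSet.mem_prod]
        rwa [this]
      | succ k =>
        refine ⟨k + 2, _, hΦ.subst (f := fun i v =>
          (Fin.cons (v 0) (Fin.tail (Fin.tail v)) : Fin (k + 1) → ZFSet.{u}) i) fun i => ?_,
          insertOp_tupleSet Φ⟩
        exact Fin.cases (.proj 0) (fun j => .proj j.succ.succ) i
    · rcases eq_or_ne k l with rfl | hkl
      · cases k with
        | zero =>
          have : memOp (tupleSet M Φ) (tupleSet M Ψ) = ∅ := by
            rw [memOp, ZFSet.eq_empty]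
            intro p hp
            exact not_isPair_of_mem_tupleSet_zero (ZFSet.mem_sep.1 hp).1 (ZFSet.mem_sep.1 hp).2.1
          rwa [this]
        | succ k =>
          refine ⟨k + 1, _, hΨ.and (.ex (R := fun x v => x ∈ v 0 ∧ Φ (Fin.cons x (Fin.tail v)))
            (.and (.mem (.proj 0) (.proj 1)) (hΦ.subst (f := fun i v =>
              (Fin.cons (v 0) (Fin.tail (Fin.tail v)) : Fin (k + 1) → ZFSet.{u}) i) fun i => ?_))),
            memOp_tupleSet Φ Ψ⟩
          exact Fin.cases (.proj 0) (fun j => .proj j.succ.succ) i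
      · rwa [memOp_tupleSet_of_ne hkl]

theorem unaryPart_mem_defPowerset {j : ℕ} {r : ZFSet.{u}} (hr : r ∈ defIter M j) :
    unaryPart M r ∈ defPowerset M := by
  obtain ⟨k, Φ, hΦ, rfl⟩ := exists_tupleSet_of_mem_defIter hr
  refine sep_mem_defPowerset ?_
  by_cases hk : k = 1
  · subst hk
    refine hΦ.congr fun v hv => ?_
    have : ZFSet.pair (v 0) ∅ = tuple v := rfl
    rw [this, tuple_mem_tupleSet, and_iff_right hv]
  · refine DefRel.true.not.congr fun v _ => ?_
    simp only [not_true_eq_false, iff_false]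
    intro h
    obtain ⟨w, -, -, h⟩ := mem_tupleSet.1 h
    have : ZFSet.pair (v 0) ∅ = tuple v := rfl
    exact hk (length_eq_of_tuple_eq (this ▸ h)).symm

end

/-! ### Completeness: every definable relation is generated -/

section
variable {M : ZFSet.{u}}

theorem defIter_mono {i j : ℕ} (h : i ≤ j) : defIter M i ⊆ defIter M j := by
  induction h with
  | refl => exact fun _ h => h
  | step _ ih => exact fun x hx => ZFSet.mem_union.2 (.inl (ih hx))

/-- `r` is one of the generated definable relations over `M`. -/
def IsGenerated (M r : ZFSet.{u}) : Prop := ∃ j, r ∈ defIter M j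

theorem IsGenerated.step {r s t : ZFSet.{u}} (hr : IsGenerated M r) (hs : IsGenerated M s)
    (ht : t ∈ ({r \ s, ran r, ZFSet.prod M r, diagOp r, insertOp M r, memOp r s} : ZFSet.{u})) :
    IsGenerated M t := by
  obtain ⟨i, hr⟩ := hr
  obtain ⟨j, hs⟩ := hs
  refine ⟨max i j + 1, ZFSet.mem_union.2 (.inr (mem_bUnion.2
    ⟨r, defIter_mono (le_max_left _ _) hr, ZFSet.mem_union.2 (.inr (mem_bUnion.2
      ⟨s, defIter_mono (le_max_right _ _) hs, ht⟩))⟩))⟩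

variable {k : ℕ} {Φ Ψ : (Fin k → ZFSet.{u}) → Prop}

theorem IsGenerated.const {c : ZFSet.{u}} (hc : c ∈ M) (h : IsGenerated M (tupleSet M Φ)) :
    IsGenerated M (tupleSet M fun v : Fin (k + 1) → ZFSet.{u} => v 0 = c ∧ Φ (Fin.tail v)) := by
  obtain ⟨j, h⟩ := h
  rw [← singleton_prod_tupleSet hc]
  exact ⟨j + 1, ZFSet.mem_union.2 (.inr (mem_bUnion.2
    ⟨_, h, ZFSet.mem_union.2 (.inl (mem_img.2 ⟨c, hc, rfl⟩))⟩))⟩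

theorem IsGenerated.congr {r s : ZFSet.{u}} (h : IsGenerated M r) (hrs : s = r) :
    IsGenerated M s := hrs ▸ h

theorem tupleSet_congr (h : ∀ v : Fin k → ZFSet.{u}, (∀ i, v i ∈ M) → (Φ v ↔ Ψ v)) :
    tupleSet M Φ = tupleSet M Ψ := by
  ext p
  simp only [mem_tupleSet]
  exact exists_congr fun v => and_congr_right fun hv => by rw [h v hv]

theorem IsGenerated.andNot (h₁ : IsGenerated M (tupleSet M Φ)) (h₂ : IsGenerated M (tupleSet M Ψ)) :
    IsGenerated M (tupleSet M fun v => Φ v ∧ ¬ Ψ v) :=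
  h₁.step h₂ (by rw [tupleSet_diff]; simp)

theorem IsGenerated.and (h₁ : IsGenerated M (tupleSet M Φ)) (h₂ : IsGenerated M (tupleSet M Ψ)) :
    IsGenerated M (tupleSet M fun v => Φ v ∧ Ψ v) :=
  (h₁.andNot (h₁.andNot h₂)).congr (tupleSet_congr fun v _ => by tauto)

theorem IsGenerated.ex {Φ : (Fin (k + 1) → ZFSet.{u}) → Prop} (h : IsGenerated M (tupleSet M Φ)) :
    IsGenerated M (tupleSet M fun v => ∃ x ∈ M, Φ (Fin.cons x v)) :=
  h.step h (by rw [ran_tupleSet]; simp)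

theorem IsGenerated.tail (h : IsGenerated M (tupleSet M Φ)) :
    IsGenerated M (tupleSet M fun v : Fin (k + 1) → ZFSet.{u} => Φ (Fin.tail v)) :=
  h.step h (by rw [prod_tupleSet]; simp)

theorem isGenerated_true : IsGenerated M (tupleSet M fun _ : Fin k → ZFSet.{u} => True) := by
  induction k with
  | zero =>
    refine ⟨0, ?_⟩
    rw [defIter, ZFSet.mem_singleton]
    ext p
    simp [mem_tupleSet, tuple]
  | succ k ih => exact ih.tail

/-- Built up from the diagonal: `diagOp` duplicates the head of a tuple, and `insertOp` puts a fresh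
coordinate directly behind the head, moving the compared coordinate one place on. -/
theorem isGenerated_var (i : Fin k) :
    IsGenerated M (tupleSet M fun v : Fin (k + 1) → ZFSet.{u} => v 0 = v i.succ) := by
  induction k with
  | zero => exact i.elim0
  | succ k ih =>
    refine Fin.cases ?_ (fun j => ?_) i
    · have h : IsGenerated M (tupleSet M fun _ : Fin (k + 1) → ZFSet.{u} => True) := isGenerated_true
      refine (h.step h (t := diagOp (tupleSet M fun _ : Fin (k + 1) → ZFSet.{u} => True)) (by simp)).congr ?_
      rw [diagOp_tupleSet]
      simp
    · refine ((ih j).step (ih j) (t := insertOp M (tupleSet M fun v : Fin (k + 1) → ZFSet.{u} =>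
      v 0 = v j.succ)) (by simp)).congr ?_
      rw [insertOp_tupleSet]
      rfl

variable {f g : (Fin k → ZFSet.{u}) → ZFSet.{u}}

theorem IsGenerated.eq (hf : IsGenerated M (tupleSet M fun v : Fin (k + 1) → ZFSet.{u} =>
      v 0 = f (Fin.tail v)))
    (hg : IsGenerated M (tupleSet M fun v : Fin (k + 1) → ZFSet.{u} => v 0 = g (Fin.tail v)))
    (hfM : ∀ v : Fin k → ZFSet.{u}, (∀ i, v i ∈ M) → f v ∈ M) :
    IsGenerated M (tupleSet M fun v => f v = g v) :=
  (hf.and hg).ex.congr (tupleSet_congr fun v hv => by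
    simp only [Fin.cons_zero, Fin.tail_cons]
    exact ⟨fun h => ⟨_, hfM v hv, rfl, h⟩, fun ⟨_, _, h₁, h₂⟩ => h₁.symm.trans h₂⟩)

/-- `memOp` compares the heads of two graphs over the same arguments; projecting the head away
leaves the relation between the values. Both functions must stay in `M` for the witnesses to exist
there. -/
theorem IsGenerated.mem (hf : IsGenerated M (tupleSet M fun v : Fin (k + 1) → ZFSet.{u} =>
      v 0 = f (Fin.tail v)))
    (hg : IsGenerated M (tupleSet M fun v : Fin (k + 1) → ZFSet.{u} => v 0 = g (Fin.tail v)))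
    (hfM : ∀ v : Fin k → ZFSet.{u}, (∀ i, v i ∈ M) → f v ∈ M)
    (hgM : ∀ v : Fin k → ZFSet.{u}, (∀ i, v i ∈ M) → g v ∈ M) :
    IsGenerated M (tupleSet M fun v => f v ∈ g v) := by
  have h := hf.step hg (t := memOp (tupleSet M fun v : Fin (k + 1) → ZFSet.{u} =>
    v 0 = f (Fin.tail v)) (tupleSet M fun v : Fin (k + 1) → ZFSet.{u} => v 0 = g (Fin.tail v)))
    (by simp)
  rw [memOp_tupleSet] at h
  refine h.ex.congr (tupleSet_congr fun v hv => ?_)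
  simp only [Fin.cons_zero, Fin.tail_cons]
  constructor
  · exact fun h => ⟨_, hgM v hv, rfl, _, hfM v hv, h, rfl⟩
  · rintro ⟨_, -, rfl, _, -, h, rfl⟩
    exact h

/-- The assignment to the variables of a formula with one free variable given by a tuple, whose last
entry is the value of the free variable. -/
def assignment {n : ℕ} (v : Fin (n + 1) → {x : ZFSet.{u} // x ∈ M}) :
    Fin 1 ⊕ Fin n → {x : ZFSet.{u} // x ∈ M} :=
  Sum.elim (fun _ => v (Fin.last n)) fun i => v i.rev.castSucc

/-- The only terms are variables and constants naming elements of `M`, and the graph of each is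
generated. -/
theorem exists_realize_eq {n : ℕ}
    (t : setLang[[(Set.univ : Set {x : ZFSet.{u} // x ∈ M})]].Term (Fin 1 ⊕ Fin n)) :
    ∃ f : (Fin (n + 1) → ZFSet.{u}) → ZFSet.{u},
      IsGenerated M (tupleSet M fun v : Fin (n + 2) → ZFSet.{u} => v 0 = f (Fin.tail v)) ∧
      (∀ v : Fin (n + 1) → ZFSet.{u}, (∀ i, v i ∈ M) → f v ∈ M) ∧
      ∀ v : Fin (n + 1) → {x : ZFSet.{u} // x ∈ M},
        (t.realize (assignment v)).1 = f fun i => (v i).1 := by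
  have hvar : ∀ i : Fin (n + 1), ∃ f : (Fin (n + 1) → ZFSet.{u}) → ZFSet.{u},
      IsGenerated M (tupleSet M fun v : Fin (n + 2) → ZFSet.{u} => v 0 = f (Fin.tail v)) ∧
      (∀ v : Fin (n + 1) → ZFSet.{u}, (∀ i, v i ∈ M) → f v ∈ M) ∧
      ∀ v : Fin (n + 1) → {x : ZFSet.{u} // x ∈ M}, (v i).1 = f fun i => (v i).1 :=
    fun i => ⟨fun v => v i, isGenerated_var i, fun v hv => hv i, fun _ => rfl⟩
  cases t with
  | var i =>
    rcases i with i | i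
    · exact hvar _
    · exact hvar _
  | @func l F ts =>
    rcases F with F | F
    · exact F.elim
    · match l, F with
      | 0, c =>
        refine ⟨fun _ => c.1.1, ?_, fun _ _ => c.1.2, fun v => rfl⟩
        exact (isGenerated_true.const c.1.2).congr (tupleSet_congr fun v _ => by simp)
      | _ + 1, F => exact F.elim

/-- Induction on the formula. Tuples list the bound variables with the most recent first and end
with the free variable, so that quantifying over the newest variable drops the head of the tuple,
which is what `ran` does. -/
theorem isGenerated_realize {n : ℕ}
    (φ : setLang[[(Set.univ : Set {x : ZFSet.{u} // x ∈ M})]].BoundedFormula (Fin 1) n) :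
    IsGenerated M (tupleSet M fun v : Fin (n + 1) → ZFSet.{u} => ∃ h : ∀ i, v i ∈ M,
      φ.Realize (fun _ => (⟨v (Fin.last n), h _⟩ : {x : ZFSet.{u} // x ∈ M}))
        fun i => (⟨v i.rev.castSucc, h _⟩ : {x : ZFSet.{u} // x ∈ M})) := by
  induction φ with
  | falsum =>
    refine (isGenerated_true.andNot isGenerated_true).congr (tupleSet_congr fun v _ => ?_)
    simp [BoundedFormula.Realize]
  | equal t₁ t₂ =>
    obtain ⟨f, hf, hfM, h₁⟩ := exists_realize_eq t₁
    obtain ⟨g, hg, hgM, h₂⟩ := exists_realize_eq t₂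
    refine (hf.eq hg hfM).congr (tupleSet_congr fun v hv => ?_)
    rw [exists_prop_of_true hv, BoundedFormula.Realize, ← h₁ fun i => ⟨v i, hv i⟩,
      ← h₂ fun i => ⟨v i, hv i⟩, ← Subtype.ext_iff]
    rfl
  | @rel n l R ts =>
    rcases R with R | R
    · cases R with
      | mem =>
        obtain ⟨f, hf, hfM, h₁⟩ := exists_realize_eq (ts 0)
        obtain ⟨g, hg, hgM, h₂⟩ := exists_realize_eq (ts 1)
        refine (hf.mem hg hfM hgM).congr (tupleSet_congr fun v hv => ?_)
        rw [exists_prop_of_true hv, ← h₁ fun i => ⟨v i, hv i⟩, ← h₂ fun i => ⟨v i, hv i⟩]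
        rfl
    · exact R.elim
  | imp _ _ ih₁ ih₂ =>
    refine (isGenerated_true.andNot (ih₁.andNot ih₂)).congr (tupleSet_congr fun v hv => ?_)
    simp only [exists_prop_of_true hv, BoundedFormula.realize_imp]
    tauto
  | @all n φ ih =>
    refine (isGenerated_true.andNot ((isGenerated_true.andNot ih).ex)).congr
      (tupleSet_congr fun v hv => ?_)
    simp only [exists_prop_of_true hv, BoundedFormula.realize_all, true_and, not_exists, not_and,
      not_forall, not_not, Subtype.forall]
    refine forall₂_congr fun x hx => ?_
    rw [exists_prop_of_true (forall_cons_mem.2 ⟨hx, hv⟩)]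
    -- The reversal of indices turns prepending to the tuple into appending to the assignment.
    apply iff_of_eq
    congr 1
    funext i
    refine Fin.lastCases ?_ (fun j => ?_) i
    · simp
    · simp only [Fin.snoc_castSucc, Subtype.mk.injEq]
      rw [Fin.rev_castSucc, Fin.castSucc_succ, Fin.cons_succ]

/-- First-order definability over `M` thus amounts to finitely many steps of a rudimentary
operation, so a recursion can produce the next level of `L` in ω stages. -/
theorem mem_defPowerset_iff {A : ZFSet.{u}} :
    A ∈ defPowerset M ↔ ∃ j, ∃ r ∈ defIter M j, A = unaryPart M r := by
  constructor
  · intro hA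
    obtain ⟨hsub, φ, hφ⟩ := mem_defPowerset.1 hA
    obtain ⟨j, hj⟩ := isGenerated_realize φ
    refine ⟨j, _, hj, ?_⟩
    have hiff : ∀ x (hx : x ∈ M), x ∈ A ↔ φ.Realize fun _ => (⟨x, hx⟩ : {x : ZFSet.{u} // x ∈ M}) := fun x hx => by
      have := Set.ext_iff.1 hφ fun _ => ⟨x, hx⟩
      exact this
    have realize_congr : ∀ {y : {x : ZFSet.{u} // x ∈ M}} (w : Fin 0 → {x : ZFSet.{u} // x ∈ M}),
        φ.Realize (fun _ => y) ↔ BoundedFormula.Realize φ (fun _ => y) w := fun w => by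
      rw [Formula.Realize, Subsingleton.elim w default]
    ext x
    rw [unaryPart, ZFSet.mem_sep]
    have hx : ZFSet.pair x ∅ = tuple (fun _ : Fin 1 => x) := rfl
    simp only [hx, tuple_mem_tupleSet]
    constructor
    · intro hxA
      refine ⟨hsub hxA, fun _ => hsub hxA, fun _ => hsub hxA, ?_⟩
      exact (realize_congr _).1 ((hiff x (hsub hxA)).1 hxA)
    · rintro ⟨hxM, -, h, hr⟩
      refine (hiff x hxM).2 ?_
      exact (realize_congr _).2 hr
  · rintro ⟨j, r, hr, rfl⟩
    exact unaryPart_mem_defPowerset hr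

end

/-! ### The constructible hierarchy inside the `J`-hierarchy -/

open Classical in
/-- The step of the recursion whose value at `ω · ξ + k` is `(L_ξ, D_k)`, where `D_k` consists of the
relations over `L_ξ` generated in `k` steps. -/
def levelStep (g : ZFSet.{u}) : ZFSet.{u} :=
  if ZFSet.sUnion (dom g) ∈ dom g then
    ZFSet.pair (fst (app g (ZFSet.sUnion (dom g))))
      (defStep (fst (app g (ZFSet.sUnion (dom g)))) (snd (app g (ZFSet.sUnion (dom g)))))
  else ZFSet.pair (bUnion (ran g) fun x => img (snd x) fun r => unaryPart (fst x) r) {{∅}}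

theorem Rud.levelStep {P : Set ZFSet.{u}} :
    Rud P fun v : Fin 1 → ZFSet.{u} => levelStep (v 0) := by
  have hd : Rud P fun v : Fin 1 → ZFSet.{u} => ClopenGames.dom (v 0) := (Rud.proj 0).dom
  have ha : Rud P fun v : Fin 1 → ZFSet.{u} =>
      ClopenGames.app (v 0) (ZFSet.sUnion (ClopenGames.dom (v 0))) := .app (.proj 0) hd.sUnion
  refine .ite (.mem hd.sUnion hd) (.pair ha.fst (.defStep ha.fst ha.snd))
    (.pair ?_ (Rud.singleton (Rud.singleton .empty)))
  refine .bUnion (g := fun x _ => ClopenGames.img (ClopenGames.snd x) fun r =>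
    unaryPart (ClopenGames.fst x) r) (Rud.proj 0).ran
      (.img (g := fun r w => unaryPart (ClopenGames.fst (w 0)) r) (Rud.proj 0).snd ?_)
  exact .sep (R := fun x w => ZFSet.pair x ∅ ∈ w 0) (.fst (.proj 1))
    (.mem (.pair (.proj 0) .empty) (.proj 1))

theorem sUnion_toZFSet_add_one (δ : Ordinal.{u}) :
    ZFSet.sUnion (δ + 1).toZFSet = δ.toZFSet := by
  ext x
  simp only [ZFSet.mem_sUnion, Ordinal.mem_toZFSet_iff, Order.lt_add_one_iff]
  constructor
  · rintro ⟨_, ⟨a, ha, rfl⟩, hx⟩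
    obtain ⟨b, hb, rfl⟩ := Ordinal.mem_toZFSet_iff.1 hx
    exact ⟨b, hb.trans_le ha, rfl⟩
  · rintro ⟨a, ha, rfl⟩
    exact ⟨_, ⟨δ, le_rfl, rfl⟩, Ordinal.toZFSet_mem_toZFSet_iff.2 ha⟩

theorem mem_godelL_iff {α : Ordinal.{u}} {x : ZFSet.{u}} :
    x ∈ godelL α ↔ ∃ β < α, x ∈ defPowerset (godelL β) := by
  simp only [← godelL_add_one]
  refine ⟨fun hx => ?_, fun ⟨β, hβ, hx⟩ => godelL_mono (Order.add_one_le_of_lt hβ) hx⟩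
  induction α using Ordinal.limitRecOn with
  | zero => simp at hx
  | add_one α _ => exact ⟨α, by simp, hx⟩
  | limit α hα _ =>
    obtain ⟨β, hβ, hx⟩ := (mem_godelL_limit hα).1 hx
    exact ⟨β, hβ, godelL_mono (by simp) hx⟩

/-- This selects the branch of `levelStep`: an ordinal `δ + 1` has its union as a member, while `ω ·
ξ`, zero included, does not. -/
theorem sUnion_toZFSet_omega0_mul_notMem (ξ : Ordinal.{u}) :
    ZFSet.sUnion (Ordinal.omega0 * ξ).toZFSet ∉ (Ordinal.omega0 * ξ).toZFSet := by
  intro h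
  obtain ⟨η, hη, h⟩ := Ordinal.mem_toZFSet_iff.1 h
  have hpos : 0 < ξ := by
    rcases eq_or_ne ξ 0 with rfl | h
    · simp at hη
    · exact pos_iff_ne_zero.2 h
  have : η.toZFSet ∈ ZFSet.sUnion (Ordinal.omega0 * ξ).toZFSet :=
    ZFSet.mem_sUnion.2 ⟨(η + 1).toZFSet, Ordinal.toZFSet_mem_toZFSet_iff.2
      ((isSuccLimit_omega0_mul hpos).add_one_lt hη), Ordinal.toZFSet_mem_toZFSet_iff.2 (by simp)⟩
  rw [← h] at this
  exact ZFSet.mem_irrefl _ this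

/-- Between `ω · ξ` and `ω · (ξ + 1)` the recursion accumulates the generated relations over `L_ξ`.
At a multiple of ω it reads off the unary parts from all earlier stages, which together make up the
new level, and restarts from the full nullary relation `{∅}`. -/
theorem recFun_levelStep (ξ : Ordinal.{u}) (k : ℕ) :
    recFun levelStep (Ordinal.omega0 * ξ + k) = ZFSet.pair (godelL ξ) (defIter (godelL ξ) k) := by
  induction ξ using WellFoundedLT.induction generalizing k with
  | ind ξ ih =>
    induction k with
    | zero =>
      rw [Nat.cast_zero, add_zero, recFun_eq, levelStep, dom_graph,
        if_neg (sUnion_toZFSet_omega0_mul_notMem ξ), defIter]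
      congr 1
      ext x
      simp only [mem_bUnion, mem_ran, mem_graph, ZFSet.pair_inj, mem_img, mem_godelL_iff (α := ξ),
        mem_defPowerset_iff]
      constructor
      · rintro ⟨_, ⟨_, ζ, hζ, -, rfl⟩, r, hr, rfl⟩
        obtain ⟨η, hη, k, rfl⟩ := exists_eq_omega0_mul_add hζ
        rw [ih η hη, snd_pair] at hr
        exact ⟨η, hη, k, r, hr, by rw [ih η hη, fst_pair]⟩
      · rintro ⟨η, hη, k, r, hr, rfl⟩
        refine ⟨_, ⟨_, Ordinal.omega0 * η + k, ?_, rfl, rfl⟩, r, ?_⟩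
        · calc Ordinal.omega0 * η + k < Ordinal.omega0 * η + Ordinal.omega0 := by
                gcongr
                exact Ordinal.natCast_lt_omega0 k
            _ = Ordinal.omega0 * (η + 1) := by rw [mul_add, mul_one]
            _ ≤ _ := by
                gcongr
                exact Order.add_one_le_of_lt hη
        · rw [ih η hη, fst_pair, snd_pair]
          exact ⟨hr, rfl⟩
    | succ k ihk =>
      rw [Nat.cast_succ, ← add_assoc, recFun_eq, levelStep, dom_graph, sUnion_toZFSet_add_one,
        if_pos (Ordinal.toZFSet_mem_toZFSet_iff.2 (by simp)), app_graph (by simp), ihk, fst_pair,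
        snd_pair, defIter]

theorem godelL_mem_jensenJ (ξ : Ordinal.{u}) : godelL ξ ∈ jensenJ (ξ + 1) := by
  have := rudHierarchy_jensenJ.value_mem (recFun_eq levelStep) (α := 0) .levelStep ξ 0
  rw [recFun_levelStep, zero_add] at this
  have h := (rudHierarchy_jensenJ.closed (ξ + 1) (by simp)) _ (.fst (.const this))
  rwa [fst_pair] at h

/-- Each hierarchy lags behind the other by at most a successor and a factor ω in the index, which
`ω · θ = θ` absorbs. -/
theorem jensenJ_eq_godelL {θ : Ordinal.{u}} (h₀ : 0 < θ) (hθ : Ordinal.omega0 * θ = θ) :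
    jensenJ θ = godelL θ := by
  have hlim : Order.IsSuccLimit θ := hθ ▸ isSuccLimit_omega0_mul h₀
  ext x
  constructor
  · intro hx
    obtain ⟨α, hα, hx⟩ := (mem_jensenJ_limit hlim).1 hx
    rw [← hθ]
    refine godelL_mono ?_ (isTransitive_godelL _ _ (jensenJ_mem_godelL α) hx)
    gcongr
    exact Order.add_one_le_of_lt hα
  · intro hx
    obtain ⟨α, hα, hx⟩ := (mem_godelL_limit hlim).1 hx
    exact jensenJ_mono (Order.add_one_le_of_lt hα) (isTransitive_jensenJ _ _ (godelL_mem_jensenJ α) hx)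

/-! ### Natural numbers and finite sequences as sets -/

/-- The natural number `n` as a set. -/
abbrev natSet (n : ℕ) : ZFSet.{u} := Ordinal.toZFSet (n : Ordinal.{u})

theorem natSet_inj {i j : ℕ} : natSet.{u} i = natSet j ↔ i = j := by
  rw [Ordinal.toZFSet_injective.eq_iff, Nat.cast_inj]

theorem natSet_mem_natSet {i j : ℕ} : natSet.{u} i ∈ natSet j ↔ i < j := by
  rw [Ordinal.toZFSet_mem_toZFSet_iff, Nat.cast_lt]

theorem mem_natSet {n : ℕ} {x : ZFSet.{u}} : x ∈ natSet n ↔ ∃ i < n, x = natSet i := by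
  rw [Ordinal.mem_toZFSet_iff]
  constructor
  · rintro ⟨a, ha, rfl⟩
    obtain ⟨i, rfl⟩ := Ordinal.lt_omega0.1 (ha.trans (Ordinal.natCast_lt_omega0 n))
    exact ⟨i, Nat.cast_lt.1 ha, rfl⟩
  · rintro ⟨i, hi, rfl⟩
    exact ⟨i, Nat.cast_lt.2 hi, rfl⟩

theorem mem_toZFSet_omega0 {x : ZFSet.{u}} : x ∈ Ordinal.omega0.toZFSet ↔ ∃ n, x = natSet n := by
  rw [Ordinal.mem_toZFSet_iff]
  constructor
  · rintro ⟨a, ha, rfl⟩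
    obtain ⟨i, rfl⟩ := Ordinal.lt_omega0.1 ha
    exact ⟨i, rfl⟩
  · rintro ⟨i, rfl⟩
    exact ⟨i, Ordinal.natCast_lt_omega0 i, rfl⟩

theorem insert_natSet (n : ℕ) : insert (natSet n) (natSet n) = natSet.{u} (n + 1) := by
  rw [natSet, natSet, Nat.cast_succ, Ordinal.toZFSet_add_one]

theorem natSet_zero : natSet.{u} 0 = ∅ := by
  rw [natSet, Nat.cast_zero, Ordinal.toZFSet_zero]

section
variable {l m : List ZFSet.{u}}

theorem mem_seq {p : ZFSet.{u}} :
    p ∈ seq l ↔ ∃ (i : ℕ) (h : i < l.length), p = ZFSet.pair (natSet i) l[i] := by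
  simp only [seq, ZFSet.mem_range, List.get_eq_getElem]
  exact ⟨fun ⟨i, h⟩ => ⟨i, i.2, h.symm⟩, fun ⟨i, h, hp⟩ => ⟨⟨i, h⟩, hp.symm⟩⟩

theorem pair_mem_seq {i : ℕ} {x : ZFSet.{u}} :
    ZFSet.pair (natSet i) x ∈ seq l ↔ ∃ h : i < l.length, x = l[i] := by
  rw [mem_seq]
  constructor
  · rintro ⟨j, h, hp⟩
    obtain ⟨hij, rfl⟩ := ZFSet.pair_inj.1 hp
    obtain rfl := natSet_inj.1 hij
    exact ⟨h, rfl⟩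
  · rintro ⟨h, rfl⟩
    exact ⟨i, h, rfl⟩

theorem dom_seq : dom (seq l) = natSet l.length := by
  ext x
  rw [mem_dom, mem_natSet]
  constructor
  · rintro ⟨y, hy⟩
    obtain ⟨i, hi, hp⟩ := mem_seq.1 hy
    exact ⟨i, hi, (ZFSet.pair_inj.1 hp).1⟩
  · rintro ⟨i, hi, rfl⟩
    exact ⟨_, pair_mem_seq.2 ⟨hi, rfl⟩⟩

theorem app_seq (i : ℕ) : app (seq l) (natSet i) = l.getD i ∅ := by
  by_cases h : i < l.length
  · rw [List.getD_eq_getElem _ _ h]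
    exact app_eq fun z => by rw [pair_mem_seq]; exact ⟨fun ⟨_, h⟩ => h, fun hz => ⟨h, hz⟩⟩
  · rw [List.getD_eq_default _ _ (not_lt.1 h), app, ZFSet.eq_empty]
    intro y hy
    obtain ⟨z, hz, -⟩ := ZFSet.mem_sUnion.1 hy
    exact h (pair_mem_seq.1 (ZFSet.mem_sep.1 hz).2).1

theorem seq_nil : seq ([] : List ZFSet.{u}) = ∅ := by
  rw [ZFSet.eq_empty]
  intro y hy
  obtain ⟨i, hi, -⟩ := mem_seq.1 hy
  simp at hi

theorem seq_append_singleton (l : List ZFSet.{u}) (x : ZFSet.{u}) :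
    seq (l ++ [x]) = insert (ZFSet.pair (dom (seq l)) x) (seq l) := by
  ext p
  rw [ZFSet.mem_insert_iff, mem_seq, mem_seq, dom_seq]
  constructor
  · rintro ⟨i, hi, rfl⟩
    by_cases h : i < l.length
    · exact .inr ⟨i, h, by rw [List.getElem_append_left h]⟩
    · have : i = l.length := by simp at hi; omega
      subst this
      simp
  · rintro (rfl | ⟨i, hi, rfl⟩)
    · exact ⟨l.length, by simp, by simp⟩
    · exact ⟨i, by simp; omega, by rw [List.getElem_append_left hi]⟩

theorem seq_subset_seq : seq l ⊆ seq m ↔ l <+: m := by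
  constructor
  · intro h
    rw [List.prefix_iff_getElem]
    have key : ∀ i (hi : i < l.length), ∃ h' : i < m.length, l[i] = m[i] := fun i hi =>
      pair_mem_seq.1 (h (pair_mem_seq.2 ⟨hi, rfl⟩))
    refine ⟨?_, fun i hi => (key i hi).2⟩
    by_contra hlt
    exact absurd (key m.length (not_le.1 hlt)).1 (lt_irrefl _)
  · rintro ⟨k, rfl⟩ p hp
    obtain ⟨i, hi, rfl⟩ := mem_seq.1 hp
    exact mem_seq.2 ⟨i, by simp; omega, by rw [List.getElem_append_left hi]⟩

theorem seq_injective : Function.Injective (seq : List ZFSet.{u} → ZFSet.{u}) := fun l m h => by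
  have h₁ : l <+: m := seq_subset_seq.1 h.subset
  have h₂ : m <+: l := seq_subset_seq.1 h.symm.subset
  exact h₁.eq_of_length_le h₂.length_le

theorem seq_ssubset_seq_append (l : List ZFSet.{u}) (h : m ≠ []) : seq l ⊂ seq (l ++ m) := by
  refine lt_of_le_of_ne (seq_subset_seq.2 ⟨m, rfl⟩) fun he => h ?_
  simpa using seq_injective he

/-- `s` is a finite sequence of elements of `X`. -/
def IsSeq (X s : ZFSet.{u}) : Prop :=
  dom s ∈ Ordinal.omega0.toZFSet ∧
    (∀ p ∈ s, p = ZFSet.pair (fst p) (app s (fst p))) ∧ ∀ i ∈ dom s, app s i ∈ X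

theorem isSeq_iff {X s : ZFSet.{u}} :
    IsSeq X s ↔ ∃ l : List ZFSet.{u}, (∀ x ∈ l, x ∈ X) ∧ seq l = s := by
  constructor
  · rintro ⟨hd, hs, hX⟩
    obtain ⟨n, hn⟩ := mem_toZFSet_omega0.1 hd
    refine ⟨List.ofFn fun i : Fin n => app s (natSet i), ?_, ?_⟩
    · intro x hx
      obtain ⟨i, rfl⟩ := (List.mem_ofFn' _ _).1 hx
      refine hX _ ?_
      rw [hn, natSet_mem_natSet]
      exact i.2
    · ext p
      rw [mem_seq]
      constructor
      · rintro ⟨i, hi, rfl⟩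
        have hi' : i < n := by simpa using hi
        have : natSet i ∈ dom s := by rwa [hn, natSet_mem_natSet]
        obtain ⟨y, hy⟩ := mem_dom.1 this
        have := hs _ hy
        rw [fst_pair] at this
        rw [this] at hy
        simpa using hy
      · intro hp
        have hp' := hs p hp
        have : fst p ∈ dom s := mem_dom.2 ⟨_, hp' ▸ hp⟩
        rw [hn, mem_natSet] at this
        obtain ⟨i, hi, hip⟩ := this
        refine ⟨i, by simpa using hi, ?_⟩
        rw [hip] at hp'
        simpa using hp'
  · rintro ⟨l, hl, rfl⟩
    refine ⟨?_, ?_, ?_⟩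
    · rw [dom_seq]
      exact mem_toZFSet_omega0.2 ⟨_, rfl⟩
    · intro p hp
      obtain ⟨i, hi, rfl⟩ := mem_seq.1 hp
      rw [fst_pair, app_seq, List.getD_eq_getElem _ _ hi]
    · intro i hi
      rw [dom_seq, mem_natSet] at hi
      obtain ⟨i, hi, rfl⟩ := hi
      rw [app_seq, List.getD_eq_getElem _ _ hi]
      exact hl _ (List.getElem_mem hi)

end

theorem RudRel.isSeq {P : Set ZFSet.{u}} {n : ℕ} {X f : (Fin n → ZFSet.{u}) → ZFSet.{u}}
    (hω : Ordinal.omega0.toZFSet ∈ P) (hX : Rud P X) (hf : Rud P f) :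
    RudRel P fun v => IsSeq (X v) (f v) :=
  .and (.mem hf.dom (.const hω)) <|
    .and (.ball (R := fun p v => p = ZFSet.pair (fst p) (app (f v) (fst p))) hf
      (.eq (.proj 0) (.pair (.fst (.proj 0)) (.app hf.tail (.fst (.proj 0))))))
    (.ball (R := fun i v => app (f v) i ∈ X v) hf.dom (.mem (.app hf.tail (.proj 0)) hX.tail))

/-! ### Even numbers -/

/-- `n` is even, as witnessed by a set `e ∈ A` of even numbers. -/
def IsEvenIn (A n : ZFSet.{u}) : Prop :=
  ∃ e ∈ A, n ∈ e ∧ ∅ ∈ e ∧ ∀ k ∈ n, (insert k k ∈ e ↔ k ∉ e)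

/-- A witness `e` need only alternate up to `n`, so finite sets suffice, and rudimentarily closed
sets contain them. Parity thereby becomes a relation rudimentary in the parameter `A`. -/
theorem isEvenIn_natSet {A : ZFSet.{u}} (hA : RudClosed A) {n : ℕ} :
    IsEvenIn A (natSet n) ↔ Even n := by
  constructor
  · rintro ⟨e, -, hn, h₀, h⟩
    have key : ∀ k ≤ n, (natSet k ∈ e ↔ Even k) := by
      intro k
      induction k with
      | zero => simp [h₀, natSet_zero]
      | succ k ih =>
        intro hk
        rw [← insert_natSet, h _ (natSet_mem_natSet.2 hk), ih (by omega), Nat.even_add_one]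
    exact (key n le_rfl).1 hn
  · intro hn
    have hnat : ∀ k : ℕ, natSet k ∈ A := fun k => by
      induction k with
      | zero =>
        rw [natSet_zero]
        exact hA _ .empty
      | succ k ih =>
        rw [← insert_natSet]
        exact hA _ (.insert (.const ih) (.const ih))
    have : ∀ k : ℕ, ∃ e ∈ A, ∀ x, x ∈ e ↔ ∃ i ≤ k, Even i ∧ x = natSet i := by
      intro k
      induction k with
      | zero =>
        refine ⟨{∅}, hA _ (.singleton .empty), fun x => ?_⟩
        simp [natSet_zero]
      | succ k ih =>
        obtain ⟨e, he, h⟩ := ih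
        by_cases hk : Even (k + 1)
        · refine ⟨insert (natSet (k + 1)) e, hA _ (.insert (.const (hnat _)) (.const he)), fun x => ?_⟩
          rw [ZFSet.mem_insert_iff, h]
          constructor
          · rintro (rfl | ⟨i, hi, he, rfl⟩)
            · exact ⟨_, le_rfl, hk, rfl⟩
            · exact ⟨i, by omega, he, rfl⟩
          · rintro ⟨i, hi, he, rfl⟩
            rcases hi.eq_or_lt with rfl | hi
            · exact .inl rfl
            · exact .inr ⟨i, by omega, he, rfl⟩
        · refine ⟨e, he, fun x => (h x).trans ?_⟩
          constructor
          · rintro ⟨i, hi, he, rfl⟩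
            exact ⟨i, by omega, he, rfl⟩
          · rintro ⟨i, hi, he, rfl⟩
            rcases hi.eq_or_lt with rfl | hi
            · exact absurd he hk
            · exact ⟨i, by omega, he, rfl⟩
    obtain ⟨e, he, h⟩ := this n
    have h' : ∀ i, natSet i ∈ e ↔ i ≤ n ∧ Even i := fun i => by
      rw [h]
      exact ⟨fun ⟨j, hj, he, hij⟩ => natSet_inj.1 hij ▸ ⟨hj, he⟩, fun ⟨hi, he⟩ => ⟨i, hi, he, rfl⟩⟩
    refine ⟨e, he, (h' n).2 ⟨le_rfl, hn⟩, natSet_zero ▸ (h' 0).2 ⟨by omega, by simp⟩, fun k hk => ?_⟩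
    obtain ⟨k, hkn, rfl⟩ := mem_natSet.1 hk
    rw [insert_natSet, h', h', Nat.even_add_one]
    exact ⟨fun h₁ h₂ => h₁.2 h₂.2, fun h₁ => ⟨hkn, fun h₂ => h₁ ⟨hkn.le, h₂⟩⟩⟩

theorem RudRel.isEvenIn {P : Set ZFSet.{u}} {n : ℕ} {A f : (Fin n → ZFSet.{u}) → ZFSet.{u}}
    (hA : Rud P A) (hf : Rud P f) : RudRel P fun v => IsEvenIn (A v) (f v) :=
  .bex (R := fun e v => f v ∈ e ∧ ∅ ∈ e ∧ ∀ k ∈ f v, (insert k k ∈ e ↔ k ∉ e)) hA <|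
    .and (.mem hf.tail (.proj 0)) <| .and (.mem .empty (.proj 0)) <|
      .ball (R := fun k w => insert k k ∈ w 0 ↔ k ∉ w 0) hf.tail
        (.iff (.mem (.insert (.proj 0) (.proj 0)) (.proj 1)) (.not (.mem (.proj 0) (.proj 1))))

/-! ### Bijections in a rudimentarily closed set -/

/-- `f` is a bijection from `a` to `b`. -/
def IsBijection (a b f : ZFSet.{u}) : Prop :=
  ZFSet.IsFunc a b f ∧ ∀ y ∈ b, ∃! x, ZFSet.pair x y ∈ f

theorem exists_isBijection_self {M a : ZFSet.{u}} (hM : RudClosed M) (ha : a ∈ M) :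
    ∃ f ∈ M, IsBijection a a f := by
  refine ⟨img a fun x => ZFSet.pair x x,
    hM _ (.img (g := fun x _ => ZFSet.pair x x) (.const ha) (.pair (.proj 0) (.proj 0))), ⟨?_, ?_⟩, ?_⟩
  · intro p hp
    obtain ⟨x, hx, rfl⟩ := mem_img.1 hp
    exact ZFSet.pair_mem_prod.2 ⟨hx, hx⟩
  · intro x hx
    refine ⟨x, mem_img.2 ⟨x, hx, rfl⟩, fun y hy => ?_⟩
    obtain ⟨z, -, hz⟩ := mem_img.1 hy
    obtain ⟨rfl, rfl⟩ := ZFSet.pair_inj.1 hz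
    rfl
  · intro x hx
    refine ⟨x, mem_img.2 ⟨x, hx, rfl⟩, fun y hy => ?_⟩
    obtain ⟨z, -, hz⟩ := mem_img.1 hy
    obtain ⟨rfl, rfl⟩ := ZFSet.pair_inj.1 hz
    rfl

theorem IsBijection.exists_comp {M a b c f g : ZFSet.{u}} (hM : RudClosed M) (ha : a ∈ M) (hb : b ∈ M)
    (hc : c ∈ M) (hfM : f ∈ M) (hgM : g ∈ M) (hf : IsBijection a b f) (hg : IsBijection b c g) :
    ∃ h ∈ M, IsBijection a c h := by
  refine ⟨ZFSet.sep (fun p => ∃ y ∈ b, ZFSet.pair (fst p) y ∈ f ∧ ZFSet.pair y (snd p) ∈ g)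
    (ZFSet.prod a c), hM _ ?_, ⟨?_, ?_⟩, ?_⟩
  · exact .sep (R := fun p _ => ∃ y ∈ b, ZFSet.pair (fst p) y ∈ f ∧ ZFSet.pair y (snd p) ∈ g)
      (.prod (.const ha) (.const hc))
      (.bex (R := fun y w => ZFSet.pair (fst (w 0)) y ∈ f ∧ ZFSet.pair y (snd (w 0)) ∈ g) (.const hb)
        (.and (.mem (.pair (.fst (.proj 1)) (.proj 0)) (.const hfM))
          (.mem (.pair (.proj 0) (.snd (.proj 1))) (.const hgM))))
  · exact fun p hp => (ZFSet.mem_sep.1 hp).1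
  · intro x hx
    obtain ⟨y, hy, hy'⟩ := hf.1.2 x hx
    have hyb := (ZFSet.pair_mem_prod.1 (hf.1.1 hy)).2
    obtain ⟨z, hz, hz'⟩ := hg.1.2 y hyb
    have hzc := (ZFSet.pair_mem_prod.1 (hg.1.1 hz)).2
    refine ⟨z, ?_, fun w hw => ?_⟩
    · exact ZFSet.mem_sep.2 ⟨ZFSet.pair_mem_prod.2 ⟨hx, hzc⟩, y, hyb, by simpa using hy,
        by simpa using hz⟩
    · obtain ⟨-, t, ht, h₁, h₂⟩ := ZFSet.mem_sep.1 hw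
      rw [fst_pair] at h₁
      rw [snd_pair] at h₂
      obtain rfl := hy' t h₁
      exact hz' w h₂
  · intro z hz
    obtain ⟨y, hy, hy'⟩ := hg.2 z hz
    have hyb := (ZFSet.pair_mem_prod.1 (hg.1.1 hy)).1
    obtain ⟨x, hx, hx'⟩ := hf.2 y hyb
    have hxa := (ZFSet.pair_mem_prod.1 (hf.1.1 hx)).1
    refine ⟨x, ?_, fun w hw => ?_⟩
    · exact ZFSet.mem_sep.2 ⟨ZFSet.pair_mem_prod.2 ⟨hxa, hz⟩, y, hyb, by simpa using hx,
        by simpa using hy⟩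
    · obtain ⟨-, t, ht, h₁, h₂⟩ := ZFSet.mem_sep.1 hw
      rw [fst_pair] at h₁
      rw [snd_pair] at h₂
      obtain rfl := hy' t h₂
      exact hx' w h₁

/-- In a model with a largest cardinal `κ`, every ordinal is the image of some ordinal `b ≤ κ`. -/
theorem IsLargestCardinalIn.exists_app_eq {M : ZFSet.{u}} {κ α : Ordinal.{u}}
    (h : IsLargestCardinalIn M κ) (hM : RudClosed M) (hMt : M.IsTransitive) (hα : α.toZFSet ∈ M) :
    ∃ b ≤ κ, b.toZFSet ∈ M ∧ ∃ f ∈ M, (∀ x ∈ b.toZFSet, app f x ∈ α.toZFSet) ∧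
      ∀ ξ < α, ∃ x ∈ b.toZFSet, app f x = ξ.toZFSet := by
  let B : Set Ordinal.{u} := {b | ∃ f ∈ M, IsBijection b.toZFSet α.toZFSet f}
  have hαB : α ∈ B := exists_isBijection_self hM hα
  have hBmin : sInf B ∈ B := csInf_mem ⟨α, hαB⟩
  have hBα : sInf B ≤ α := csInf_le' hαB
  have hsub : ∀ c ≤ α, c.toZFSet ∈ M := fun c hc => by
    rcases hc.eq_or_lt with rfl | hc
    · exact hα
    · exact hMt _ hα (Ordinal.toZFSet_mem_toZFSet_iff.2 hc)
  obtain ⟨f, hfM, hf⟩ := id hBmin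
  -- The least ordinal in bijection with `α` inside `M` is a cardinal of `M`, since a bijection from
  -- a smaller ordinal could be composed with `f`. Hence it is at most `κ`.
  refine ⟨sInf B, h.2 ⟨hsub _ hBα, fun c hc => ?_⟩, hsub _ hBα, f, hfM, ?_, ?_⟩
  · rintro ⟨g, hgM, hg⟩
    exact notMem_of_lt_csInf' hc (IsBijection.exists_comp hM (hsub _ (hc.le.trans hBα)) (hsub _ hBα) hα
      hgM hfM hg hf)
  · intro x hx
    obtain ⟨y, hy, hy'⟩ := hf.1.2 x hx
    rw [app_eq fun z => ⟨hy' z, fun hz => hz ▸ hy⟩]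
    exact (ZFSet.pair_mem_prod.1 (hf.1.1 hy)).2
  · intro ξ hξ
    obtain ⟨x, hx, -⟩ := hf.2 _ (Ordinal.toZFSet_mem_toZFSet_iff.2 hξ)
    have hxb := (ZFSet.pair_mem_prod.1 (hf.1.1 hx)).1
    refine ⟨x, hxb, app_eq fun z => ⟨fun hz => (hf.1.2 x hxb).unique hz hx, fun hz => hz ▸ hx⟩⟩

/-! ### Ordinals of the model as ranks of trees -/

theorem IsRankedIn.exists_rank {M T : ZFSet.{u}} (hT : IsRankedIn M T) (hM : RudClosed M)
    (hMt : M.IsTransitive) : ∃ ρ : ZFSet.{u} → Ordinal.{u},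
      (∀ s ∈ T, ∀ t ∈ T, s ⊂ t → ρ t < ρ s) ∧ ∀ s ∈ T, (ρ s).toZFSet ∈ M := by
  obtain ⟨r, hr, ρ, hρ, rfl⟩ := hT
  refine ⟨ρ, fun s hs t ht => (hρ s hs).1 t ht, fun s hs => ?_⟩
  have hp : ZFSet.pair s (ρ s).toZFSet ∈ (ZFSet.range fun s : {s : ZFSet.{u} // s ∈ T} =>
      ZFSet.pair s.1 (ρ s.1).toZFSet) := ZFSet.mem_range.2 ⟨⟨s, hs⟩, rfl⟩
  have := hM _ (.snd (.const (hMt _ hr hp)))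
  rwa [snd_pair] at this

namespace RanksTrees

variable {ψ : setLang.Formula (Fin 1)} {θ κ : Ordinal.{u}}

theorem lt_omega0_mul (h : RanksTrees ψ (jensenJ θ) κ) : κ < Ordinal.omega0 * θ :=
  toZFSet_mem_jensenJ_iff.1 h.largest.1.1

theorem one_lt (h : RanksTrees ψ (jensenJ θ) κ) : 1 < θ := by
  by_contra hle
  refine (h.uncountable.trans h.lt_omega0_mul).not_ge ?_
  calc Ordinal.omega0 * θ ≤ Ordinal.omega0 * 1 := by
        gcongr
        exact not_lt.1 hle
    _ = _ := mul_one _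

theorem rudClosed (h : RanksTrees ψ (jensenJ θ) κ) : RudClosed (jensenJ θ) :=
  rudHierarchy_jensenJ.closed _ (zero_lt_one.trans h.one_lt)

/-- Otherwise `κ` is some `ν + 1`, and the function `{(0, ν)}` from `1` to `κ` is unbounded, against
regularity. The form `ω · η` makes `κ` the set of ordinals of `J_η`. -/
theorem exists_eq_omega0_mul (h : RanksTrees ψ (jensenJ θ) κ) :
    ∃ η < θ, 0 < η ∧ κ = Ordinal.omega0 * η := by
  obtain ⟨η, hη, k, hk⟩ := exists_eq_omega0_mul_add h.lt_omega0_mul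
  rcases k with _ | k
  · refine ⟨η, hη, pos_iff_ne_zero.2 ?_, by simpa using hk⟩
    rintro rfl
    have := h.uncountable
    simp [hk] at this
  · exfalso
    set ν := Ordinal.omega0 * η + k with hν
    have hκ : κ = ν + 1 := by rw [hk, Nat.cast_succ, hν, add_assoc]
    have hνκ : ν < κ := by simp [hκ]
    have hνM : ν.toZFSet ∈ jensenJ θ := isTransitive_jensenJ _ _ h.largest.1.1
      (Ordinal.toZFSet_mem_toZFSet_iff.2 hνκ)
    have hmem1 : ∀ x : ZFSet.{u}, x ∈ (1 : Ordinal.{u}).toZFSet ↔ x = ∅ := fun x => by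
      rw [← zero_add 1, Ordinal.toZFSet_add_one]
      simp
    have hfun : ZFSet.IsFunc (1 : Ordinal.{u}).toZFSet κ.toZFSet {ZFSet.pair ∅ ν.toZFSet} := by
      refine ⟨fun p hp => ?_, fun x hx => ?_⟩
      · rw [ZFSet.mem_singleton.1 hp, ZFSet.pair_mem_prod, hmem1, Ordinal.toZFSet_mem_toZFSet_iff]
        exact ⟨rfl, hνκ⟩
      · rw [hmem1] at hx
        subst hx
        exact ⟨ν.toZFSet, by simp, fun y hy => by simpa using hy⟩
    obtain ⟨c, hc, hb⟩ := h.regular 1 (Ordinal.one_lt_omega0.trans h.uncountable) _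
      (h.rudClosed _ (.singleton (.pair .empty (.const hνM)))) hfun
    have := hb ∅ ν.toZFSet (by simp)
    rw [Ordinal.toZFSet_mem_toZFSet_iff] at this
    rw [hκ, Order.lt_add_one_iff] at hc
    exact this.not_ge hc

theorem omega0_mem (h : RanksTrees ψ (jensenJ θ) κ) : Ordinal.omega0.toZFSet ∈ jensenJ θ :=
  toZFSet_mem_jensenJ_iff.2 (h.uncountable.trans h.lt_omega0_mul)

/-- The set of finite sequences from `κ` belongs to the model. -/
theorem exists_finSeq (h : RanksTrees ψ (jensenJ θ) κ) :
    ∃ q ∈ jensenJ θ, ∀ s, s ∈ q ↔ IsSeq κ.toZFSet s := by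
  obtain ⟨η, hη, hη₀, hκ⟩ := h.exists_eq_omega0_mul
  -- `J_η` is rudimentarily closed and contains every ordinal below `κ = ω · η`, so it contains all
  -- finite sequences from `κ`, and they can be separated from it.
  refine ⟨ZFSet.sep (fun s => IsSeq κ.toZFSet s) (jensenJ η), h.rudClosed _ ?_, fun s => ?_⟩
  · exact .sep (R := fun s _ => IsSeq κ.toZFSet s)
      (.const (jensenJ_mono (Order.add_one_le_of_lt hη) (rudHierarchy_jensenJ.mem_add_one η)))
      (.isSeq h.omega0_mem (.const h.largest.1.1) (.proj 0))
  · rw [ZFSet.mem_sep, and_iff_right_of_imp]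
    intro hs
    obtain ⟨l, hl, rfl⟩ := isSeq_iff.1 hs
    have hc : RudClosed (jensenJ η) := rudHierarchy_jensenJ.closed _ hη₀
    have hκη : ∀ x ∈ κ.toZFSet, x ∈ jensenJ η := fun x hx => by
      obtain ⟨ξ, hξ, rfl⟩ := Ordinal.mem_toZFSet_iff.1 hx
      exact toZFSet_mem_jensenJ_iff.2 (hκ ▸ hξ)
    clear hs
    induction l using List.reverseRecOn with
    | nil =>
      rw [seq_nil]
      exact hc _ .empty
    | append_singleton l x ih =>
      rw [seq_append_singleton]
      have hl' : seq l ∈ jensenJ η := ih fun y hy => hl y (List.mem_append_left _ hy)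
      exact hc _ (.insert (.pair (.dom (.const hl')) (.const (hκη _ (hl x (by simp))))) (.const hl'))

end RanksTrees

/-- The pair of the entries of the list `l` at `i` and `i + 1`. -/
def block (l : List ZFSet.{u}) (i : ℕ) : ZFSet.{u} := ZFSet.pair (l.getD i ∅) (l.getD (i + 1) ∅)

/-- The consecutive pairs of entries of `l` lie in `d` and form an `R`-chain. -/
def IsChain (d : ZFSet.{u}) (R : ZFSet.{u} → ZFSet.{u} → Prop) (l : List ZFSet.{u}) : Prop :=
  ∀ i < l.length, Even i → (i + 1 < l.length → block l i ∈ d) ∧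
    (i + 3 < l.length → R (block l i) (block l (i + 2)))

theorem block_append {l m : List ZFSet.{u}} {i : ℕ} (h : i + 1 < l.length) :
    block (l ++ m) i = block l i := by
  rw [block, block, List.getD_append _ _ _ _ (by omega), List.getD_append _ _ _ _ h]

theorem block_append_pair {l : List ZFSet.{u}} {x y : ZFSet.{u}} :
    block (l ++ [x, y]) l.length = ZFSet.pair x y := by
  rw [block, List.getD_append_right _ _ _ _ le_rfl, List.getD_append_right _ _ _ _ (by omega)]
  simp

section
variable {d : ZFSet.{u}} {R : ZFSet.{u} → ZFSet.{u} → Prop} {l m : List ZFSet.{u}}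

theorem IsChain.of_append (h : IsChain d R (l ++ m)) : IsChain d R l := by
  intro i hi he
  obtain ⟨h₁, h₂⟩ := h i (by simp; omega) he
  refine ⟨fun h => ?_, fun h => ?_⟩
  · rw [← block_append (m := m) h]
    exact h₁ (by simp; omega)
  · rw [← block_append (m := m) (show i + 1 < l.length by omega),
      ← block_append (m := m) (show i + 2 + 1 < l.length by omega)]
    exact h₂ (by simp; omega)

theorem isChain_nil : IsChain d R ([] : List ZFSet.{u}) := fun i hi => by simp at hi

theorem IsChain.append_pair {x y : ZFSet.{u}} (h : IsChain d R l) (he : Even l.length)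
    (hd : ZFSet.pair x y ∈ d)
    (hR : ∀ i, i + 2 = l.length → R (block l i) (ZFSet.pair x y)) : IsChain d R (l ++ [x, y]) := by
  intro i hi hie
  simp only [List.length_append, List.length_cons, List.length_nil, zero_add] at hi ⊢
  have : i ≠ l.length + 1 := fun h => by
    rw [h, Nat.even_add_one] at hie
    exact hie he
  refine ⟨fun h' => ?_, fun h' => ?_⟩
  · rcases (show i ≤ l.length by omega).eq_or_lt with rfl | hlt
    · rwa [block_append_pair]
    · have : i + 1 ≠ l.length := fun h => by
        rw [← h, Nat.even_add_one] at he
        exact he hie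
      rw [block_append (by omega)]
      exact (h i hlt hie).1 (by omega)
  · have : i + 3 ≠ l.length := fun h => by
      rw [← h, show i + 3 = i + 2 + 1 from rfl, Nat.even_add_one] at he
      exact he (hie.add (by simp))
    rw [block_append (by omega)]
    by_cases h₂ : i + 2 = l.length
    · rw [h₂, block_append_pair]
      exact hR i h₂
    · rw [block_append (by omega)]
      exact (h i (by omega) hie).2 (by omega)

end

/-! ### Trees of descending chains and the closure of θ under arithmetic -/

namespace RanksTrees

variable {ψ : setLang.Formula (Fin 1)} {θ κ : Ordinal.{u}}

/-- Entries must be elements of `κ`, so a pair occupies two consecutive entries, the first at an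
even index. The chain condition quantifies only over indices, with parity witnessed in `J_1`, so the
tree is separated from the set of finite sequences. -/
theorem exists_chainTree (h : RanksTrees ψ (jensenJ θ) κ) {d : ZFSet.{u}} (hd : d ∈ jensenJ θ)
    {R : ZFSet.{u} → ZFSet.{u} → Prop}
    (hR : RudRel {x | x ∈ jensenJ θ} fun v : Fin 2 → ZFSet.{u} => R (v 0) (v 1)) :
    ∃ T ∈ jensenJ θ, ∀ l : List ZFSet.{u},
      (seq l ∈ T ↔ (∀ x ∈ l, x ∈ κ.toZFSet) ∧ IsChain d R l) ∧
      ∀ s ∈ T, ∃ l : List ZFSet.{u}, (∀ x ∈ l, x ∈ κ.toZFSet) ∧ seq l = s := by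
  obtain ⟨q, hq, hqs⟩ := h.exists_finSeq
  have hJ₁ : jensenJ 1 ∈ jensenJ θ := jensenJ_mono (Order.add_one_le_of_lt h.one_lt)
    (rudHierarchy_jensenJ.mem_add_one 1)
  have hc₁ : RudClosed (jensenJ (1 : Ordinal.{u})) := rudHierarchy_jensenJ.closed _ zero_lt_one
  let S : ZFSet.{u} → ZFSet.{u} := fun x => insert x x
  let B : ZFSet.{u} → ZFSet.{u} → ZFSet.{u} := fun s i => ZFSet.pair (app s i) (app s (S i))
  let Q : ZFSet.{u} → ZFSet.{u} → Prop := fun s i => IsEvenIn (jensenJ 1) i →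
    (S i ∈ dom s → B s i ∈ d) ∧ (S (S (S i)) ∈ dom s → R (B s i) (B s (S (S i))))
  have hS : ∀ {n : ℕ} {f : (Fin n → ZFSet.{u}) → ZFSet.{u}}, Rud {x | x ∈ jensenJ θ} f →
      Rud {x | x ∈ jensenJ θ} fun v => S (f v) := fun hf => .insert hf hf
  have hB : ∀ {n : ℕ} {f g : (Fin n → ZFSet.{u}) → ZFSet.{u}}, Rud {x | x ∈ jensenJ θ} f →
      Rud {x | x ∈ jensenJ θ} g → Rud {x | x ∈ jensenJ θ} fun v => B (f v) (g v) :=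
    fun hf hg => .pair (.app hf hg) (.app hf (hS hg))
  have hS' : ∀ i : ℕ, S (natSet i) = natSet (i + 1) := insert_natSet
  refine ⟨ZFSet.sep (fun s => ∀ i ∈ dom s, Q s i) q, h.rudClosed _ ?_, fun l => ⟨?_, fun s hs => ?_⟩⟩
  · refine .sep (R := fun s _ => ∀ i ∈ dom s, Q s i) (.const hq) (.ball (R := fun i w => Q (w 0) i)
      (.dom (.proj 0)) (.imp (.isEvenIn (.const hJ₁) (.proj 0)) (.and ?_ ?_)))
    · exact .imp (.mem (hS (.proj 0)) (.dom (.proj 1))) (.mem (hB (.proj 1) (.proj 0)) (.const hd))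
    · exact .imp (.mem (hS (hS (hS (.proj 0)))) (.dom (.proj 1)))
        (hR.comp₂ (hB (.proj 1) (.proj 0)) (hB (.proj 1) (hS (hS (.proj 0)))))
  · have hseq : IsSeq κ.toZFSet (seq l) ↔ ∀ x ∈ l, x ∈ κ.toZFSet := by
      rw [isSeq_iff]
      exact ⟨fun ⟨m, hm, hml⟩ => seq_injective hml ▸ hm, fun hl => ⟨l, hl, rfl⟩⟩
    rw [ZFSet.mem_sep, hqs, hseq]
    refine and_congr_right fun _ => ?_
    simp only [dom_seq, Q, B]
    constructor
    · intro hQ i hi he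
      have := hQ _ (natSet_mem_natSet.2 hi) ((isEvenIn_natSet hc₁).2 he)
      simpa only [hS', natSet_mem_natSet, app_seq, add_assoc, Nat.reduceAdd, block] using this
    · intro hl i hi he
      obtain ⟨i, hil, rfl⟩ := mem_natSet.1 hi
      have := hl i hil ((isEvenIn_natSet hc₁).1 he)
      simpa only [hS', natSet_mem_natSet, app_seq, add_assoc, Nat.reduceAdd, block] using this
  · exact isSeq_iff.1 ((hqs s).1 (ZFSet.mem_sep.1 hs).1)

/-- The ordinals below the ranks of definable prewellorderings of sets of pairs from `κ` belong to the
model. -/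
theorem toZFSet_mem_of_prewellordering (h : RanksTrees ψ (jensenJ θ) κ) {d : ZFSet.{u}}
    (hd : d ∈ jensenJ θ) (hdκ : d ⊆ ZFSet.prod κ.toZFSet κ.toZFSet)
    {R : ZFSet.{u} → ZFSet.{u} → Prop}
    (hR : RudRel {x | x ∈ jensenJ θ} fun v : Fin 2 → ZFSet.{u} => R (v 0) (v 1))
    {v : ZFSet.{u} → Ordinal.{u}} (hv : ∀ p ∈ d, ∀ q ∈ d, R p q ↔ v q < v p) {β : Ordinal.{u}}
    (hβ : ∀ ζ < β, ∃ p ∈ d, v p = ζ) : β.toZFSet ∈ jensenJ θ := by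
  obtain ⟨T, hT, hTl⟩ := h.exists_chainTree hd hR
  have htree : IsTreeOn κ.toZFSet T := by
    refine ⟨(hTl []).2, fun l m hlm => (hTl l).1.2 ?_⟩
    obtain ⟨h₁, h₂⟩ := (hTl _).1.1 hlm
    exact ⟨fun x hx => h₁ x (List.mem_append_left _ hx), h₂.of_append⟩
  -- Any infinite branch, whether or not it belongs to the model, would give an infinite descending
  -- sequence of values of `v`.
  have hwf : IsWellfoundedIn (jensenJ θ) κ.toZFSet T := by
    rintro ⟨x, -, -, hx⟩
    have hchain : ∀ n, IsChain d R (List.ofFn fun i : Fin n => x i) := fun n => ((hTl _).1.1 (hx n)).2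
    have hblock : ∀ n i : ℕ, i + 1 < n →
        block (List.ofFn fun i : Fin n => x i) i = ZFSet.pair (x i) (x (i + 1)) := by
      intro n i hi
      rw [block, List.getD_eq_getElem _ _ (by simp; omega), List.getD_eq_getElem _ _ (by simp; omega)]
      simp
    have hpd : ∀ j, ZFSet.pair (x (2 * j)) (x (2 * j + 1)) ∈ d := fun j => by
      rw [← hblock (2 * j + 2) (2 * j) (by omega)]
      exact (hchain _ (2 * j) (by simp) (by simp)).1 (by simp)
    have hlt : ∀ j, v (ZFSet.pair (x (2 * (j + 1))) (x (2 * (j + 1) + 1))) <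
        v (ZFSet.pair (x (2 * j)) (x (2 * j + 1))) := fun j => by
      rw [← hv _ (hpd j) _ (hpd (j + 1)), ← hblock (2 * j + 4) (2 * j) (by omega),
        ← hblock (2 * j + 4) (2 * (j + 1)) (by omega)]
      exact (hchain _ (2 * j) (by simp; omega) (by simp)).2 (by simp)
    obtain ⟨_, ⟨j, rfl⟩, hmin⟩ := wellFounded_lt.has_min
      (Set.range fun j => v (ZFSet.pair (x (2 * j)) (x (2 * j + 1)))) ⟨_, 0, rfl⟩
    exact hmin _ ⟨j + 1, rfl⟩ (hlt j)
  obtain ⟨ρ, hρ, hρM⟩ := (h.ranked T hT htree hwf).exists_rank h.rudClosed (isTransitive_jensenJ θ)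
  have hlt : ∀ l m : List ZFSet.{u}, m ≠ [] → seq (l ++ m) ∈ T → ρ (seq (l ++ m)) < ρ (seq l) :=
    fun l m hm hlm => hρ _ (htree.2 l m hlm) _ hlm (seq_ssubset_seq_append l hm)
  have step : ∀ l : List ZFSet.{u}, seq l ∈ T → Even l.length → ∀ p ∈ d,
      (∀ i, i + 2 = l.length → R (block l i) p) → seq (l ++ [fst p, snd p]) ∈ T := by
    intro l hl he p hp hi
    obtain ⟨x, hx, y, hy, rfl⟩ := ZFSet.mem_prod.1 (hdκ hp)
    rw [fst_pair, snd_pair]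
    obtain ⟨h₁, h₂⟩ := (hTl l).1.1 hl
    refine (hTl _).1.2 ⟨fun z hz => ?_, h₂.append_pair he hp hi⟩
    rcases List.mem_append.1 hz with hz | hz
    · exact h₁ z hz
    · simp only [List.mem_cons, List.not_mem_nil, or_false] at hz
      rcases hz with rfl | rfl
      · exact hx
      · exact hy
  have hpair : ∀ p ∈ d, ZFSet.pair (fst p) (snd p) = p := fun p hp => by
    obtain ⟨x, hx, y, hy, rfl⟩ := ZFSet.mem_prod.1 (hdκ hp)
    simp
  -- A node ending in `p` has rank at least `v p`: every smaller value is attained by some `p'`, the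
  -- chain can be continued with `p'`, and ranks drop along extensions.
  have key : ∀ ζ < β, ∀ l : List ZFSet.{u}, ∀ p ∈ d, v p = ζ → Even l.length →
      seq (l ++ [fst p, snd p]) ∈ T → ζ ≤ ρ (seq (l ++ [fst p, snd p])) := by
    intro ζ
    induction ζ using WellFoundedLT.induction with
    | ind ζ ih =>
      intro hζ l p hp hvp he hl
      refine le_of_forall_lt fun ζ' hζ' => ?_
      obtain ⟨p', hp', hvp'⟩ := hβ ζ' (hζ'.trans hζ)
      have hl' : seq ((l ++ [fst p, snd p]) ++ [fst p', snd p']) ∈ T := by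
        refine step _ hl (by simpa using he.add (by simp)) p' hp' fun i hi => ?_
        obtain rfl : i = l.length := by simpa using hi
        rw [block_append_pair, hpair p hp, hv p hp p' hp', hvp, hvp']
        exact hζ'
      exact (ih ζ' hζ' (hζ'.trans hζ) _ p' hp' hvp' (by simpa using he.add (by simp)) hl').trans_lt
        (hlt _ _ (by simp) hl')
  have hroot : seq [] ∈ T := (hTl _).1.2 ⟨by simp, isChain_nil⟩
  have hle : β ≤ ρ (seq []) := by
    refine le_of_forall_lt fun ζ hζ => ?_
    obtain ⟨p, hp, hvp⟩ := hβ ζ hζ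
    have := step [] hroot (by simp) p hp (by simp)
    exact (key ζ hζ [] p hp hvp (by simp) this).trans_lt (hlt _ _ (by simp) this)
  exact toZFSet_mem_jensenJ_iff.2 (hle.trans_lt (toZFSet_mem_jensenJ_iff.1 (hρM _ hroot)))

/-- With `f` mapping `b` onto `α` and `g` mapping `c` onto `δ`, order the pairs `(x, y)`
lexicographically by `(f x, g y)`. The place of a pair is `δ · f x + g y`, and division with
remainder by `δ` shows that every ordinal below `δ · α` occurs. -/
theorem toZFSet_mul_mem (h : RanksTrees ψ (jensenJ θ) κ) {α δ : Ordinal.{u}}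
    (hα : α.toZFSet ∈ jensenJ θ) (hδ : δ.toZFSet ∈ jensenJ θ) : (δ * α).toZFSet ∈ jensenJ θ := by
  obtain ⟨b, hb, hbM, f, hf, hfα, hfs⟩ := h.largest.exists_app_eq h.rudClosed (isTransitive_jensenJ θ) hα
  obtain ⟨c, hc, hcM, g, hg, hgδ, hgs⟩ := h.largest.exists_app_eq h.rudClosed (isTransitive_jensenJ θ) hδ
  refine h.toZFSet_mem_of_prewellordering (d := ZFSet.prod b.toZFSet c.toZFSet)
    (R := fun p q => app f (fst q) ∈ app f (fst p) ∨
      (app f (fst q) = app f (fst p) ∧ app g (snd q) ∈ app g (snd p)))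
    (v := fun p => δ * (app f (fst p)).rank + (app g (snd p)).rank)
    (h.rudClosed _ (.prod (.const hbM) (.const hcM))) ?_ ?_ ?_ ?_
  · intro p hp
    obtain ⟨x, hx, y, hy, rfl⟩ := ZFSet.mem_prod.1 hp
    exact ZFSet.pair_mem_prod.2 ⟨Ordinal.toZFSet_subset_toZFSet_iff.2 hb hx,
      Ordinal.toZFSet_subset_toZFSet_iff.2 hc hy⟩
  · exact .or (.mem (.app (.const hf) (.fst (.proj 1))) (.app (.const hf) (.fst (.proj 0))))
      (.and (.eq (.app (.const hf) (.fst (.proj 1))) (.app (.const hf) (.fst (.proj 0))))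
        (.mem (.app (.const hg) (.snd (.proj 1))) (.app (.const hg) (.snd (.proj 0)))))
  · intro p hp q hq
    obtain ⟨x, hx, y, hy, rfl⟩ := ZFSet.mem_prod.1 hp
    obtain ⟨x', hx', y', hy', rfl⟩ := ZFSet.mem_prod.1 hq
    simp only [fst_pair, snd_pair]
    obtain ⟨ξ, hξ, hfx⟩ := Ordinal.mem_toZFSet_iff.1 (hfα x hx)
    obtain ⟨ξ', hξ', hfx'⟩ := Ordinal.mem_toZFSet_iff.1 (hfα x' hx')
    obtain ⟨η, hη, hgy⟩ := Ordinal.mem_toZFSet_iff.1 (hgδ y hy)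
    obtain ⟨η', hη', hgy'⟩ := Ordinal.mem_toZFSet_iff.1 (hgδ y' hy')
    rw [← hfx, ← hfx', ← hgy, ← hgy']
    simp only [Ordinal.toZFSet_mem_toZFSet_iff, Ordinal.toZFSet_injective.eq_iff, Ordinal.rank_toZFSet]
    have key : ∀ {ξ ξ' η η' : Ordinal.{u}}, η < δ → ξ < ξ' → δ * ξ + η < δ * ξ' + η' := by
      intro ξ ξ' η η' hη hξ
      calc δ * ξ + η < δ * ξ + δ := by gcongr
        _ = δ * (ξ + 1) := by rw [mul_add, mul_one]
        _ ≤ δ * ξ' := by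
          gcongr
          exact Order.add_one_le_of_lt hξ
        _ ≤ _ := le_self_add
    rcases lt_trichotomy ξ' ξ with hlt | rfl | hlt
    · simp only [hlt, true_or, true_iff]
      exact key hη' hlt
    · simp
    · simp only [hlt.not_gt, hlt.ne', false_and, or_self, false_iff, not_lt]
      exact (key hη hlt).le
  · intro ζ hζ
    have hδ₀ : δ ≠ 0 := by
      rintro rfl
      simp at hζ
    obtain ⟨x, hx, hfx⟩ := hfs (ζ / δ) (by rwa [← Ordinal.lt_mul_iff_div_lt hδ₀])
    obtain ⟨y, hy, hgy⟩ := hgs (ζ % δ) (Ordinal.mod_lt ζ hδ₀)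
    refine ⟨ZFSet.pair x y, ZFSet.pair_mem_prod.2 ⟨hx, hy⟩, ?_⟩
    simp only [fst_pair, snd_pair, hfx, hgy, Ordinal.rank_toZFSet, Ordinal.div_add_mod]

/-- The ordinals of `J_θ` are those below `ω · θ`. Were `θ` among them, so would be the product `ω ·
θ`. -/
theorem omega0_mul_eq (h : RanksTrees ψ (jensenJ θ) κ) : Ordinal.omega0 * θ = θ := by
  refine le_antisymm (not_lt.1 fun hlt => ?_) (Ordinal.le_mul_right _ Ordinal.omega0_pos)
  exact lt_irrefl _ (toZFSet_mem_jensenJ_iff.1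
    (h.toZFSet_mul_mem (toZFSet_mem_jensenJ_iff.2 hlt) h.omega0_mem))

theorem toZFSet_mem_iff (h : RanksTrees ψ (jensenJ θ) κ) {α : Ordinal.{u}} :
    α.toZFSet ∈ jensenJ θ ↔ α < θ := by
  rw [toZFSet_mem_jensenJ_iff, h.omega0_mul_eq]

/-- Sums are bounded by products: `α + β ≤ max α β · 2`. -/
theorem add_lt (h : RanksTrees ψ (jensenJ θ) κ) {α β : Ordinal.{u}} (hα : α < θ) (hβ : β < θ) :
    α + β < θ := by
  have h₂ : ((2 : ℕ) : Ordinal.{u}) < θ := (Ordinal.natCast_lt_omega0 2).trans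
    (h.uncountable.trans (h.lt_omega0_mul.trans_eq h.omega0_mul_eq))
  have := h.toZFSet_mem_iff.1 (h.toZFSet_mul_mem (h.toZFSet_mem_iff.2 h₂)
    (h.toZFSet_mem_iff.2 (max_lt hα hβ)))
  refine lt_of_le_of_lt ?_ this
  rw [Nat.cast_two, ← one_add_one_eq_two, mul_add, mul_one]
  exact add_le_add (le_max_left _ _) (le_max_right _ _)

end RanksTrees

/-! ### Games -/

/-- The extension of the finite sequence `s` by `x`. -/
def extend (s x : ZFSet.{u}) : ZFSet.{u} := insert (ZFSet.pair (dom s) x) s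

theorem extend_seq (l : List ZFSet.{u}) (x : ZFSet.{u}) : extend (seq l) x = seq (l ++ [x]) :=
  (seq_append_singleton l x).symm

theorem Rud.extend {P : Set ZFSet.{u}} {n : ℕ} {f g : (Fin n → ZFSet.{u}) → ZFSet.{u}}
    (hf : Rud P f) (hg : Rud P g) : Rud P fun v => ClopenGames.extend (f v) (g v) :=
  .insert (.pair hf.dom hg) hf

/-- The positions of `T` from which the player to move can reach a position in `X` with two moves,
whatever the opponent plays. -/
def winStep (X T A : ZFSet.{u}) : ZFSet.{u} :=
  ZFSet.sep (fun s => ∃ x ∈ X, extend s x ∈ T ∧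
    ∀ y ∈ X, extend (extend s x) y ∈ T → extend (extend s x) y ∈ A) T

theorem Rud.winStep {P : Set ZFSet.{u}} {X T : ZFSet.{u}} (hX : X ∈ P) (hT : T ∈ P) :
    Rud P fun v : Fin 1 → ZFSet.{u} => winStep X T (v 0) := by
  refine .sep (R := fun s v => ∃ x ∈ X, ClopenGames.extend s x ∈ T ∧ ∀ y ∈ X,
      ClopenGames.extend (ClopenGames.extend s x) y ∈ T →
        ClopenGames.extend (ClopenGames.extend s x) y ∈ v 0) (.const hT) <|
    .bex (R := fun x w => ClopenGames.extend (w 0) x ∈ T ∧ ∀ y ∈ X,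
      ClopenGames.extend (ClopenGames.extend (w 0) x) y ∈ T →
        ClopenGames.extend (ClopenGames.extend (w 0) x) y ∈ w 1) (.const hX) <|
    .and (.mem (.extend (.proj 1) (.proj 0)) (.const hT)) <|
    .ball (R := fun y w => ClopenGames.extend (ClopenGames.extend (w 1) (w 0)) y ∈ T →
        ClopenGames.extend (ClopenGames.extend (w 1) (w 0)) y ∈ w 2) (.const hX) <|
    .imp (.mem (.extend (.extend (.proj 2) (.proj 1)) (.proj 0)) (.const hT))
      (.mem (.extend (.extend (.proj 2) (.proj 1)) (.proj 0)) (.proj 3))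

theorem seq_mem_winStep {X T A : ZFSet.{u}} {l : List ZFSet.{u}} :
    seq l ∈ winStep X T A ↔ seq l ∈ T ∧ ∃ x ∈ X, seq (l ++ [x]) ∈ T ∧
      ∀ y ∈ X, seq (l ++ [x] ++ [y]) ∈ T → seq (l ++ [x] ++ [y]) ∈ A := by
  simp only [winStep, ZFSet.mem_sep, extend_seq]

/-- `W` is the set of positions of `T` that are won by the player to move. -/
def IsWinningSet (X T W : ZFSet.{u}) : Prop :=
  ∀ l : List ZFSet.{u}, seq l ∈ T →
    (seq l ∈ W ↔ ∃ x ∈ X, seq (l ++ [x]) ∈ T ∧ seq (l ++ [x]) ∉ W)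

/-- The stages of the computation of the winning set. -/
def winStage (X T : ZFSet.{u}) : Ordinal.{u} → ZFSet.{u} := recFun (accStep (winStep X T))

section
variable {X T : ZFSet.{u}} {ρ : ZFSet.{u} → Ordinal.{u}}

theorem rank_append_lt (hT : IsTreeOn X T) (hρ : ∀ s ∈ T, ∀ t ∈ T, s ⊂ t → ρ t < ρ s)
    {l m : List ZFSet.{u}} (hm : m ≠ []) (h : seq (l ++ m) ∈ T) : ρ (seq (l ++ m)) < ρ (seq l) :=
  hρ _ (hT.2 l m h) _ h (seq_ssubset_seq_append l hm)

theorem winStage_mono {δ ε : Ordinal.{u}} (h : δ ≤ ε) : winStage X T δ ⊆ winStage X T ε :=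
  recFun_accStep_mono h

/-- The positions after the replies `y` have smaller rank than `l`, so their stages come no later
than `ρ (seq l)`, and one more step captures `l`. -/
theorem seq_mem_winStage_of_forall (hT : IsTreeOn X T)
    (hρ : ∀ s ∈ T, ∀ t ∈ T, s ⊂ t → ρ t < ρ s) {l : List ZFSet.{u}} {x : ZFSet.{u}} (hl : seq l ∈ T)
    (hx : x ∈ X) (hlx : seq (l ++ [x]) ∈ T)
    (h : ∀ y ∈ X, seq (l ++ [x] ++ [y]) ∈ T →
      seq (l ++ [x] ++ [y]) ∈ winStage X T (ρ (seq (l ++ [x] ++ [y])) + 1)) :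
    seq l ∈ winStage X T (ρ (seq l) + 1) := by
  refine mem_recFun_accStep.2 ⟨ρ (seq l), by simp, seq_mem_winStep.2 ⟨hl, x, hx, hlx, fun y hy hly =>
    winStage_mono (Order.add_one_le_of_lt ?_) (h y hy hly)⟩⟩
  exact (rank_append_lt hT hρ (by simp) hly).trans (rank_append_lt hT hρ (by simp) hlx)

/-- A position that ever enters does so by the stage after its rank, so the recursion need not run
beyond the rank of the root. -/
theorem seq_mem_winStage_rank_add_one (hT : IsTreeOn X T)
    (hρ : ∀ s ∈ T, ∀ t ∈ T, s ⊂ t → ρ t < ρ s) {l : List ZFSet.{u}} {δ : Ordinal.{u}}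
    (hl : seq l ∈ winStage X T δ) : seq l ∈ winStage X T (ρ (seq l) + 1) := by
  induction δ using WellFoundedLT.induction generalizing l with
  | ind δ ih =>
    obtain ⟨ξ, hξ, h⟩ := mem_recFun_accStep.1 hl
    obtain ⟨hlT, x, hx, hlx, h⟩ := seq_mem_winStep.1 h
    exact seq_mem_winStage_of_forall hT hρ hlT hx hlx fun y hy hly => ih ξ hξ (h y hy hly)

/-- The condition in `IsWinningSet` is negative in `W`, so the stages iterate its two-move version,
which is monotone. `fix` says that nothing new enters at stage `δ`; `lose`, by induction on rank,
turns the two-move condition back into the one-move condition. -/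
theorem isWinningSet_winStage (hT : IsTreeOn X T) (hρ : ∀ s ∈ T, ∀ t ∈ T, s ⊂ t → ρ t < ρ s)
    {δ : Ordinal.{u}} (hδ : ρ (seq []) < δ) : IsWinningSet X T (winStage X T δ) := by
  have hle : ∀ l : List ZFSet.{u}, seq l ∈ T → ρ (seq l) + 1 ≤ δ := by
    intro l hl
    refine Order.add_one_le_of_lt (lt_of_le_of_lt ?_ hδ)
    rcases eq_or_ne l [] with rfl | hne
    · exact le_rfl
    · exact (rank_append_lt hT hρ (l := []) hne hl).le
  have fix : ∀ l : List ZFSet.{u}, seq l ∈ T → (seq l ∈ winStage X T δ ↔ ∃ x ∈ X, seq (l ++ [x]) ∈ T ∧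
      ∀ y ∈ X, seq (l ++ [x] ++ [y]) ∈ T → seq (l ++ [x] ++ [y]) ∈ winStage X T δ) := by
    intro l hl
    constructor
    · intro h
      obtain ⟨ξ, hξ, h⟩ := mem_recFun_accStep.1 h
      obtain ⟨-, x, hx, hlx, h⟩ := seq_mem_winStep.1 h
      exact ⟨x, hx, hlx, fun y hy hly => winStage_mono hξ.le (h y hy hly)⟩
    · rintro ⟨x, hx, hlx, h⟩
      exact winStage_mono (hle l hl) (seq_mem_winStage_of_forall hT hρ hl hx hlx fun y hy hly =>
        seq_mem_winStage_rank_add_one hT hρ (h y hy hly))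
  have lose : ∀ l : List ZFSet.{u}, seq l ∈ T → (seq l ∉ winStage X T δ ↔
      ∀ y ∈ X, seq (l ++ [y]) ∈ T → seq (l ++ [y]) ∈ winStage X T δ) := by
    intro l
    induction h : ρ (seq l) using WellFoundedLT.induction generalizing l with
    | ind ξ ih =>
      subst h
      intro hl
      rw [fix l hl]
      push Not
      refine forall₂_congr fun x hx => forall_congr' fun hlx => ?_
      have := ih _ (rank_append_lt hT hρ (by simp) hlx) (l ++ [x]) rfl hlx
      rw [← not_iff_not, this]
      push Not
      rfl
  intro l hl
  rw [← not_iff_not, lose l hl]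
  push Not
  rfl

/-- All positions in which, so far, the player to move in a won position has always made the least
winning move. -/
def leastStrategy (X T W : ZFSet.{u}) : ZFSet.{u} :=
  ZFSet.sep (fun s => ∀ t ∈ T, ∀ x ∈ X, extend t x ⊆ s → t ∈ W → extend t x ∉ W ∧
    ∀ y ∈ x, extend t y ∈ T → extend t y ∈ W) T

theorem leastStrategy_mem {M W : ZFSet.{u}} (hM : RudClosed M) (hX : X ∈ M) (hT : T ∈ M) (hW : W ∈ M) :
    leastStrategy X T W ∈ M := by
  refine hM _ <| .sep (R := fun s _ => ∀ t ∈ T, ∀ x ∈ X, extend t x ⊆ s → t ∈ W → extend t x ∉ W ∧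
      ∀ y ∈ x, extend t y ∈ T → extend t y ∈ W) (.const hT) <|
    .ball (R := fun t w => ∀ x ∈ X, extend t x ⊆ w 0 → t ∈ W → extend t x ∉ W ∧
      ∀ y ∈ x, extend t y ∈ T → extend t y ∈ W) (.const hT) <|
    .ball (R := fun x w => extend (w 0) x ⊆ w 1 → w 0 ∈ W → extend (w 0) x ∉ W ∧
      ∀ y ∈ x, extend (w 0) y ∈ T → extend (w 0) y ∈ W) (.const hX) <|
    .imp (.subset (.extend (.proj 1) (.proj 0)) (.proj 2)) <|
    .imp (.mem (.proj 1) (.const hW)) <|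
    .and (.not (.mem (.extend (.proj 1) (.proj 0)) (.const hW))) <|
    .ball (R := fun y w => extend (w 1) y ∈ T → extend (w 1) y ∈ W) (.proj 0) <|
    .imp (.mem (.extend (.proj 2) (.proj 0)) (.const hT))
      (.mem (.extend (.proj 2) (.proj 0)) (.const hW))

theorem seq_mem_leastStrategy {W : ZFSet.{u}} (hT : IsTreeOn X T) {l : List ZFSet.{u}} :
    seq l ∈ leastStrategy X T W ↔ seq l ∈ T ∧ ∀ k x, k ++ [x] <+: l → seq k ∈ W →
      seq (k ++ [x]) ∉ W ∧ ∀ y ∈ x, seq (k ++ [y]) ∈ T → seq (k ++ [y]) ∈ W := by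
  rw [leastStrategy, ZFSet.mem_sep]
  refine and_congr_right fun hl => ?_
  constructor
  · rintro h k x ⟨m, rfl⟩ hk
    have hkx : seq (k ++ [x]) ∈ T := hT.2 _ _ hl
    obtain ⟨l', hl', hll'⟩ := hT.1 _ hkx
    obtain rfl := seq_injective hll'
    have := h (seq k) (hT.2 _ _ hkx) x (hl' x (by simp))
    simp only [extend_seq] at this
    exact this (seq_subset_seq.2 ⟨m, rfl⟩) hk
  · intro h t ht x _ hx htW
    obtain ⟨k, -, rfl⟩ := hT.1 t ht
    simp only [extend_seq] at hx ⊢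
    exact h k x (seq_subset_seq.1 hx) htW

theorem seq_append_mem_leastStrategy {W : ZFSet.{u}} (hT : IsTreeOn X T) {l : List ZFSet.{u}}
    {x : ZFSet.{u}} (hl : seq l ∈ leastStrategy X T W) :
    seq (l ++ [x]) ∈ leastStrategy X T W ↔ seq (l ++ [x]) ∈ T ∧ (seq l ∈ W →
      seq (l ++ [x]) ∉ W ∧ ∀ y ∈ x, seq (l ++ [y]) ∈ T → seq (l ++ [y]) ∈ W) := by
  rw [seq_mem_leastStrategy hT] at hl ⊢
  refine and_congr_right fun _ => ⟨fun h => h l x (List.prefix_refl _), fun h k y hk => ?_⟩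
  rcases List.prefix_concat_iff.1 hk with hk | hk
  · obtain ⟨rfl, hxy⟩ := List.append_inj' hk rfl
    obtain rfl := List.singleton_inj.1 hxy
    exact h
  · exact hl.2 k y hk

theorem leastStrategy_of_append {W : ZFSet.{u}} (hT : IsTreeOn X T) {l m : List ZFSet.{u}}
    (h : seq (l ++ m) ∈ leastStrategy X T W) : seq l ∈ leastStrategy X T W := by
  rw [seq_mem_leastStrategy hT] at h ⊢
  exact ⟨hT.2 _ _ h.1, fun k x hk => h.2 k x (hk.trans ⟨m, rfl⟩)⟩

/-- Membership in `W` alternates along the strategy: from a won position the chosen move leaves `W`,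
from a lost one every legal move enters `W`. So it is the same player who moves at all won
positions. -/
theorem seq_mem_iff_of_mem_leastStrategy {W : ZFSet.{u}} (hT : IsTreeOn X T)
    (hW : IsWinningSet X T W) {l : List ZFSet.{u}} (hl : seq l ∈ leastStrategy X T W) :
    seq l ∈ W ↔ (Even l.length ↔ seq [] ∈ W) := by
  induction l using List.reverseRecOn with
  | nil => simp
  | append_singleton l x ih =>
    have hl' := leastStrategy_of_append hT hl
    have hlT := ((seq_mem_leastStrategy hT).1 hl').1
    obtain ⟨hlx, h⟩ := (seq_append_mem_leastStrategy hT hl').1 hl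
    have hx : x ∈ X := by
      obtain ⟨l', hl', hll'⟩ := hT.1 _ hlx
      obtain rfl := seq_injective hll'
      exact hl' x (by simp)
    have hiff : seq (l ++ [x]) ∈ W ↔ seq l ∉ W := by
      refine ⟨fun h₁ h₂ => (h h₂).1 h₁, fun h₁ => ?_⟩
      by_contra h₂
      exact h₁ ((hW l hlT).2 ⟨x, hx, hlx, h₂⟩)
    rw [hiff, ih hl', List.length_append, List.length_singleton, Nat.even_add_one]
    tauto

/-- One set serves both cases: the winner is the player to move at positions in `W`, namely I if the
root is in `W` and II otherwise. At that player's turns the least winning ordinal is the unique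
move; at the others no legal move is excluded. -/
theorem exists_isWinningStrategy_leastStrategy {κ : Ordinal.{u}} {W : ZFSet.{u}}
    (hT : IsTreeOn κ.toZFSet T) (hroot : seq [] ∈ T) (hW : IsWinningSet κ.toZFSet T W) :
    ∃ p : Player, IsWinningStrategy p κ.toZFSet T (leastStrategy κ.toZFSet T W) := by
  have hp : ∃ p : Player, ∀ n, p.MovesAt n ↔ (Even n ↔ seq [] ∈ W) := by
    by_cases h : seq [] ∈ W
    · exact ⟨.I, fun n => by simp [Player.MovesAt, h]⟩
    · exact ⟨.II, fun n => by simp [Player.MovesAt, h]⟩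
  obtain ⟨p, hp⟩ := hp
  have hsub : leastStrategy κ.toZFSet T W ⊆ T := fun s hs => (ZFSet.mem_sep.1 hs).1
  refine ⟨p, ⟨fun s hs => hT.1 s (hsub hs), fun l m => leastStrategy_of_append hT⟩, hsub, ?_, ?_, ?_⟩
  · exact (seq_mem_leastStrategy hT).2 ⟨hroot, fun k x hk => by simp at hk⟩
  · intro l hl hpl
    rw [hp, ← seq_mem_iff_of_mem_leastStrategy hT hW hl] at hpl
    simp only [seq_append_mem_leastStrategy hT hl, hpl, true_imp_iff]
    have hne : {ξ : Ordinal.{u} | ξ < κ ∧ seq (l ++ [ξ.toZFSet]) ∈ T ∧ seq (l ++ [ξ.toZFSet]) ∉ W}.Nonempty := by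
      obtain ⟨x, hx, h⟩ := (hW l (hsub hl)).1 hpl
      obtain ⟨ξ, hξ, rfl⟩ := Ordinal.mem_toZFSet_iff.1 hx
      exact ⟨ξ, hξ, h⟩
    obtain ⟨ξ, ⟨hξ, hξT, hξW⟩, hmin⟩ := wellFounded_lt.has_min _ hne
    refine ⟨ξ.toZFSet, ⟨Ordinal.toZFSet_mem_toZFSet_iff.2 hξ, hξT, hξW, fun y hy hyT => ?_⟩, ?_⟩
    · obtain ⟨η, hη, rfl⟩ := Ordinal.mem_toZFSet_iff.1 hy
      by_contra hyW
      exact hmin η ⟨hη.trans hξ, hyT, hyW⟩ hη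
    · rintro x ⟨hx, hxT, hxW, hxmin⟩
      obtain ⟨η, hη, rfl⟩ := Ordinal.mem_toZFSet_iff.1 hx
      rcases lt_trichotomy η ξ with h | rfl | h
      · exact absurd h (hmin η ⟨hη, hxT, hxW⟩)
      · rfl
      · exact absurd (hxmin _ (Ordinal.toZFSet_mem_toZFSet_iff.2 h) hξT) hξW
  · intro l hl hpl x _
    rw [hp, ← seq_mem_iff_of_mem_leastStrategy hT hW hl] at hpl
    simp [seq_append_mem_leastStrategy hT hl, hpl]

end

/-! ### Clopen determinacy in J_θ and in L_θ -/

theorem RanksTrees.clopenDeterminacyIn {ψ : setLang.Formula (Fin 1)} {θ κ : Ordinal.{u}}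
    (h : RanksTrees ψ (jensenJ θ) κ) : ClopenDeterminacyIn (jensenJ θ) κ.toZFSet := by
  intro T hTθ hT hroot hwf
  obtain ⟨ρ, hρ, hρθ⟩ := (h.ranked T hTθ hT hwf).exists_rank h.rudClosed (isTransitive_jensenJ θ)
  have hlim : Order.IsSuccLimit θ := h.omega0_mul_eq ▸ isSuccLimit_omega0_mul (zero_lt_one.trans h.one_lt)
  obtain ⟨α, hα, hTα⟩ := (mem_jensenJ_limit hlim).1 hTθ
  obtain ⟨β, hβ, hκβ⟩ := (mem_jensenJ_limit hlim).1 h.largest.1.1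
  have hγ : max α β < θ := max_lt hα hβ
  have hδ : ρ (seq []) + 1 < θ := hlim.add_one_lt (h.toZFSet_mem_iff.1 (hρθ _ hroot))
  -- The length `ω · (ρ(∅) + 1)` exceeds the rank of the root and has the form required by the
  -- recursion principle. The resulting level `max α β + (ρ(∅) + 1) + 1` is below `θ` by closure
  -- under addition.
  have hW : winStage κ.toZFSet T (Ordinal.omega0 * (ρ (seq []) + 1)) ∈ jensenJ θ := by
    have := rudHierarchy_jensenJ.value_mem (recFun_eq (accStep (winStep κ.toZFSet T)))
      (α := max α β) (.accStep (.winStep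
        (jensenJ_mono ((le_max_right α β).trans le_self_add) hκβ)
        (jensenJ_mono ((le_max_left α β).trans le_self_add) hTα))) (ρ (seq []) + 1) 0
    rw [Nat.cast_zero, add_zero] at this
    exact jensenJ_mono (hlim.add_one_lt (h.add_lt hγ hδ)).le this
  obtain ⟨p, hp⟩ := exists_isWinningStrategy_leastStrategy hT hroot
    (isWinningSet_winStage hT hρ (δ := Ordinal.omega0 * (ρ (seq []) + 1))
      ((Order.lt_add_one_iff.2 le_rfl).trans_le (Ordinal.le_mul_right _ Ordinal.omega0_pos)))
  exact ⟨p, _, leastStrategy_mem h.rudClosed h.largest.1.1 hTθ hW, hp⟩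

theorem RanksTrees.jensenJ_eq_godelL {ψ : setLang.Formula (Fin 1)} {θ κ : Ordinal.{u}}
    (h : RanksTrees ψ (jensenJ θ) κ) : jensenJ θ = godelL θ :=
  ClopenGames.jensenJ_eq_godelL (zero_lt_one.trans h.one_lt) h.omega0_mul_eq

end ClopenGames

end

theorem theorem3p1 (ψ : ClopenGames.setLang.Formula (Fin 1)) (_hψ : ClopenGames.IsPi1 ψ)
    (θ κ : Ordinal.{u}) (_hθ : ClopenGames.IsTheta ψ θ)
    (_hκ : ClopenGames.IsLargestCardinalIn (ClopenGames.jensenJ θ) κ) :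
    ClopenGames.ClopenDeterminacyIn (ClopenGames.godelL θ) κ.toZFSet := by
  obtain ⟨κ', h⟩ := _hθ.1
  obtain rfl := _hκ.unique h.largest
  rw [← h.jensenJ_eq_godelL]
  exact h.clopenDeterminacyIn
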